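/- Let $M$ be a smooth (Hausdorff, second countable) real manifold of dimension $m$ and $B$ a complex Lie algebroid of rank $r$ over $M$: a smooth complex vector bundle with a complex linear anchor $a:B\to T_{\mathbb C}M$ and a Lie bracket on its smooth sections satisfying the Leibniz rule, such that $a$ is a homomorphism into the Lie algebra of complex vector fields. Let $d_B$ be its differential on sections of $\wedge^\bullet B^*$, put $\tilde d_B f=d_Bf/f$ for nowhere vanishing $f$, and let $Q_B=\wedge^rB\otimes\wedge^mT^*_{\mathbb C}M$, with its canonical representation $$\nabla_X(W\otimes\mu)=[X,W]\otimes\mu+W\otimes L_{a(X)}\mu .$$ Let $\mathcal S$ and $\mathcal S^\times$ be the sheaves of smooth complex valued, resp. smooth nowhere vanishing complex valued, functions, and $\Omega^k_B$ the sheaf of sections of $\wedge^kB^*$. Let $H^\bullet(B,\mathbb C)$ be the cohomology of $d_B$ on global sections, and $\tilde H^\bullet(B,\mathbb C)$ the Čech hypercohomology (colimit over open covers of the total cohomology of the Čech double complex) of $$\mathcal S^{\times}\xrightarrow{\tilde d_B}\Omega^1_B\xrightarrow{d_B}\Omega^2_B\to\cdots .$$ A class in $\tilde H^1(B,\mathbb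 C)$ is represented by 1-forms $\xi_i$ on $U_i$ with $d_B\xi_i=0$ and nowhere vanishing functions $f_{ij}$ on $U_i\cap U_j$ with $\xi_i=\xi_j+\tilde d_Bf_{ij}$ and $f_{ij}f_{jk}=f_{ik}$; the coboundaries are the pairs $(\tilde d_Bh_i,\,h_i/h_j)$. For the connecting map $\tau$ in $$H^1(B,\mathbb C)\to\tilde H^1(B,\mathbb C)\xrightarrow{\tau}H^2(M,\mathbb Z),$$ $\tau[(\xi_i,f_{ij})]=[n_{ijk}]$ where, after refining the cover and changing the representative, $f_{ij}=\exp h_{ij}$ and $2\pi i\,n_{ijk}=h_{jk}-h_{ik}+h_{ij}$; the first map is $[\xi]\mapsto[(\xi|_{U_i},1)]$. For local nowhere vanishing sections $\omega_i$ of $Q_B$, on the sets $U_i$ of an open cover, with $\omega_i=f_{ij}\omega_j$, let $\xi_i$ be the modular form of $\omega_i$, i.e. the section of $B^*$ over $U_i$ with $\nabla_X\omega_i=\langle\xi_i,X\rangle\omega_i$ for all $X$. The first Chern class $c_1(Q_B)\in H^2(M,\mathbb Z)$ is the image of $[f_{ij}]\in H^1(M,\mathcal S^\times)$ under the connecting map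 of the exponential sequence $0\to\mathbb Z\to\mathcal S\to\mathcal S^\times\to0$. Then: 1. $\tau$ is a well-defined homomorphism and the above sequence is exact at $\tilde H^1(B,\mathbb C)$. 2. For every choice of local nowhere vanishing sections $\omega_i$ of $Q_B$ the modular forms $\xi_i$ exist and $(\xi_i,f_{ij})$ is a cocycle; its class $\mathrm{mod}(B)\in\tilde H^1(B,\mathbb C)$, the modular class, does not depend on the choices. Likewise $c_1(Q_B)$ is well defined. 3. $\tau(\mathrm{mod}(B))=c_1(Q_B)$. 4. If $c_1(Q_B)=0$, then $Q_B$ has a global nowhere vanishing section, and for every such section $\omega$ its modular form $\xi$ is $d_B$-closed and $\mathrm{mod}(B)$ is the image of the Evens–Lu–Weinstein class $[\xi]\in H^1(B,\mathbb C)$. 5. $B$ is unimodular, i.e. $\mathrm{mod}(B)=0$, if and only if $c_1(Q_B)=0$ and the modular form $\xi$ of some global nowhere vanishing section $\omega$ of $Q_B$ is exact: $\xi=d_Bg$ with $g\in C^\infty(M,\mathbb C)$. Equivalently, $c_1(Q_B)=0$ and for every global nowhere vanishing section $\omega$ the modular form is $\xi=\tilde d_Bg$ for some $g\in C^\infty(M,\mathbb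 C^\times)$. -/

import Mathlib

open scoped Manifold ContDiff Topology TensorProduct Bundle

noncomputable section

namespace CLieAlgd

section Base

variable {E : Type*} [NormedAddCommGroup E] [NormedSpace ℝ E]
  {M : Type*} [TopologicalSpace M] [ChartedSpace E M]

/-! ### Complexified tangent vectors -/

/-- The fibre at `x` of the complexified tangent bundle of the manifold `M` modelled on `E`. -/
abbrev CTangent (E : Type*) [NormedAddCommGroup E] [NormedSpace ℝ E]
    {M : Type*} [TopologicalSpace M] [ChartedSpace E M] (x : M) : Type _ :=
  ℂ ⊗[ℝ] TangentSpace 𝓘(ℝ, E) x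

/-- Real part of a complexified vector, `z ⊗ v ↦ (Re z) v`. -/
def reVec (V : Type*) [AddCommGroup V] [Module ℝ V] : ℂ ⊗[ℝ] V →ₗ[ℝ] V :=
  (TensorProduct.lid ℝ V).toLinearMap ∘ₗ LinearMap.rTensor V Complex.reLm

/-- Imaginary part of a complexified vector, `z ⊗ v ↦ (Im z) v`. -/
def imVec (V : Type*) [AddCommGroup V] [Module ℝ V] : ℂ ⊗[ℝ] V →ₗ[ℝ] V :=
  (TensorProduct.lid ℝ V).toLinearMap ∘ₗ LinearMap.rTensor V Complex.imLm

/-- The real vector field `Re V` of a complex vector field `V`. -/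
def reField (V : ∀ x : M, CTangent E x) (x : M) : TangentSpace 𝓘(ℝ, E) x :=
  reVec (TangentSpace 𝓘(ℝ, E) x) (V x)

/-- The real vector field `Im V` of a complex vector field `V`. -/
def imField (V : ∀ x : M, CTangent E x) (x : M) : TangentSpace 𝓘(ℝ, E) x :=
  imVec (TangentSpace 𝓘(ℝ, E) x) (V x)

/-- The derivative of a complex valued function along complexified tangent vectors at `x`,
`z ⊗ v ↦ z * df_x(v)`. -/
def cderiv (f : M → ℂ) (x : M) : CTangent E x →ₗ[ℂ] ℂ :=
  LinearMap.liftBaseChange ℂ (mvfderiv 𝓘(ℝ, E) f x).toLinearMap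

/-- The Lie bracket of complex vector fields, the complex bilinear extension of the Lie bracket
of real vector fields. -/
def cLieBracket (V W : ∀ x : M, CTangent E x) (x : M) : CTangent E x :=
  (1 : ℂ) ⊗ₜ[ℝ] (VectorField.mlieBracket 𝓘(ℝ, E) (reField V) (reField W) x
      - VectorField.mlieBracket 𝓘(ℝ, E) (imField V) (imField W) x)
    + Complex.I ⊗ₜ[ℝ] (VectorField.mlieBracket 𝓘(ℝ, E) (reField V) (imField W) x
      + VectorField.mlieBracket 𝓘(ℝ, E) (imField V) (reField W) x)

/-- Smooth real vector fields. -/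
def SmoothField [IsManifold 𝓘(ℝ, E) ∞ M] (Y : ∀ x : M, TangentSpace 𝓘(ℝ, E) x) : Prop :=
  ContMDiff 𝓘(ℝ, E) 𝓘(ℝ, E).tangent ∞ (fun x => (⟨x, Y x⟩ : TangentBundle 𝓘(ℝ, E) M))

/-! ### Complex forms of top degree and their Lie derivatives -/

/-- The fibre at `x` of `∧^m T*_ℂ M`, where `m = dim M`: complex valued alternating `m`-forms on
the real tangent space. -/
abbrev TopForm (E : Type*) [NormedAddCommGroup E] [NormedSpace ℝ E]
    {M : Type*} [TopologicalSpace M] [ChartedSpace E M] (x : M) : Type _ :=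
  (TangentSpace 𝓘(ℝ, E) x) [⋀^Fin (Module.finrank ℝ E)]→ₗ[ℝ] ℂ

/-- Smooth complex `m`-forms: those which are smooth when evaluated on smooth vector fields. -/
def SmoothTopForm [IsManifold 𝓘(ℝ, E) ∞ M] (μ : ∀ x : M, TopForm E x) : Prop :=
  ∀ Y : Fin (Module.finrank ℝ E) → ∀ x : M, TangentSpace 𝓘(ℝ, E) x,
    (∀ j, SmoothField (Y j)) →
      ContMDiff 𝓘(ℝ, E) 𝓘(ℝ, ℂ) ∞ (fun x => μ x (fun j => Y j x))

/-- `ν` is the Lie derivative of the complex `m`-form `μ` along the complex vector field `V`: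
`ν(Y₁,…,Yₘ) = V(μ(Y₁,…,Yₘ)) - ∑ⱼ μ(Y₁,…,[V,Yⱼ],…,Yₘ)` for all smooth real vector fields `Yⱼ`,
with `[V,Yⱼ] = [Re V,Yⱼ] + i [Im V,Yⱼ]`. -/
def IsLieDeriv [IsManifold 𝓘(ℝ, E) ∞ M] (V : ∀ x : M, CTangent E x)
    (μ ν : ∀ x : M, TopForm E x) : Prop :=
  ∀ Y : Fin (Module.finrank ℝ E) → ∀ x : M, TangentSpace 𝓘(ℝ, E) x,
    (∀ j, SmoothField (Y j)) → ∀ x : M,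
      ν x (fun j => Y j x) =
        cderiv (fun y => μ y (fun j => Y j y)) x (V x)
        - ∑ j, (μ x (Function.update (fun k => Y k x) j
                  (VectorField.mlieBracket 𝓘(ℝ, E) (reField V) (Y j) x))
              + Complex.I * μ x (Function.update (fun k => Y k x) j
                  (VectorField.mlieBracket 𝓘(ℝ, E) (imField V) (Y j) x)))

/-! ### Smooth functions on open subsets -/

/-- Smoothness on `s` of a complex valued function. -/
def SmoothOn (E : Type*) [NormedAddCommGroup E] [NormedSpace ℝ E]
    {M : Type*} [TopologicalSpace M] [ChartedSpace E M] (f : M → ℂ) (s : Set M) : Prop :=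
  ContMDiffOn 𝓘(ℝ, E) 𝓘(ℝ, ℂ) ∞ f s

/-- Smoothness on `s` of a nowhere vanishing complex valued function. -/
def SmoothUnitOn (E : Type*) [NormedAddCommGroup E] [NormedSpace ℝ E]
    {M : Type*} [TopologicalSpace M] [ChartedSpace E M] (f : M → ℂˣ) (s : Set M) : Prop :=
  SmoothOn E (fun y => (f y : ℂ)) s

theorem SmoothOn.mono {f : M → ℂ} {s t : Set M} (hf : SmoothOn E f s) (h : t ⊆ s) :
    SmoothOn E f t :=
  ContMDiffOn.mono hf h

theorem SmoothOn.congr {f g : M → ℂ} {s : Set M} (hf : SmoothOn E f s)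
    (h : ∀ y ∈ s, g y = f y) : SmoothOn E g s :=
  ContMDiffOn.congr hf h

theorem SmoothOn.const (c : ℂ) (s : Set M) : SmoothOn E (fun _ : M => c) s :=
  contMDiffOn_const

theorem SmoothOn.add {f g : M → ℂ} {s : Set M} (hf : SmoothOn E f s) (hg : SmoothOn E g s) :
    SmoothOn E (fun y => f y + g y) s :=
  ContMDiffOn.add hf hg

theorem SmoothOn.neg {f : M → ℂ} {s : Set M} (hf : SmoothOn E f s) :
    SmoothOn E (fun y => -f y) s :=
  ContMDiffOn.neg hf

theorem SmoothOn.comp_contDiff {f : M → ℂ} {s : Set M} (hf : SmoothOn E f s) {φ : ℂ → ℂ}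
    (hφ : ContDiff ℝ ∞ φ) : SmoothOn E (fun y => φ (f y)) s :=
  hφ.contMDiff.comp_contMDiffOn hf

theorem SmoothOn.mul {f g : M → ℂ} {s : Set M} (hf : SmoothOn E f s) (hg : SmoothOn E g s) :
    SmoothOn E (fun y => f y * g y) s := by
  have h : ContDiff ℝ ∞ (fun p : ℂ × ℂ => p.1 * p.2) := contDiff_fst.mul contDiff_snd
  exact h.contMDiff.comp_contMDiffOn (ContMDiffOn.prodMk_space hf hg)

theorem SmoothOn.mdifferentiableAt {f : M → ℂ} {s : Set M} (hf : SmoothOn E f s)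
    (hs : IsOpen s) {x : M} (hx : x ∈ s) : MDifferentiableAt 𝓘(ℝ, E) 𝓘(ℝ, ℂ) f x :=
  (ContMDiffOn.contMDiffAt hf (hs.mem_nhds hx)).mdifferentiableAt (by simp)

theorem SmoothUnitOn.mono {f : M → ℂˣ} {s t : Set M} (hf : SmoothUnitOn E f s) (h : t ⊆ s) :
    SmoothUnitOn E f t :=
  SmoothOn.mono hf h

theorem SmoothUnitOn.one (s : Set M) : SmoothUnitOn E (1 : M → ℂˣ) s :=
  SmoothOn.const 1 s

theorem SmoothUnitOn.mul {f g : M → ℂˣ} {s : Set M} (hf : SmoothUnitOn E f s)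
    (hg : SmoothUnitOn E g s) : SmoothUnitOn E (f * g) s := by
  have := SmoothOn.mul hf hg
  simpa [SmoothUnitOn] using this

theorem SmoothUnitOn.inv {f : M → ℂˣ} {s : Set M} (hf : SmoothUnitOn E f s) :
    SmoothUnitOn E f⁻¹ s := by
  intro x hx
  have h : ContDiffAt ℝ ∞ (fun z : ℂ => z⁻¹) (f x : ℂ) :=
    contDiffAt_inv ℝ (f x).ne_zero
  have := ContMDiffAt.comp_contMDiffWithinAt x h.contMDiffAt (hf x hx)
  simpa [Function.comp_def] using this

theorem cderiv_const (c : ℂ) (x : M) : cderiv (E := E) (fun _ : M => c) x = 0 := by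
  have h : mvfderiv 𝓘(ℝ, E) (fun _ : M => c) x = 0 := mvfderiv_const c
  rw [cderiv, h]
  ext v
  simp

theorem cderiv_add {f g : M → ℂ} {x : M} (hf : MDifferentiableAt 𝓘(ℝ, E) 𝓘(ℝ, ℂ) f x)
    (hg : MDifferentiableAt 𝓘(ℝ, E) 𝓘(ℝ, ℂ) g x) :
    cderiv (E := E) (fun y => f y + g y) x = cderiv f x + cderiv g x := by
  have h : mvfderiv 𝓘(ℝ, E) (fun y => f y + g y) x
      = mvfderiv 𝓘(ℝ, E) f x + mvfderiv 𝓘(ℝ, E) g x := mvfderiv_add hf hg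
  rw [cderiv, h]
  ext v
  simp [cderiv]

theorem cderiv_neg (f : M → ℂ) (x : M) :
    cderiv (E := E) (fun y => -f y) x = -cderiv f x := by
  have h : mvfderiv 𝓘(ℝ, E) (fun y => -f y) x
      = -mvfderiv 𝓘(ℝ, E) f x := mvfderiv_neg
  rw [cderiv, h]
  ext v
  simp [cderiv]

theorem cderiv_congr {f g : M → ℂ} {x : M} (h : f =ᶠ[𝓝 x] g) :
    cderiv (E := E) f x = cderiv g x := by
  have h1 : mvfderiv 𝓘(ℝ, E) f x = mvfderiv 𝓘(ℝ, E) g x := by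
    ext v
    simp only [mvfderiv, ContinuousLinearMap.comp_apply]
    rw [h.mfderiv_eq]
    rfl
  rw [cderiv, cderiv, h1]

theorem cderiv_mul {f g : M → ℂ} {x : M} (hf : MDifferentiableAt 𝓘(ℝ, E) 𝓘(ℝ, ℂ) f x)
    (hg : MDifferentiableAt 𝓘(ℝ, E) 𝓘(ℝ, ℂ) g x) :
    cderiv (E := E) (fun y => f y * g y) x = f x • cderiv g x + g x • cderiv f x := by
  ext v
  have h := congrArg (fun l => l v) (hf.hasMFDerivAt.mul hg.hasMFDerivAt).mfderiv
  simp only [cderiv, mvfderiv, TensorProduct.AlgebraTensorModule.curry_apply,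
    TensorProduct.curry_apply, LinearMap.coe_restrictScalars, LinearMap.liftBaseChange_tmul,
    LinearMap.add_apply, LinearMap.smul_apply, one_smul]
  exact h

theorem cderiv_exp {f : M → ℂ} {x : M} (hf : MDifferentiableAt 𝓘(ℝ, E) 𝓘(ℝ, ℂ) f x) :
    cderiv (E := E) (fun y => Complex.exp (f y)) x = Complex.exp (f x) • cderiv f x := by
  ext v
  have h0 : HasFDerivAt Complex.exp ((Complex.exp (f x) • (1 : ℂ →L[ℂ] ℂ)).restrictScalars ℝ) (f x) :=
    (Complex.hasStrictDerivAt_exp (f x)).hasDerivAt.complexToReal_fderiv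
  have h := congrArg (fun l => l v) (h0.hasMFDerivAt.comp x hf.hasMFDerivAt).mfderiv
  simp only [cderiv, mvfderiv, TensorProduct.AlgebraTensorModule.curry_apply,
    TensorProduct.curry_apply, LinearMap.coe_restrictScalars, LinearMap.liftBaseChange_tmul,
    LinearMap.smul_apply, one_smul]
  exact h

/-! ### Čech cohomology of `M` with coefficients in `ℤ` and in nowhere vanishing functions

Čech cohomology is the colimit, over all open covers of `M`, of the cohomology of the Čech complexes.
It suffices to use the covers indexed by the points of `M` themselves, `U p` being an open
neighbourhood of `p`: every cover is refined by such a one, and these are directed by inclusion.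
Cochains are written as families of functions on all of `M`, of which only the restrictions to
the finite intersections of the cover matter: all conditions are imposed there only, and two
families which agree there differ by a coboundary. Passing to a finer cover then leaves the family
unchanged, so that the colimit of the groups (cocycles of `U`)/(coboundaries of `U`) is the quotient
of the directed union of the cocycle groups by that of the coboundary groups. -/

/-- An open cover of `M` indexed by the points of `M`, with `p ∈ U p`. -/
def NbhdCover (U : M → Set M) : Prop := ∀ p, IsOpen (U p) ∧ p ∈ U p

theorem NbhdCover.univ : NbhdCover (fun _ : M => (Set.univ : Set M)) :=
  fun _ => ⟨isOpen_univ, trivial⟩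

theorem NbhdCover.inter {U V : M → Set M} (hU : NbhdCover U) (hV : NbhdCover V) :
    NbhdCover (fun p => U p ∩ V p) :=
  fun p => ⟨(hU p).1.inter (hV p).1, (hU p).2, (hV p).2⟩

/-- Čech 2-cocycles with values in the locally constant sheaf `ℤ`. -/
def intCocycle (M : Type*) [TopologicalSpace M] : AddSubgroup (M → M → M → M → ℤ) where
  carrier := {n | ∃ U : M → Set M, NbhdCover U ∧
    (∀ p q r, ContinuousOn (n p q r) (U p ∩ U q ∩ U r)) ∧
    ∀ p q r s, ∀ y ∈ U p ∩ U q ∩ U r ∩ U s,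
      n q r s y - n p r s y + n p q s y - n p q r y = 0}
  zero_mem' := ⟨_, NbhdCover.univ, fun _ _ _ => continuousOn_const, by simp⟩
  add_mem' := by
    rintro a b ⟨U, hU, h1, h2⟩ ⟨V, hV, k1, k2⟩
    refine ⟨_, hU.inter hV, fun p q r => ?_, fun p q r s y hy => ?_⟩
    · exact ((h1 p q r).mono (by grind)).add ((k1 p q r).mono (by grind))
    · have e1 := h2 p q r s y (by grind)
      have e2 := k2 p q r s y (by grind)
      simp only [Pi.add_apply]
      linarith
  neg_mem' := by
    rintro a ⟨U, hU, h1, h2⟩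
    refine ⟨U, hU, fun p q r => (h1 p q r).neg, fun p q r s y hy => ?_⟩
    have e1 := h2 p q r s y hy
    simp only [Pi.neg_apply]
    linarith

/-- Čech 2-coboundaries with values in the locally constant sheaf `ℤ`. -/
def intCoboundary (M : Type*) [TopologicalSpace M] : AddSubgroup (M → M → M → M → ℤ) where
  carrier := {n | ∃ U : M → Set M, NbhdCover U ∧ ∃ m : M → M → M → ℤ,
    (∀ p q, ContinuousOn (m p q) (U p ∩ U q)) ∧
    ∀ p q r, ∀ y ∈ U p ∩ U q ∩ U r, n p q r y = m q r y - m p r y + m p q y}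
  zero_mem' := ⟨_, NbhdCover.univ, 0, fun _ _ => continuousOn_const, by simp⟩
  add_mem' := by
    rintro a b ⟨U, hU, m, h1, h2⟩ ⟨V, hV, l, k1, k2⟩
    refine ⟨_, hU.inter hV, m + l, fun p q => ?_, fun p q r y hy => ?_⟩
    · exact ((h1 p q).mono (by grind)).add ((k1 p q).mono (by grind))
    · have e1 := h2 p q r y (by grind)
      have e2 := k2 p q r y (by grind)
      simp only [Pi.add_apply]
      linarith
  neg_mem' := by
    rintro a ⟨U, hU, m, h1, h2⟩
    refine ⟨U, hU, -m, fun p q => (h1 p q).neg, fun p q r y hy => ?_⟩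
    have e1 := h2 p q r y hy
    simp only [Pi.neg_apply]
    linarith

/-- The Čech cohomology group `H²(M, ℤ)`. -/
abbrev H2Int (M : Type*) [TopologicalSpace M] : Type _ :=
  intCocycle M ⧸ (intCoboundary M).addSubgroupOf (intCocycle M)

/-- Čech 1-cocycles with values in the sheaf of smooth nowhere vanishing functions. -/
def unitCocycle (E : Type*) [NormedAddCommGroup E] [NormedSpace ℝ E]
    (M : Type*) [TopologicalSpace M] [ChartedSpace E M] :
    AddSubgroup (Additive (M → M → M → ℂˣ)) where
  carrier := {f | ∃ U : M → Set M, NbhdCover U ∧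
    (∀ p q, SmoothUnitOn E (f.toMul p q) (U p ∩ U q)) ∧
    ∀ p q r, ∀ y ∈ U p ∩ U q ∩ U r, f.toMul p q y * f.toMul q r y = f.toMul p r y}
  zero_mem' := ⟨_, NbhdCover.univ, fun _ _ => SmoothUnitOn.one _, by simp⟩
  add_mem' := by
    rintro a b ⟨U, hU, h1, h2⟩ ⟨V, hV, k1, k2⟩
    refine ⟨_, hU.inter hV, fun p q => ?_, fun p q r y hy => ?_⟩
    · exact ((h1 p q).mono (by grind)).mul ((k1 p q).mono (by grind))
    · simp only [toMul_add, Pi.mul_apply]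
      rw [← h2 p q r y (by grind), ← k2 p q r y (by grind)]
      exact mul_mul_mul_comm _ _ _ _
  neg_mem' := by
    rintro a ⟨U, hU, h1, h2⟩
    refine ⟨U, hU, fun p q => (h1 p q).inv, fun p q r y hy => ?_⟩
    simp only [toMul_neg, Pi.inv_apply]
    rw [← h2 p q r y hy, mul_inv]

/-- Čech 1-coboundaries with values in the sheaf of smooth nowhere vanishing functions. -/
def unitCoboundary (E : Type*) [NormedAddCommGroup E] [NormedSpace ℝ E]
    (M : Type*) [TopologicalSpace M] [ChartedSpace E M] :
    AddSubgroup (Additive (M → M → M → ℂˣ)) where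
  carrier := {f | ∃ U : M → Set M, NbhdCover U ∧ ∃ h : M → M → ℂˣ,
    (∀ p, SmoothUnitOn E (h p) (U p)) ∧
    ∀ p q, ∀ y ∈ U p ∩ U q, f.toMul p q y = h p y / h q y}
  zero_mem' := ⟨_, NbhdCover.univ, 1, fun _ => SmoothUnitOn.one _, by simp⟩
  add_mem' := by
    rintro a b ⟨U, hU, h, h1, h2⟩ ⟨V, hV, k, k1, k2⟩
    refine ⟨_, hU.inter hV, h * k, fun p => ?_, fun p q y hy => ?_⟩
    · exact ((h1 p).mono (by grind)).mul ((k1 p).mono (by grind))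
    · simp only [toMul_add, Pi.mul_apply]
      rw [h2 p q y (by grind), k2 p q y (by grind)]
      exact div_mul_div_comm _ _ _ _
  neg_mem' := by
    rintro a ⟨U, hU, h, h1, h2⟩
    refine ⟨U, hU, h⁻¹, fun p => (h1 p).inv, fun p q y hy => ?_⟩
    simp only [toMul_neg, Pi.inv_apply]
    rw [h2 p q y hy]
    simp [div_eq_mul_inv, mul_comm]

/-- The Čech cohomology group `H¹(M, 𝒮ˣ)`, where `𝒮ˣ` is the sheaf of smooth nowhere vanishing
complex functions (written additively). -/
abbrev H1Unit (E : Type*) [NormedAddCommGroup E] [NormedSpace ℝ E]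
    (M : Type*) [TopologicalSpace M] [ChartedSpace E M] : Type _ :=
  unitCocycle E M ⧸ (unitCoboundary E M).addSubgroupOf (unitCocycle E M)

/-- The family `n` is obtained from the family `f` by the snake construction for
`0 → ℤ → 𝒮 → 𝒮ˣ → 0`, with maps `n ↦ 2πi n` and `h ↦ exp h`: on some cover there are smooth
logarithms `h` of `f`, and `2πi n` is the Čech coboundary of `h`. -/
def IsLogCoboundary (E : Type*) [NormedAddCommGroup E] [NormedSpace ℝ E]
    {M : Type*} [TopologicalSpace M] [ChartedSpace E M]
    (f : M → M → M → ℂˣ) (n : M → M → M → M → ℤ) : Prop :=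
  ∃ U : M → Set M, NbhdCover U ∧ ∃ h : M → M → M → ℂ,
    (∀ p q, SmoothOn E (h p q) (U p ∩ U q)) ∧
    (∀ p q, ∀ y ∈ U p ∩ U q, Complex.exp (h p q y) = f p q y) ∧
    ∀ p q r, ∀ y ∈ U p ∩ U q ∩ U r,
      h q r y - h p r y + h p q y = 2 * Real.pi * Complex.I * n p q r y

/-- The graph of the connecting map `H¹(M, 𝒮ˣ) → H²(M, ℤ)` of the exponential sequence. -/
def IsExpConnecting (a : H1Unit E M) (b : H2Int M) : Prop :=
  ∃ (f : unitCocycle E M) (n : intCocycle M),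
    a = QuotientAddGroup.mk f ∧ b = QuotientAddGroup.mk n ∧
    IsLogCoboundary E (f : Additive (M → M → M → ℂˣ)).toMul n

end Base

section Algebroid

variable (E : Type*) [NormedAddCommGroup E] [NormedSpace ℝ E]
  (M : Type*) [TopologicalSpace M] [ChartedSpace E M] [IsManifold 𝓘(ℝ, E) ∞ M]
  (F : Type*) [NormedAddCommGroup F] [NormedSpace ℂ F]
  (B : M → Type*) [∀ x, AddCommGroup (B x)] [∀ x, Module ℂ (B x)]
  [∀ x, TopologicalSpace (B x)] [TopologicalSpace (Bundle.TotalSpace F B)] [FiberBundle F B]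
  [VectorBundle ℝ F B]

/-- A complex Lie algebroid structure on the smooth complex vector bundle `B` over `M`: a complex
linear bundle map `B → T_ℂ M` and a Lie bracket on the smooth sections of `B`, with the Leibniz rule,
such that the anchor is compatible with the brackets. (Complex bilinearity of the bracket is the
Leibniz rule for constant functions.) -/
structure ComplexLieAlgebroid where
  /-- the anchor -/
  anchor : ∀ x : M, B x →ₗ[ℂ] CTangent E x
  smooth_anchor : ∀ u : Cₛ^∞⟮𝓘(ℝ, E); F, B⟯,
    SmoothField (reField fun x => anchor x (u x)) ∧
    SmoothField (imField fun x => anchor x (u x))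
  /-- the bracket of smooth sections -/
  bracket : Cₛ^∞⟮𝓘(ℝ, E); F, B⟯ → Cₛ^∞⟮𝓘(ℝ, E); F, B⟯ → Cₛ^∞⟮𝓘(ℝ, E); F, B⟯
  bracket_add : ∀ u v w, bracket u (v + w) = bracket u v + bracket u w
  bracket_skew : ∀ u v, bracket u v = -bracket v u
  jacobi : ∀ u v w, bracket u (bracket v w) = bracket (bracket u v) w + bracket v (bracket u w)
  leibniz : ∀ (f : M → ℂ) (u v fv : Cₛ^∞⟮𝓘(ℝ, E); F, B⟯), SmoothOn E f Set.univ →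
    (∀ x, fv x = f x • v x) → ∀ x,
      bracket u fv x = cderiv f x (anchor x (u x)) • v x + f x • bracket u v x
  anchor_bracket : ∀ u v : Cₛ^∞⟮𝓘(ℝ, E); F, B⟯, ∀ x,
    anchor x (bracket u v x)
      = cLieBracket (fun y => anchor y (u y)) (fun y => anchor y (v y)) x

/-- The fibre at `x` of `Q_B = ∧^r B ⊗ ∧^m T*_ℂ M`, where `r` is the rank of `B` and
`m = dim M`. -/
abbrev QFiber {M : Type*} [TopologicalSpace M] [ChartedSpace E M] (F : Type*)
    [NormedAddCommGroup F] [NormedSpace ℂ F] (B : M → Type*) [∀ x, AddCommGroup (B x)]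
    [∀ x, Module ℂ (B x)] (x : M) : Type _ :=
  (⋀[ℂ]^(Module.finrank ℂ F) (B x)) ⊗[ℂ] TopForm E x

variable {E M F B}

/-- The section `u₁ ∧ … ∧ uᵣ` of `∧^r B`. -/
def wedge (u : Fin (Module.finrank ℂ F) → Cₛ^∞⟮𝓘(ℝ, E); F, B⟯) (x : M) :
    ⋀[ℂ]^(Module.finrank ℂ F) (B x) :=
  exteriorPower.ιMulti ℂ (Module.finrank ℂ F) (fun i => u i x)

variable (F) in
/-- Smoothness on a set `s` of 1-forms on `B`, i.e. of sections of `B*`: they are smooth when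
evaluated on smooth sections of `B`. -/
def SmoothFormOn (ξ : ∀ x : M, Module.Dual ℂ (B x)) (s : Set M) : Prop :=
  ∀ u : Cₛ^∞⟮𝓘(ℝ, E); F, B⟯, SmoothOn E (fun x => ξ x (u x)) s

/-- `e` is a smooth nowhere vanishing section on the open set `s` of the line bundle `Q_B`.
Smooth means that locally `e = (u₁ ∧ … ∧ uᵣ) ⊗ μ` with smooth sections `uᵢ` of `B` and a smooth
`m`-form `μ`. -/
def IsQFrameOn (e : ∀ x : M, QFiber E F B x) (s : Set M) : Prop :=
  ∀ x ∈ s, e x ≠ 0 ∧ ∃ (u : Fin (Module.finrank ℂ F) → Cₛ^∞⟮𝓘(ℝ, E); F, B⟯)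
    (μ : ∀ x : M, TopForm E x), SmoothTopForm μ ∧ ∀ᶠ y in 𝓝 x, e y = wedge u y ⊗ₜ[ℂ] μ y

/-- A system of local frames of `Q_B` on an open cover, with the functions `f p q` such that
`e p = f p q • e q` on the overlaps. -/
structure QFrames (E : Type*) [NormedAddCommGroup E] [NormedSpace ℝ E]
    (M : Type*) [TopologicalSpace M] [ChartedSpace E M] [IsManifold 𝓘(ℝ, E) ∞ M]
    (F : Type*) [NormedAddCommGroup F] [NormedSpace ℂ F]
    (B : M → Type*) [∀ x, AddCommGroup (B x)] [∀ x, Module ℂ (B x)]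
    [∀ x, TopologicalSpace (B x)] [TopologicalSpace (Bundle.TotalSpace F B)] [FiberBundle F B]
    [VectorBundle ℝ F B] where
  /-- the open cover -/
  U : M → Set M
  cover : NbhdCover U
  /-- the frames -/
  e : M → ∀ x : M, QFiber E F B x
  frame : ∀ p, IsQFrameOn (e p) (U p)
  /-- the quotients of the frames -/
  f : M → M → M → ℂˣ
  trans : ∀ p q, ∀ y ∈ U p ∩ U q, e p y = (f p q y : ℂ) • e q y

variable (E F B) in
/-- `c` is the first Chern class of the line bundle `Q_B`: the image, under the connecting map of
the exponential sequence, of the class in `H¹(M, 𝒮ˣ)` of `Q_B`, i.e. of the cocycle `f p q` given by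
`e p = f p q • e q` for local frames `e p` of `Q_B`. -/
def IsFirstChernClass (c : H2Int M) : Prop :=
  ∃ (A : QFrames E M F B) (hf : Additive.ofMul A.f ∈ unitCocycle E M),
    IsExpConnecting (QuotientAddGroup.mk (⟨_, hf⟩ : unitCocycle E M)) c

namespace ComplexLieAlgebroid

variable (L : ComplexLieAlgebroid E M F B)

/-- The anchor on sections. -/
def anchorField (u : Cₛ^∞⟮𝓘(ℝ, E); F, B⟯) (x : M) : CTangent E x := L.anchor x (u x)

/-! ### The differential in low degrees, and `H¹(B, ℂ)` -/

/-- `d_B f`, the 1-form `u ↦ a(u) f`. -/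
def d0 (f : M → ℂ) (x : M) : Module.Dual ℂ (B x) := cderiv f x ∘ₗ L.anchor x

/-- `d_B ξ (u, v) = a(u)(ξ(v)) - a(v)(ξ(u)) - ξ([u, v])`. -/
def d1 (ξ : ∀ x : M, Module.Dual ℂ (B x)) (u v : Cₛ^∞⟮𝓘(ℝ, E); F, B⟯) (x : M) : ℂ :=
  cderiv (fun y => ξ y (v y)) x (L.anchorField u x)
    - cderiv (fun y => ξ y (u y)) x (L.anchorField v x) - ξ x (L.bracket u v x)

/-- `d̃_B f = d_B f / f` for a nowhere vanishing function `f`. -/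
def dlog (f : M → ℂˣ) (x : M) : Module.Dual ℂ (B x) :=
  (f x : ℂ)⁻¹ • L.d0 (fun y => (f y : ℂ)) x

/-- `ξ` is, on the open set `s`, a smooth 1-form with `d_B ξ = 0`. -/
def IsClosedOn (ξ : ∀ x : M, Module.Dual ℂ (B x)) (s : Set M) : Prop :=
  SmoothFormOn (E := E) F ξ s ∧ ∀ u v, ∀ x ∈ s, L.d1 ξ u v x = 0

variable {L}

theorem IsClosedOn.mono {ξ : ∀ x : M, Module.Dual ℂ (B x)} {s t : Set M}
    (h : L.IsClosedOn ξ s) (hst : t ⊆ s) : L.IsClosedOn ξ t :=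
  ⟨fun u => (h.1 u).mono hst, fun u v x hx => h.2 u v x (hst hx)⟩

theorem IsClosedOn.zero (s : Set M) : L.IsClosedOn (0 : ∀ x : M, Module.Dual ℂ (B x)) s := by
  refine ⟨fun u => SmoothOn.const 0 s, fun u v x _ => ?_⟩
  simp [d1, cderiv_const]

theorem IsClosedOn.add {ξ η : ∀ x : M, Module.Dual ℂ (B x)} {s : Set M} (hs : IsOpen s)
    (h : L.IsClosedOn ξ s) (k : L.IsClosedOn η s) : L.IsClosedOn (ξ + η) s := by
  refine ⟨fun u => (h.1 u).add (k.1 u), fun u v x hx => ?_⟩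
  have e1 := h.2 u v x hx
  have e2 := k.2 u v x hx
  have hd (w : Cₛ^∞⟮𝓘(ℝ, E); F, B⟯) : cderiv (E := E) (fun y => (ξ + η) y (w y)) x
      = cderiv (fun y => ξ y (w y)) x + cderiv (fun y => η y (w y)) x :=
    cderiv_add ((h.1 w).mdifferentiableAt hs hx) ((k.1 w).mdifferentiableAt hs hx)
  rw [d1, hd, hd]
  simp only [d1, LinearMap.add_apply, Pi.add_apply] at e1 e2 ⊢
  linear_combination e1 + e2

theorem IsClosedOn.neg {ξ : ∀ x : M, Module.Dual ℂ (B x)} {s : Set M}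
    (h : L.IsClosedOn ξ s) : L.IsClosedOn (-ξ) s := by
  refine ⟨fun u => (h.1 u).neg, fun u v x hx => ?_⟩
  have e1 := h.2 u v x hx
  have hd (w : Cₛ^∞⟮𝓘(ℝ, E); F, B⟯) : cderiv (E := E) (fun y => (-ξ) y (w y)) x
      = -cderiv (fun y => ξ y (w y)) x := cderiv_neg _ _
  rw [d1, hd, hd]
  simp only [d1, LinearMap.neg_apply, Pi.neg_apply] at e1 ⊢
  linear_combination -e1

theorem dlog_one (x : M) : L.dlog 1 x = 0 := by
  have h : cderiv (E := E) (fun _ : M => (1 : ℂ)) x = 0 := cderiv_const 1 x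
  simp [dlog, d0, h]

theorem dlog_mul {f g : M → ℂˣ} {s : Set M} (hs : IsOpen s) (hf : SmoothUnitOn E f s)
    (hg : SmoothUnitOn E g s) {x : M} (hx : x ∈ s) :
    L.dlog (f * g) x = L.dlog f x + L.dlog g x := by
  have h : cderiv (E := E) (fun y => ((f * g) y : ℂ)) x = _ :=
    cderiv_mul (SmoothOn.mdifferentiableAt hf hs hx) (SmoothOn.mdifferentiableAt hg hs hx)
  ext v
  rw [dlog, d0, h]
  simp only [dlog, d0, Pi.mul_apply, Units.val_mul, LinearMap.smul_apply, LinearMap.comp_apply,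
    LinearMap.add_apply, smul_eq_mul]
  have h1 := (f x).ne_zero
  have h2 := (g x).ne_zero
  field_simp
  ring

theorem dlog_inv {f : M → ℂˣ} {s : Set M} (hs : IsOpen s) (hf : SmoothUnitOn E f s)
    {x : M} (hx : x ∈ s) : L.dlog f⁻¹ x = -L.dlog f x := by
  have h := dlog_mul (L := L) hs hf hf.inv hx
  rw [mul_inv_cancel, dlog_one] at h
  exact (neg_eq_of_add_eq_zero_right h.symm).symm

theorem d0_exp {f : M → ℂ} {s : Set M} (hs : IsOpen s) (hf : SmoothOn E f s) {x : M}
    (hx : x ∈ s) {g : M → ℂˣ} (hg : ∀ y, (g y : ℂ) = Complex.exp (f y)) :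
    L.dlog g x = L.d0 f x := by
  have h := cderiv_exp (SmoothOn.mdifferentiableAt hf hs hx)
  ext v
  simp only [dlog, d0, hg, h, LinearMap.smul_apply, LinearMap.comp_apply, smul_eq_mul]
  rw [inv_mul_cancel_left₀ (Complex.exp_ne_zero _)]

variable (L)

/-- The closed 1-forms on `B`. -/
def closedForms : AddSubgroup (∀ x : M, Module.Dual ℂ (B x)) where
  carrier := {ξ | L.IsClosedOn ξ Set.univ}
  zero_mem' := IsClosedOn.zero _
  add_mem' h k := IsClosedOn.add isOpen_univ h k
  neg_mem' h := IsClosedOn.neg h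

/-- The exact 1-forms on `B`, i.e. the forms `d_B g` with `g` smooth on `M`. -/
def exactForms : AddSubgroup (∀ x : M, Module.Dual ℂ (B x)) where
  carrier := {ξ | ∃ g : M → ℂ, SmoothOn E g Set.univ ∧ ξ = L.d0 g}
  zero_mem' := ⟨_, SmoothOn.const 0 _, by
    funext x
    simp [d0, cderiv_const]⟩
  add_mem' := by
    rintro a b ⟨g, hg, rfl⟩ ⟨k, hk, rfl⟩
    refine ⟨_, hg.add hk, ?_⟩
    funext x
    simp only [d0, Pi.add_apply]
    rw [cderiv_add (hg.mdifferentiableAt isOpen_univ trivial)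
      (hk.mdifferentiableAt isOpen_univ trivial), LinearMap.add_comp]
  neg_mem' := by
    rintro a ⟨g, hg, rfl⟩
    refine ⟨_, hg.neg, ?_⟩
    funext x
    simp only [d0, Pi.neg_apply]
    rw [cderiv_neg, LinearMap.neg_comp]

/-- The Lie algebroid cohomology group `H¹(B, ℂ)` with trivial coefficients. -/
abbrev H1 : Type _ := L.closedForms ⧸ L.exactForms.addSubgroupOf L.closedForms

/-! ### `H̃¹(B, ℂ)`

The first total cohomology of the Čech double complex with entries
`Č^k(𝒮ˣ) → Č^k(Ω¹_B) → Č^k(Ω²_B) → ⋯`. A 1-cochain is a pair `(ξ, f)`, with `ξ p` a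
1-form on `U p` and `f p q` a nowhere vanishing function on `U p ∩ U q`. The signs of the total
differential are such that `D h = (d̃ h p, h p / h q)` and
`D (ξ, f) = (d ξ p, ξ q - ξ p + d̃ f p q, f q r * (f p r)⁻¹ * f p q)`. -/

/-- The 1-cocycles of the total complex. -/
def tildeCocycle : AddSubgroup
    ((M → ∀ x : M, Module.Dual ℂ (B x)) × Additive (M → M → M → ℂˣ)) where
  carrier := {c | ∃ U : M → Set M, NbhdCover U ∧
    (∀ p, L.IsClosedOn (c.1 p) (U p)) ∧
    (∀ p q, SmoothUnitOn E (c.2.toMul p q) (U p ∩ U q)) ∧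
    (∀ p q, ∀ y ∈ U p ∩ U q, c.1 p y = c.1 q y + L.dlog (c.2.toMul p q) y) ∧
    ∀ p q r, ∀ y ∈ U p ∩ U q ∩ U r,
      c.2.toMul p q y * c.2.toMul q r y = c.2.toMul p r y}
  zero_mem' := ⟨_, NbhdCover.univ, fun _ => IsClosedOn.zero _, fun _ _ => SmoothUnitOn.one _,
    fun p q y _ => by
      have h := dlog_one (L := L) y
      simp [show ((0 : Additive (M → M → M → ℂˣ)).toMul p q) = 1 from rfl, h], by simp⟩
  add_mem' := by
    rintro a b ⟨U, hU, h1, h2, h3, h4⟩ ⟨V, hV, k1, k2, k3, k4⟩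
    refine ⟨_, hU.inter hV, fun p => ?_, fun p q => ?_, fun p q y hy => ?_,
      fun p q r y hy => ?_⟩
    · exact ((h1 p).mono (by grind)).add (hU.inter hV p).1 ((k1 p).mono (by grind))
    · exact ((h2 p q).mono (by grind)).mul ((k2 p q).mono (by grind))
    · have e := dlog_mul (L := L) ((hU.inter hV p).1.inter (hU.inter hV q).1)
        ((h2 p q).mono (by grind)) ((k2 p q).mono (by grind)) hy
      simp only [Prod.fst_add, Prod.snd_add, toMul_add, Pi.add_apply]
      rw [h3 p q y (by grind), k3 p q y (by grind)]
      refine Eq.trans ?_ (congrArg _ e.symm)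
      abel
    · simp only [Prod.snd_add, toMul_add, Pi.mul_apply]
      rw [← h4 p q r y (by grind), ← k4 p q r y (by grind)]
      exact mul_mul_mul_comm _ _ _ _
  neg_mem' := by
    rintro a ⟨U, hU, h1, h2, h3, h4⟩
    refine ⟨U, hU, fun p => (h1 p).neg, fun p q => (h2 p q).inv, fun p q y hy => ?_,
      fun p q r y hy => ?_⟩
    · have e := dlog_inv (L := L) ((hU p).1.inter (hU q).1) (h2 p q) hy
      simp only [Prod.fst_neg, Prod.snd_neg, toMul_neg, Pi.neg_apply]
      rw [h3 p q y hy, neg_add]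
      exact congrArg _ e.symm
    · simp only [Prod.snd_neg, toMul_neg, Pi.inv_apply]
      rw [← h4 p q r y hy, mul_inv]

/-- The 1-coboundaries of the total complex. -/
def tildeCoboundary : AddSubgroup
    ((M → ∀ x : M, Module.Dual ℂ (B x)) × Additive (M → M → M → ℂˣ)) where
  carrier := {c | ∃ U : M → Set M, NbhdCover U ∧ ∃ h : M → M → ℂˣ,
    (∀ p, SmoothUnitOn E (h p) (U p)) ∧
    (∀ p, ∀ y ∈ U p, c.1 p y = L.dlog (h p) y) ∧
    ∀ p q, ∀ y ∈ U p ∩ U q, c.2.toMul p q y = h p y / h q y}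
  zero_mem' := ⟨_, NbhdCover.univ, 1, fun _ => SmoothUnitOn.one _,
    fun p y _ => (dlog_one y).symm, by simp⟩
  add_mem' := by
    rintro a b ⟨U, hU, h, h1, h2, h3⟩ ⟨V, hV, k, k1, k2, k3⟩
    refine ⟨_, hU.inter hV, h * k, fun p => ?_, fun p y hy => ?_, fun p q y hy => ?_⟩
    · exact ((h1 p).mono (by grind)).mul ((k1 p).mono (by grind))
    · have e := dlog_mul (L := L) (hU.inter hV p).1
        ((h1 p).mono (by grind)) ((k1 p).mono (by grind)) hy
      simp only [Prod.fst_add, Pi.add_apply]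
      rw [h2 p y (by grind), k2 p y (by grind)]
      exact e.symm
    · simp only [Prod.snd_add, toMul_add, Pi.mul_apply]
      rw [h3 p q y (by grind), k3 p q y (by grind)]
      exact div_mul_div_comm _ _ _ _
  neg_mem' := by
    rintro a ⟨U, hU, h, h1, h2, h3⟩
    refine ⟨U, hU, h⁻¹, fun p => (h1 p).inv, fun p y hy => ?_, fun p q y hy => ?_⟩
    · have e := dlog_inv (L := L) (hU p).1 (h1 p) hy
      simp only [Prod.fst_neg, Pi.neg_apply]
      rw [h2 p y hy]
      exact e.symm
    · simp only [Prod.snd_neg, toMul_neg, Pi.inv_apply]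
      rw [h3 p q y hy]
      simp [div_eq_mul_inv, mul_comm]

/-- The group `H̃¹(B, ℂ)`. -/
abbrev HTilde1 : Type _ := L.tildeCocycle ⧸ L.tildeCoboundary.addSubgroupOf L.tildeCocycle

/-- The map of 1-cochains that sends a global 1-form `ξ` to the pair `(ξ, 1)`. -/
def toTildeCochain : (∀ x : M, Module.Dual ℂ (B x)) →+
    (M → ∀ x : M, Module.Dual ℂ (B x)) × Additive (M → M → M → ℂˣ) where
  toFun ξ := (fun _ => ξ, 0)
  map_zero' := rfl
  map_add' ξ η := by
    ext <;> simp

/-- The same on cocycles. -/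
def toTildeCocycle : L.closedForms →+ L.tildeCocycle :=
  (toTildeCochain.comp L.closedForms.subtype).codRestrict L.tildeCocycle fun ξ =>
    ⟨_, NbhdCover.univ, fun _ => ξ.2, fun _ _ => SmoothUnitOn.one _,
      fun p q y _ => by
        have h := dlog_one (L := L) y
        simp [toTildeCochain, show ((0 : Additive (M → M → M → ℂˣ)).toMul p q) = 1 from rfl, h],
      by simp [toTildeCochain]⟩

/-- The natural map `H¹(B, ℂ) → H̃¹(B, ℂ)`, induced by `exp` in form degree `0` and by the
identity in positive form degrees. -/
def toTilde : L.H1 →+ L.HTilde1 :=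
  QuotientAddGroup.map _ _ L.toTildeCocycle (by
    rintro ⟨ξ, hξ⟩ ⟨g, hg, h⟩
    have h' : ξ = L.d0 g := h
    subst h'
    refine ⟨_, NbhdCover.univ, fun _ y => Units.mk0 (Complex.exp (g y)) (Complex.exp_ne_zero _),
      fun p => ?_, fun p y _ => ?_, fun p q y _ => ?_⟩
    · exact hg.comp_contDiff Complex.contDiff_exp
    · exact (d0_exp (L := L) isOpen_univ hg trivial (fun _ => rfl)).symm
    · simp [toTildeCocycle, toTildeCochain])

/-- The graph of the connecting map `τ : H̃¹(B, ℂ) → H²(M, ℤ)` of the short exact sequence of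
complexes of sheaves `0 → ℤ → Ω_B → Ω̃_B → 0`: a cocycle `(ξ, f)` is lifted to `(ξ, h)` with
`exp h = f`, and the total differential of `(ξ, h)` is `2πi n`. -/
def IsConnecting (a : L.HTilde1) (b : H2Int M) : Prop :=
  ∃ (c : L.tildeCocycle) (n : intCocycle M),
    a = QuotientAddGroup.mk c ∧ b = QuotientAddGroup.mk n ∧
    IsLogCoboundary E c.1.2.toMul n

/-! ### The canonical representation on `Q_B` and modular classes -/

/-- `q` is the value at `x` of `∇_X e`, where `∇` is the canonical representation of `B` on `Q_B`,
`∇_X ((u₁ ∧ … ∧ uᵣ) ⊗ μ)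
  = (∑ᵢ u₁ ∧ … ∧ [X, uᵢ] ∧ … ∧ uᵣ) ⊗ μ + (u₁ ∧ … ∧ uᵣ) ⊗ (Lie derivative of μ along a(X))`. -/
def IsNablaAt (X : Cₛ^∞⟮𝓘(ℝ, E); F, B⟯) (e : ∀ x : M, QFiber E F B x) (x : M)
    (q : QFiber E F B x) : Prop :=
  ∃ (u : Fin (Module.finrank ℂ F) → Cₛ^∞⟮𝓘(ℝ, E); F, B⟯) (μ ν : ∀ x : M, TopForm E x),
    SmoothTopForm μ ∧ IsLieDeriv (L.anchorField X) μ ν ∧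
    (∀ᶠ y in 𝓝 x, e y = wedge u y ⊗ₜ[ℂ] μ y) ∧
    q = (∑ i, wedge (Function.update u i (L.bracket X (u i))) x) ⊗ₜ[ℂ] μ x
      + wedge u x ⊗ₜ[ℂ] ν x

/-- `ξ` is the modular 1-form on `s` of the frame `e` of `Q_B`: a smooth section of `B*` on `s`
with `∇_X e = ⟨ξ, X⟩ e` for all `X`. -/
def IsModularFormOn (e : ∀ x : M, QFiber E F B x) (ξ : ∀ x : M, Module.Dual ℂ (B x))
    (s : Set M) : Prop :=
  SmoothFormOn (E := E) F ξ s ∧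
    ∀ X : Cₛ^∞⟮𝓘(ℝ, E); F, B⟯, ∀ x ∈ s, L.IsNablaAt X e x (ξ x (X x) • e x)

/-- `c` is the modular class of `B`: the class of `(ξ p, f p q)`, where `e p` are local frames of
`Q_B`, `e p = f p q • e q`, and `ξ p` is the modular 1-form of `e p`. -/
def IsModularClass (c : L.HTilde1) : Prop :=
  ∃ (A : QFrames E M F B) (ξ : M → ∀ x : M, Module.Dual ℂ (B x)),
    (∀ p, L.IsModularFormOn (A.e p) (ξ p) (A.U p)) ∧
    ∃ h : (ξ, Additive.ofMul A.f) ∈ L.tildeCocycle,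
      c = QuotientAddGroup.mk (⟨_, h⟩ : L.tildeCocycle)

/-- `a` is the Evens-Lu-Weinstein modular class in `H¹(B, ℂ)` of a global frame `e` of `Q_B`: the
class of the modular 1-form of `e`. -/
def IsELWClass (e : ∀ x : M, QFiber E F B x) (a : L.H1) : Prop :=
  ∃ ξ : ∀ x : M, Module.Dual ℂ (B x), L.IsModularFormOn e ξ Set.univ ∧
    ∃ h : ξ ∈ L.closedForms, a = QuotientAddGroup.mk (⟨ξ, h⟩ : L.closedForms)

end ComplexLieAlgebroid

end Algebroid

end CLieAlgd

set_option linter.unusedSectionVars false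

/-! Forgetting the forms sends a pair (ξ, f) to the cocycle f of nowhere vanishing functions. This
gives a map `forget` from H̃¹(B, ℂ) to H¹(M, 𝒮ˣ), and τ is `forget` followed by the connecting map
`expConnecting` of the exponential sequence. Partitions of unity give H¹(M, 𝒮) = 0
(`exists_eq_sub_of_cocycle`), so `expConnecting` is injective
(`mem_unitCoboundary_of_isExpConnecting`). Hence τ[(ξ, f)] = 0 means that f is a coboundary h_i/h_j.
The forms ξ_i - d̃h_i then agree on overlaps and glue to a global closed form, which is exactness
(`range_toTilde`).

Modular forms are found locally. In the coordinate of Q_B given by frames of B and of TM, ∇_X acts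
as a(X) plus multiplication by the function tr(ad X) - tr(L_{a(X)}) (`BundleFrame.qCoord_nabla`).
Under X ↦ fX both traces acquire the same error -a(X)f, so the difference is C^∞-linear in X, that
is, a 1-form on B. By the Jacobi identity both traces are 1-cocycles for the bracket, so this form
is closed. Rescaling a frame by g adds d̃g, which is closed because g has local logarithms and d_B²
= 0.

Consequently a change of frames alters (ξ_i, f_ij) by exactly a coboundary (d̃g_i, g_i/g_j), so
mod(B) is well defined. Since `forget` maps it to the class of the transition functions of Q_B,
τ(mod(B)) = c₁(Q_B) follows from the factorization of τ. If c₁ = 0, injectivity of `expConnecting`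
makes the transition functions a coboundary. Rescaling the local frames then produces a global one,
for which mod(B) is the class of (ξ, 1).

The kernel of H¹(B, ℂ) → H̃¹(B, ℂ) consists of the classes of forms d̃g (`toTilde_mk_eq_zero_iff`).
Here g need not have a global logarithm, so for a given frame ξ need not be exact. The frame g⁻¹ω,
however, has modular form 0. This is why unimodularity reads "exact for some frame" or "d̃g for
every frame". -/

namespace CLieAlgd

/-! ### Čech cohomology: logarithms, refinements, and the connecting map of the exponential
sequence. -/

section Cech

variable {E : Type*} [NormedAddCommGroup E] [NormedSpace ℝ E]
  {M : Type*} [TopologicalSpace M] [ChartedSpace E M]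

/-! ### Smooth functions and logarithms -/

theorem SmoothOn.sub {f g : M → ℂ} {s : Set M} (hf : SmoothOn E f s) (hg : SmoothOn E g s) :
    SmoothOn E (fun y => f y - g y) s := by
  simpa [sub_eq_add_neg] using hf.add hg.neg

theorem SmoothOn.continuousOn {f : M → ℂ} {s : Set M} (hf : SmoothOn E f s) :
    ContinuousOn f s :=
  ContMDiffOn.continuousOn hf

theorem SmoothOn.of_locally {f : M → ℂ} {s : Set M}
    (h : ∀ x ∈ s, ∃ u, IsOpen u ∧ x ∈ u ∧ SmoothOn E f u) : SmoothOn E f s := by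
  refine contMDiffOn_of_locally_contMDiffOn fun x hx => ?_
  obtain ⟨u, hu, hxu, hf⟩ := h x hx
  exact ⟨u, hu, hxu, hf.mono Set.inter_subset_right⟩

theorem SmoothUnitOn.div {f g : M → ℂˣ} {s : Set M} (hf : SmoothUnitOn E f s)
    (hg : SmoothUnitOn E g s) : SmoothUnitOn E (f / g) s := by
  rw [div_eq_mul_inv]
  exact hf.mul hg.inv

theorem SmoothUnitOn.congr {f g : M → ℂˣ} {s : Set M} (hf : SmoothUnitOn E f s)
    (h : ∀ y ∈ s, g y = f y) : SmoothUnitOn E g s :=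
  SmoothOn.congr hf fun y hy => by rw [h y hy]

/-- The nowhere vanishing function `exp f`. -/
def expUnit {X : Type*} (f : X → ℂ) (y : X) : ℂˣ :=
  Units.mk0 (Complex.exp (f y)) (Complex.exp_ne_zero _)

@[simp]
theorem coe_expUnit {X : Type*} (f : X → ℂ) (y : X) : (expUnit f y : ℂ) = Complex.exp (f y) := rfl

theorem SmoothOn.expUnit {f : M → ℂ} {s : Set M} (hf : SmoothOn E f s) :
    SmoothUnitOn E (expUnit f) s :=
  hf.comp_contDiff Complex.contDiff_exp

theorem SmoothUnitOn.exists_log {f : M → ℂˣ} {s : Set M} (hs : IsOpen s)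
    (hf : SmoothUnitOn E f s) {x : M} (hx : x ∈ s) :
    ∃ V, IsOpen V ∧ x ∈ V ∧ V ⊆ s ∧ ∃ l : M → ℂ, SmoothOn E l V ∧
      ∀ y ∈ V, Complex.exp (l y) = f y := by
  have hq : SmoothOn E (fun y => (f y : ℂ) * (f x : ℂ)⁻¹) s := SmoothOn.mul hf (SmoothOn.const _ s)
  -- The quotient by the value at `x` equals 1 at `x`, so near `x` it stays in the slit plane, where
  -- the principal logarithm is smooth. Adding the constant `log (f x)` restores `f`.
  refine ⟨s ∩ (fun y => (f y : ℂ) * (f x : ℂ)⁻¹) ⁻¹' Complex.slitPlane,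
    hq.continuousOn.isOpen_inter_preimage hs Complex.isOpen_slitPlane, ⟨hx, by simp⟩,
    Set.inter_subset_left,
    fun y => Complex.log ((f y : ℂ) * (f x : ℂ)⁻¹) + Complex.log (f x), ?_, fun y hy => ?_⟩
  · refine SmoothOn.add (fun y hy => ?_) (SmoothOn.const _ _)
    exact ContMDiffAt.comp_contMDiffWithinAt (I' := 𝓘(ℝ, ℂ)) y
      ((Complex.contDiffAt_log hy.2).restrict_scalars ℝ).contMDiffAt
      (hq.mono Set.inter_subset_left y hy)
  · rw [Complex.exp_add, Complex.exp_log (by simp), Complex.exp_log (by simp)]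
    simp

theorem two_pi_I_ne_zero : (2 * Real.pi * Complex.I : ℂ) ≠ 0 := Complex.two_pi_I_ne_zero

/-- The integer `n` with `z = 2πi n`, if it exists. -/
def windingInt (z : ℂ) : ℤ := round (z / (2 * Real.pi * Complex.I)).re

theorem windingInt_spec {z : ℂ} (hz : Complex.exp z = 1) :
    z = 2 * Real.pi * Complex.I * windingInt z := by
  obtain ⟨n, hn⟩ := Complex.exp_eq_one_iff.1 hz
  have h : windingInt z = n := by
    rw [windingInt, hn, mul_div_assoc, div_self two_pi_I_ne_zero]
    simp
  rw [h, hn]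
  ring

/-- ℤ is closed in ℝ with the induced topology, and the integer is recovered continuously as the
real part of g/(2πi). -/
theorem continuousOn_int_of_eq {X : Type*} [TopologicalSpace X] {n : X → ℤ} {g : X → ℂ}
    {s : Set X} (hg : ContinuousOn g s)
    (h : ∀ y ∈ s, g y = 2 * Real.pi * Complex.I * n y) : ContinuousOn n s := by
  rw [Int.isClosedEmbedding_coe_real.isEmbedding.isInducing.continuousOn_iff]
  have h1 : ContinuousOn (fun y => (g y / (2 * Real.pi * Complex.I)).re) s :=
    Complex.continuous_re.comp_continuousOn (hg.div_const _)
  refine h1.congr fun y hy => ?_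
  simp only [Function.comp_apply]
  rw [h y hy, mul_div_cancel_left₀ _ two_pi_I_ne_zero]
  simp

theorem smoothOn_int {n : M → ℤ} {s : Set M} (hs : IsOpen s) (hn : ContinuousOn n s) :
    SmoothOn E (fun y => (n y : ℂ)) s := by
  refine SmoothOn.of_locally fun x hx => ⟨s ∩ n ⁻¹' {n x},
    hn.isOpen_inter_preimage hs (isOpen_discrete _), ⟨hx, rfl⟩, ?_⟩
  exact (SmoothOn.const (n x : ℂ) _).congr fun y hy => by rw [show n y = n x from hy.2]

/-! ### Refinements of covers -/

theorem NbhdCover.isOpen₂ {U : M → Set M} (hU : NbhdCover U) (p q : M) : IsOpen (U p ∩ U q) :=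
  (hU p).1.inter (hU q).1

/-- On a paracompact Hausdorff space a cover `U` has a refinement `V`, with refining map `r`, such
that `V p` is contained in a prescribed neighbourhood of `p` in `U (r p) ∩ U (r q)` whenever `V p`
meets `V q`. -/
theorem NbhdCover.exists_refinement {X : Type*} [TopologicalSpace X] [T2Space X]
    [ParacompactSpace X]
    {U : X → Set X} (hU : ∀ p, IsOpen (U p) ∧ p ∈ U p) (P : X → X → X → Set X)
    (hP : ∀ i j, ∀ p ∈ U i ∩ U j, P i j p ∈ 𝓝 p) :
    ∃ (V : X → Set X) (r : X → X), (∀ p, IsOpen (V p) ∧ p ∈ V p) ∧ (∀ p, V p ⊆ U (r p)) ∧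
      ∀ p q, (V p ∩ V q).Nonempty → V p ⊆ P (r p) (r q) p := by
  obtain ⟨U', hU'o, hU'c, hU'f, hU'U⟩ := precise_refinement U (fun p => (hU p).1)
    (Set.eq_univ_of_forall fun p => Set.mem_iUnion.2 ⟨p, (hU p).2⟩)
  obtain ⟨W, hWc, hWo, hWU⟩ := exists_subset_iUnion_closure_subset isClosed_univ hU'o
    (fun x _ => hU'f.point_finite x) hU'c.ge
  -- The closures of the `W i` lie in a locally finite refinement `U'`. Only the finitely many `i`
  -- whose `U' i` meets a small neighbourhood of `p` matter. If `p ∉ U' i`, the neighbourhood is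
  -- shrunk away from `closure (W i)`. Otherwise it is shrunk into `P (r p) i p`. Since `V q ⊆ W (r
  -- q)`, a point common to `V p` and `V q` excludes the first case for `i = r q`.
  have hr (p : X) : ∃ i, p ∈ W i := Set.mem_iUnion.1 (hWc (Set.mem_univ p))
  choose r hr using hr
  have key (p : X) : ∃ V, IsOpen V ∧ p ∈ V ∧ V ⊆ W (r p) ∧
      ∀ i, (V ∩ W i).Nonempty → p ∈ U' i ∧ V ⊆ P (r p) i p := by
    obtain ⟨T, hT, hTf⟩ := hU'f p
    have hfin : ∀ i ∈ {i | (U' i ∩ T).Nonempty},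
        ∃ N ∈ 𝓝 p, (N ∩ W i).Nonempty → p ∈ U' i ∧ N ⊆ P (r p) i p := by
      intro i _
      by_cases hi : p ∈ U' i
      · exact ⟨P (r p) i p, hP _ _ _ ⟨hU'U _ (hWU _ (subset_closure (hr p))), hU'U _ hi⟩,
          fun _ => ⟨hi, subset_rfl⟩⟩
      · refine ⟨(closure (W i))ᶜ, isClosed_closure.isOpen_compl.mem_nhds fun h => hi (hWU i h), ?_⟩
        rintro ⟨y, hy, hy'⟩
        exact absurd (subset_closure hy') hy
    choose! N hN hN' using hfin
    have hmem : (T ∩ W (r p)) ∩ ⋂ i ∈ {i | (U' i ∩ T).Nonempty}, N i ∈ 𝓝 p :=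
      Filter.inter_mem (Filter.inter_mem hT ((hWo _).mem_nhds (hr p)))
        ((Filter.biInter_mem hTf).2 hN)
    obtain ⟨V, hV, hVo, hpV⟩ := mem_nhds_iff.1 hmem
    refine ⟨V, hVo, hpV, fun y hy => (hV hy).1.2, ?_⟩
    rintro i ⟨y, hyV, hyW⟩
    have hi : i ∈ {i | (U' i ∩ T).Nonempty} :=
      ⟨y, hWU i (subset_closure hyW), (hV hyV).1.1⟩
    have hVN : V ⊆ N i := fun z hz => Set.mem_iInter₂.1 (hV hz).2 i hi
    obtain ⟨h1, h2⟩ := hN' i hi ⟨y, hVN hyV, hyW⟩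
    exact ⟨h1, hVN.trans h2⟩
  choose V hVo hpV hVW hVP using key
  refine ⟨V, r, fun p => ⟨hVo p, hpV p⟩,
    fun p => (hVW p).trans (subset_closure.trans ((hWU _).trans (hU'U _))), ?_⟩
  rintro p q ⟨y, hyp, hyq⟩
  exact (hVP p (r q) ⟨y, hyp, hVW q hyq⟩).2

/-- A 1-cocycle of nowhere vanishing functions has, on a finer cover, a cohomologous 1-cocycle with
smooth logarithms. -/
theorem exists_log_twist [T2Space M] [ParacompactSpace M]
    {f : Additive (M → M → M → ℂˣ)} (hf : f ∈ unitCocycle E M) :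
    ∃ W : M → Set M, NbhdCover W ∧ ∃ (k : M → M → ℂˣ) (h : M → M → M → ℂ),
      (∀ p, SmoothUnitOn E (k p) (W p)) ∧
      (∀ p q, SmoothOn E (h p q) (W p ∩ W q)) ∧
      ∀ p q, ∀ y ∈ W p ∩ W q, Complex.exp (h p q y) = (k p y * f.toMul p q y / k q y : ℂˣ) := by
  obtain ⟨U, hU, h1, h2⟩ := hf
  have hlog (i j p : M) : ∃ (P : Set M) (l : M → ℂ), p ∈ U i ∩ U j → IsOpen P ∧ p ∈ P ∧
      SmoothOn E l P ∧ ∀ y ∈ P, Complex.exp (l y) = f.toMul i j y := by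
    by_cases hp : p ∈ U i ∩ U j
    · obtain ⟨P, hP, hpP, -, l, hl, hl'⟩ := (h1 i j).exists_log (hU.isOpen₂ i j) hp
      exact ⟨P, l, fun _ => ⟨hP, hpP, hl, hl'⟩⟩
    · exact ⟨∅, 0, fun h => absurd h hp⟩
  choose P l hPl using hlog
  obtain ⟨V, r, hV, hVr, hVP⟩ := NbhdCover.exists_refinement hU
    (fun i j p => P i j p ∩ (U i ∩ U j))
    (fun i j p hp => Filter.inter_mem ((hPl i j p hp).1.mem_nhds (hPl i j p hp).2.1)
      ((hU.isOpen₂ i j).mem_nhds hp))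
  -- Covers are always indexed by the points of `M`, so passing to the refinement along `r` appears
  -- as a coboundary twist. By the cocycle identity f(rp,p) f(p,q) / f(rq,q) = f(rp,rq), and the
  -- right side has a logarithm on all of `V p` as soon as `V p` meets `V q`.
  refine ⟨fun p => U p ∩ V p, NbhdCover.inter hU hV, fun p => f.toMul (r p) p,
    fun p q => l (r p) (r q) p, fun p => ?_, fun p q => ?_, fun p q y hy => ?_⟩
  · exact (h1 (r p) p).mono fun y hy => ⟨hVr p hy.2, hy.1⟩
  · intro y hy
    have hsub := hVP p q ⟨y, hy.1.2, hy.2.2⟩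
    obtain ⟨-, -, hl, -⟩ := hPl (r p) (r q) p (hsub (hV p).2).2
    exact hl.mono (fun z hz => (hsub hz.1.2).1) y hy
  · have hsub := hVP p q ⟨y, hy.1.2, hy.2.2⟩
    obtain ⟨-, -, -, hl'⟩ := hPl (r p) (r q) p (hsub (hV p).2).2
    have hrp := hVr p hy.1.2
    have hrq := hVr q hy.2.2
    change Complex.exp (l (r p) (r q) p y) = _
    rw [hl' y (hsub hy.1.2).1, h2 (r p) p q y ⟨⟨hrp, hy.1.1⟩, hy.2.1⟩,
      ← h2 (r p) (r q) q y ⟨⟨hrp, hrq⟩, hy.2.1⟩, mul_div_cancel_right]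

/-- On a manifold with smooth partitions of unity, `H¹(M, 𝒮) = 0`. -/
theorem exists_eq_sub_of_cocycle [FiniteDimensional ℝ E] [IsManifold 𝓘(ℝ, E) ∞ M] [T2Space M]
    [SigmaCompactSpace M] {U : M → Set M} (hU : NbhdCover U) {h : M → M → M → ℂ}
    (h1 : ∀ p q, SmoothOn E (h p q) (U p ∩ U q))
    (h2 : ∀ p q r, ∀ y ∈ U p ∩ U q ∩ U r, h q r y - h p r y + h p q y = 0) :
    ∃ l : M → M → ℂ, (∀ p, SmoothOn E (l p) (U p)) ∧
      ∀ p q, ∀ y ∈ U p ∩ U q, h p q y = l p y - l q y := by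
  obtain ⟨ρ, hρ⟩ := SmoothPartitionOfUnity.exists_isSubordinate 𝓘(ℝ, E) isClosed_univ U
    (fun p => (hU p).1) fun p _ => Set.mem_iUnion.2 ⟨p, (hU p).2⟩
  have hfin (y : M) : (Function.support fun r => ρ r y).Finite := ρ.locallyFinite.point_finite y
  -- On the support of ρ_r the cocycle condition gives h_pr - h_qr = h_pq, and the weights sum to 1.
  refine ⟨fun p y => ∑ᶠ r, ρ r y • h p r y, fun p y hy => ?_, fun p q y hy => ?_⟩
  · refine (ρ.contMDiffAt_finsum fun r hr => ?_).contMDiffWithinAt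
    exact (h1 p r).contMDiffAt ((hU.isOpen₂ p r).mem_nhds ⟨hy, hρ r hr⟩)
  · have hs (p' : M) : (Function.support fun r => ρ r y • h p' r y).Finite :=
      (hfin y).subset fun r hr h0 => hr (by simp [show ρ r y = 0 from h0])
    change _ = (∑ᶠ r, ρ r y • h p r y) - ∑ᶠ r, ρ r y • h q r y
    rw [← finsum_sub_distrib (hs p) (hs q)]
    have : ∀ r, ρ r y • h p r y - ρ r y • h q r y = ρ r y • h p q y := by
      intro r
      by_cases hr : ρ r y = 0
      · simp [hr]
      · have hyr : y ∈ U r := hρ r (subset_tsupport _ hr)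
        rw [← smul_sub, show h p r y - h q r y = h p q y by
          linear_combination -h2 p q r y ⟨hy, hyr⟩]
    simp_rw [this]
    rw [← finsum_smul, ρ.sum_eq_one (Set.mem_univ y), one_smul]

/-! ### The connecting map of the exponential sequence -/

theorem IsLogCoboundary.mul {f g : M → M → M → ℂˣ} {n m : M → M → M → M → ℤ}
    (hf : IsLogCoboundary E f n) (hg : IsLogCoboundary E g m) :
    IsLogCoboundary E (f * g) (n + m) := by
  obtain ⟨U, hU, h, h1, h2, h3⟩ := hf
  obtain ⟨V, hV, k, k1, k2, k3⟩ := hg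
  refine ⟨_, hU.inter hV, h + k, fun p q => ?_, fun p q y hy => ?_, fun p q r y hy => ?_⟩
  · exact ((h1 p q).mono (by grind)).add ((k1 p q).mono (by grind))
  · simp only [Pi.add_apply, Pi.mul_apply, Units.val_mul]
    rw [Complex.exp_add, h2 p q y (by grind), k2 p q y (by grind)]
  · simp only [Pi.add_apply, Int.cast_add]
    linear_combination h3 p q r y (by grind) + k3 p q r y (by grind)

theorem IsLogCoboundary.inv {f : M → M → M → ℂˣ} {n : M → M → M → M → ℤ}
    (hf : IsLogCoboundary E f n) : IsLogCoboundary E f⁻¹ (-n) := by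
  obtain ⟨U, hU, h, h1, h2, h3⟩ := hf
  refine ⟨U, hU, -h, fun p q => (h1 p q).neg, fun p q y hy => ?_, fun p q r y hy => ?_⟩
  · simp only [Pi.neg_apply, Pi.inv_apply, Units.val_inv_eq_inv_val]
    rw [Complex.exp_neg, h2 p q y hy]
  · simp only [Pi.neg_apply, Int.cast_neg]
    linear_combination -h3 p q r y hy

/-- Up to the nonzero factor 2πi the cochain is a Čech coboundary of the logarithms, so its own
coboundary vanishes. -/
theorem IsLogCoboundary.mem_intCocycle {f : M → M → M → ℂˣ} {n : M → M → M → M → ℤ}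
    (hf : IsLogCoboundary E f n) : n ∈ intCocycle M := by
  obtain ⟨U, hU, h, h1, h2, h3⟩ := hf
  refine ⟨U, hU, fun p q r => ?_, fun p q r s y hy => ?_⟩
  · refine continuousOn_int_of_eq (g := fun y => h q r y - h p r y + h p q y) ?_ (h3 p q r)
    exact ((((h1 q r).mono (by grind)).sub ((h1 p r).mono (by grind))).add
      ((h1 p q).mono (by grind))).continuousOn
  · have e : (2 * Real.pi * Complex.I : ℂ) *
        ((n q r s y - n p r s y + n p q s y - n p q r y : ℤ) : ℂ) = 0 := by
      push_cast
      linear_combination -h3 q r s y (by grind) + h3 p r s y (by grind) - h3 p q s y (by grind)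
        + h3 p q r y (by grind)
    exact_mod_cast (mul_eq_zero.1 e).resolve_left two_pi_I_ne_zero

/-- If f = k_p/k_q and k_p = exp l_p after shrinking the cover, then h_pq - l_p + l_q exponentiates
to 1. It is therefore 2πi times an integral 1-cochain, whose coboundary is `n` because the terms in
`l` cancel. This is what makes the connecting map single-valued. -/
theorem IsLogCoboundary.mem_intCoboundary {f : M → M → M → ℂˣ} {n : M → M → M → M → ℤ}
    (hf : IsLogCoboundary E f n) (hf' : Additive.ofMul f ∈ unitCoboundary E M) :
    n ∈ intCoboundary M := by
  obtain ⟨U, hU, h, h1, h2, h3⟩ := hf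
  obtain ⟨V, hV, k, k1, k2⟩ := hf'
  have hlog (p : M) := (k1 p).exists_log (hV p).1 (hV p).2
  choose W hWo hpW hWV l hl hl' using hlog
  have hW : NbhdCover W := fun p => ⟨hWo p, hpW p⟩
  have hspec (p q y : M) (hy : y ∈ (U p ∩ W p) ∩ (U q ∩ W q)) :
      h p q y - l p y + l q y = 2 * Real.pi * Complex.I *
        windingInt (h p q y - l p y + l q y) := by
    refine windingInt_spec ?_
    have e : f p q y = k p y / k q y := k2 p q y ⟨hWV p hy.1.2, hWV q hy.2.2⟩
    rw [Complex.exp_add, Complex.exp_sub, h2 p q y ⟨hy.1.1, hy.2.1⟩, hl' p y hy.1.2,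
      hl' q y hy.2.2, e, Units.val_div_eq_div_val]
    have := (k p y).ne_zero
    have := (k q y).ne_zero
    field_simp
  refine ⟨_, hU.inter hW, fun p q y => windingInt (h p q y - l p y + l q y), fun p q => ?_,
    fun p q r y hy => ?_⟩
  · refine continuousOn_int_of_eq (g := fun y => h p q y - l p y + l q y) ?_ (hspec p q)
    exact ((((h1 p q).mono (by grind)).sub ((hl p).mono (by grind))).add
      ((hl q).mono (by grind))).continuousOn
  · have e : (2 * Real.pi * Complex.I : ℂ) * ((n p q r y
        - (windingInt (h q r y - l q y + l r y) - windingInt (h p r y - l p y + l r y)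
          + windingInt (h p q y - l p y + l q y)) : ℤ) : ℂ) = 0 := by
      push_cast
      linear_combination -h3 p q r y (by grind) + hspec q r y (by grind)
        - hspec p r y (by grind) + hspec p q y (by grind)
    have e' := (mul_eq_zero.1 e).resolve_left two_pi_I_ne_zero
    have e'' := Int.cast_eq_zero.1 e'
    linarith

theorem twist_mem_unitCoboundary {W : M → Set M} (hW : NbhdCover W) {k : M → M → ℂˣ}
    (hk : ∀ p, SmoothUnitOn E (k p) (W p)) :
    Additive.ofMul (fun p q y => k p y / k q y) ∈ unitCoboundary E M :=
  ⟨W, hW, k, hk, fun _ _ _ _ => rfl⟩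

theorem unitCoboundary_le : unitCoboundary E M ≤ unitCocycle E M := by
  rintro f ⟨U, hU, h, h1, h2⟩
  refine ⟨U, hU, fun p q => ?_, fun p q r y hy => ?_⟩
  · exact (((h1 p).mono (by grind)).div ((h1 q).mono (by grind))).congr (h2 p q)
  · rw [h2 p q y (by grind), h2 q r y (by grind), h2 p r y (by grind), div_mul_div_cancel]

/-- The logarithms `h p q` of a cocycle on a cover define an integral 2-cochain. -/
theorem exists_isLogCoboundary {f : Additive (M → M → M → ℂˣ)} (hf : f ∈ unitCocycle E M)
    {W : M → Set M} (hW : NbhdCover W) {h : M → M → M → ℂ}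
    (h1 : ∀ p q, SmoothOn E (h p q) (W p ∩ W q))
    (h2 : ∀ p q, ∀ y ∈ W p ∩ W q, Complex.exp (h p q y) = f.toMul p q y) :
    ∃ n, IsLogCoboundary E f.toMul n := by
  obtain ⟨U, hU, -, f2⟩ := hf
  refine ⟨fun p q r y => windingInt (h q r y - h p r y + h p q y), _, hW.inter hU, h,
    fun p q => (h1 p q).mono (by grind), fun p q y hy => h2 p q y (by grind),
    fun p q r y hy => windingInt_spec ?_⟩
  rw [Complex.exp_add, Complex.exp_sub, h2 p q y (by grind), h2 q r y (by grind),
    h2 p r y (by grind), ← f2 p q r y (by grind), Units.val_mul]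
  have := (f.toMul p q y).ne_zero
  have := (f.toMul q r y).ne_zero
  field_simp

/-- The sets on which `f` is defined need not carry logarithms, so a representative with an integral
coboundary is available only after adding a coboundary. The cochain `k` is kept in the statement,
since for H̃¹ the same twist must also be applied to the 1-forms. -/
theorem exists_isLogCoboundary_add [T2Space M] [ParacompactSpace M]
    {f : Additive (M → M → M → ℂˣ)} (hf : f ∈ unitCocycle E M) :
    ∃ (W : M → Set M) (k : M → M → ℂˣ) (n : M → M → M → M → ℤ), NbhdCover W ∧
      (∀ p, SmoothUnitOn E (k p) (W p)) ∧
      IsLogCoboundary E (f + Additive.ofMul fun p q y => k p y / k q y).toMul n := by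
  obtain ⟨W, hW, k, h, h1, h2, h3⟩ := exists_log_twist hf
  have hc := unitCoboundary_le (twist_mem_unitCoboundary hW h1)
  obtain ⟨n, hn⟩ := exists_isLogCoboundary (add_mem hf hc) hW h2 fun p q y hy => by
    rw [h3 p q y hy]
    simp only [toMul_add, Pi.mul_apply, toMul_ofMul]
    congr 1
    rw [mul_div_assoc', mul_comm]
  exact ⟨W, k, n, hW, h1, hn⟩

theorem IsExpConnecting.unique {a : H1Unit E M} {b b' : H2Int M} (h : IsExpConnecting a b)
    (h' : IsExpConnecting a b') : b = b' := by
  obtain ⟨f, n, rfl, rfl, hn⟩ := h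
  obtain ⟨f', n', e, rfl, hn'⟩ := h'
  refine QuotientAddGroup.eq.2 (AddSubgroup.mem_addSubgroupOf.2 ?_)
  refine (hn.inv.mul hn').mem_intCoboundary ?_
  exact AddSubgroup.mem_addSubgroupOf.1 (QuotientAddGroup.eq.1 e)

theorem IsExpConnecting.add {a a' : H1Unit E M} {b b' : H2Int M} (h : IsExpConnecting a b)
    (h' : IsExpConnecting a' b') : IsExpConnecting (a + a') (b + b') := by
  obtain ⟨f, n, rfl, rfl, hn⟩ := h
  obtain ⟨f', n', rfl, rfl, hn'⟩ := h'
  exact ⟨f + f', n + n', rfl, rfl, hn.mul hn'⟩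

theorem exists_isExpConnecting [T2Space M] [ParacompactSpace M] (a : H1Unit E M) :
    ∃ b : H2Int M, IsExpConnecting a b := by
  obtain ⟨f, rfl⟩ := QuotientAddGroup.mk_surjective a
  obtain ⟨W, k, n, hW, hk, hn⟩ := exists_isLogCoboundary_add f.2
  have hc := twist_mem_unitCoboundary hW hk
  refine ⟨_, ⟨_, add_mem f.2 (unitCoboundary_le hc)⟩, ⟨n, hn.mem_intCocycle⟩, ?_, rfl, hn⟩
  refine QuotientAddGroup.eq.2 (AddSubgroup.mem_addSubgroupOf.2 ?_)
  simpa using hc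

variable (E M) in
/-- The connecting map `H¹(M, 𝒮ˣ) → H²(M, ℤ)` of the exponential sequence. -/
def expConnecting [T2Space M] [ParacompactSpace M] : H1Unit E M →+ H2Int M :=
  AddMonoidHom.mk' (fun a => (exists_isExpConnecting a).choose) fun a b =>
    (exists_isExpConnecting (a + b)).choose_spec.unique
      ((exists_isExpConnecting a).choose_spec.add (exists_isExpConnecting b).choose_spec)

theorem isExpConnecting_iff [T2Space M] [ParacompactSpace M] {a : H1Unit E M} {b : H2Int M} :
    IsExpConnecting a b ↔ b = expConnecting E M a :=
  ⟨fun h => h.unique (exists_isExpConnecting a).choose_spec, fun h =>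
    h ▸ (exists_isExpConnecting a).choose_spec⟩

/-- The connecting map of the exponential sequence is injective on `H¹(M, 𝒮ˣ)`. -/
theorem mem_unitCoboundary_of_isExpConnecting [FiniteDimensional ℝ E] [IsManifold 𝓘(ℝ, E) ∞ M]
    [T2Space M] [SigmaCompactSpace M] [ParacompactSpace M] (f : unitCocycle E M)
    (h0 : expConnecting E M (QuotientAddGroup.mk f) = 0) :
    (f : Additive (M → M → M → ℂˣ)) ∈ unitCoboundary E M := by
  obtain ⟨f', n, e, e', U, hU, h, h1, h2, h3⟩ := isExpConnecting_iff.2 h0.symm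
  have hn := (QuotientAddGroup.eq_zero_iff n).1 e'.symm
  obtain ⟨V, hV, m, m1, m2⟩ := AddSubgroup.mem_addSubgroupOf.1 hn
  have hUV := hU.inter hV
  -- Since `n` is the coboundary of `m`, subtracting 2πi·m turns the logarithms into an additive
  -- smooth cocycle without changing their exponentials. The vanishing of H¹(M, 𝒮) then splits it.
  obtain ⟨l, l1, l2⟩ := exists_eq_sub_of_cocycle hUV
    (h := fun p q y => h p q y - 2 * Real.pi * Complex.I * m p q y)
    (fun p q => ((h1 p q).mono (by grind)).sub
      (SmoothOn.mul (SmoothOn.const (2 * Real.pi * Complex.I : ℂ) _)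
        (smoothOn_int (hUV.isOpen₂ p q) ((m1 p q).mono (by grind)))))
    (fun p q r y hy => by
      have a1 := h3 p q r y (by grind)
      rw [m2 p q r y (by grind)] at a1
      push_cast at a1
      linear_combination a1)
  have hf' : (f' : Additive (M → M → M → ℂˣ)) ∈ unitCoboundary E M := by
    refine ⟨_, hUV, fun p => expUnit (l p), fun p => (l1 p).expUnit, fun p q y hy => ?_⟩
    ext
    rw [← h2 p q y (by grind), Units.val_div_eq_div_val, coe_expUnit, coe_expUnit,
      ← Complex.exp_sub, ← l2 p q y hy, Complex.exp_sub, mul_comm _ (m p q y : ℂ),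
      Complex.exp_int_mul_two_pi_mul_I, div_one]
  have hd := AddSubgroup.mem_addSubgroupOf.1 (QuotientAddGroup.eq.1 e)
  have hd' : -(f : Additive (M → M → M → ℂˣ)) + f' ∈ unitCoboundary E M := hd
  have := sub_mem hf' hd'
  simpa using this

end Cech

/-! ### Extension of germs, and tangent frames by global vector fields. -/

section Extension

variable {E : Type*} [NormedAddCommGroup E] [NormedSpace ℝ E] [FiniteDimensional ℝ E]
  {M : Type*} [TopologicalSpace M] [ChartedSpace E M] [IsManifold 𝓘(ℝ, E) ∞ M] [T2Space M]

/-! ### Bump functions and extension of germs -/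

theorem exists_bump {N : Set M} (hN : IsOpen N) {x : M} (hx : x ∈ N) :
    ∃ χ : M → ℝ, ContMDiff 𝓘(ℝ, E) 𝓘(ℝ, ℝ) ∞ χ ∧ tsupport χ ⊆ N ∧ χ =ᶠ[𝓝 x] 1 := by
  obtain ⟨f, -, hf⟩ := (SmoothBumpFunction.nhds_basis_tsupport (I := 𝓘(ℝ, E)) x).mem_iff.1
    (hN.mem_nhds hx)
  exact ⟨f, f.contMDiff, hf, f.eventuallyEq_one⟩

/-- A smooth section on an open set agrees near each point of it with a global smooth section. -/
theorem exists_contMDiff_section_eventuallyEq {F : Type*} [NormedAddCommGroup F] [NormedSpace ℝ F]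
    {V : M → Type*} [TopologicalSpace (Bundle.TotalSpace F V)] [∀ x, TopologicalSpace (V x)]
    [FiberBundle F V] [∀ x, AddCommGroup (V x)] [∀ x, Module ℝ (V x)] [VectorBundle ℝ F V]
    {N : Set M} (hN : IsOpen N) {x : M} (hx : x ∈ N) {s : ∀ x, V x}
    (hs : ContMDiffOn 𝓘(ℝ, E) (𝓘(ℝ, E).prod 𝓘(ℝ, F)) ∞
      (fun y => (⟨y, s y⟩ : Bundle.TotalSpace F V)) N) :
    ∃ t : ∀ x, V x, ContMDiff 𝓘(ℝ, E) (𝓘(ℝ, E).prod 𝓘(ℝ, F)) ∞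
      (fun y => (⟨y, t y⟩ : Bundle.TotalSpace F V)) ∧ ∀ᶠ y in 𝓝 x, t y = s y := by
  obtain ⟨χ, hχ, hχN, hχ1⟩ := exists_bump (E := E) hN hx
  refine ⟨χ • s, ContMDiffOn.smul_section_of_tsupport hχ.contMDiffOn hN hχN hs, ?_⟩
  filter_upwards [hχ1] with y hy
  simp [hy]

/-- A smooth function on an open set agrees near each point of it with a global smooth function. -/
theorem SmoothOn.exists_extension {G : M → ℂ} {N : Set M} (hG : SmoothOn E G N) (hN : IsOpen N)
    {x : M} (hx : x ∈ N) : ∃ G' : M → ℂ, SmoothOn E G' Set.univ ∧ G' =ᶠ[𝓝 x] G := by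
  obtain ⟨χ, hχ, hχN, hχ1⟩ := exists_bump (E := E) hN hx
  refine ⟨fun y => χ y * G y, SmoothOn.of_locally fun y _ => ?_, ?_⟩
  · by_cases hy : y ∈ N
    · refine ⟨N, hN, hy, SmoothOn.mul ?_ hG⟩
      exact Complex.ofRealCLM.contDiff.contMDiff.comp_contMDiffOn hχ.contMDiffOn
    · refine ⟨(tsupport χ)ᶜ, (isClosed_tsupport χ).isOpen_compl, fun h => hy (hχN h), ?_⟩
      refine (SmoothOn.const 0 _).congr fun z hz => ?_
      simp [image_eq_zero_of_notMem_tsupport hz]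
  · filter_upwards [hχ1] with y hy
    simp [hy]

/-! ### Smooth frames of the tangent bundle -/

variable (E) in
/-- A frame of the tangent bundle on `N` by global smooth vector fields, with its dual frame. -/
structure TangentFrame (N : Set M) where
  /-- the vector fields -/
  Y : Fin (Module.finrank ℝ E) → ∀ x : M, TangentSpace 𝓘(ℝ, E) x
  smooth : ∀ i, SmoothField (Y i)
  /-- the dual frame -/
  η : Fin (Module.finrank ℝ E) → ∀ x : M, TangentSpace 𝓘(ℝ, E) x →ₗ[ℝ] ℝ
  dual : ∀ y ∈ N, ∀ i j, η i y (Y j y) = if i = j then 1 else 0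
  sum : ∀ y ∈ N, ∀ v, ∑ i, η i y v • Y i y = v
  smooth_dual : ∀ i Z, SmoothField Z → ContMDiffOn 𝓘(ℝ, E) 𝓘(ℝ, ℝ) ∞ (fun y => η i y (Z y)) N

/-- The constant frame of a local trivialization is cut off to global fields, and `N` is a
neighbourhood where the cut-off fields still agree with it. Global fields are needed because
smoothness of forms and Lie derivatives is tested on them. -/
theorem exists_tangentFrame (x : M) : ∃ N, IsOpen N ∧ x ∈ N ∧ Nonempty (TangentFrame E N) := by
  let e := trivializationAt E (TangentSpace 𝓘(ℝ, E) : M → Type _) x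
  have hxe : x ∈ e.baseSet := FiberBundle.mem_baseSet_trivializationAt' x
  let b := Module.finBasis ℝ E
  have hloc (i) : ContMDiffOn 𝓘(ℝ, E) (𝓘(ℝ, E).prod 𝓘(ℝ, E)) ∞
      (fun y => (⟨y, e.symm y (b i)⟩ : Bundle.TotalSpace E (TangentSpace 𝓘(ℝ, E) : M → Type _)))
      e.baseSet := by
    rw [e.contMDiffOn_section_baseSet_iff]
    refine (contMDiffOn_const (c := b i)).congr fun y hy => ?_
    rw [e.apply_mk_symm hy]
  have hext (i) := exists_contMDiff_section_eventuallyEq e.open_baseSet hxe (hloc i)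
  choose Y hY hYe using hext
  obtain ⟨N, hN, hNo, hxN⟩ := mem_nhds_iff.1 (Filter.inter_mem (e.open_baseSet.mem_nhds hxe)
    (Filter.eventually_all.2 hYe))
  refine ⟨N, hNo, hxN, ⟨⟨Y, hY, fun i y => b.coord i ∘ₗ e.linearMapAt ℝ y, ?_, ?_, ?_⟩⟩⟩
  · intro y hy i j
    have h1 : Y j y = e.symm y (b j) := (hN hy).2 j
    have h2 : e.linearMapAt ℝ y (e.symm y (b j)) = b j := by
      rw [e.linearMapAt_apply, if_pos (hN hy).1, e.apply_mk_symm (hN hy).1]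
    rw [h1, LinearMap.comp_apply, h2, Module.Basis.coord_apply, b.repr_self, Finsupp.single_apply]
    simp [eq_comm]
  · intro y hy v
    have h1 (j) : Y j y = e.symmₗ ℝ y (b j) := by rw [e.symmₗ_apply (hN hy).1]; exact (hN hy).2 j
    simp_rw [h1, ← map_smul, ← map_sum]
    have h2 : ∑ i, (b.coord i ∘ₗ e.linearMapAt ℝ y) v • b i = e.linearMapAt ℝ y v :=
      b.sum_repr _
    rw [h2, e.symmₗ_linearMapAt (hN hy).1]
  · intro i Z hZ
    have h1 : ContMDiffOn 𝓘(ℝ, E) 𝓘(ℝ, E) ∞ (fun y => (e ⟨y, Z y⟩).2) N :=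
      (e.contMDiffOn_section_iff hNo fun y hy => (hN hy).1).1 (ContMDiff.contMDiffOn hZ)
    refine ((LinearMap.toContinuousLinearMap (b.coord i)).contDiff.contMDiff.comp_contMDiffOn
      h1).congr fun y hy => ?_
    simp [(hN hy).1]

end Extension

/-! ### Multiplication of sections of B by complex functions. -/

section SmulSection

variable {E : Type*} [NormedAddCommGroup E] [NormedSpace ℝ E]
  {M : Type*} [TopologicalSpace M] [ChartedSpace E M]
  {F : Type*} [NormedAddCommGroup F] [NormedSpace ℂ F]
  {B : M → Type*} [∀ x, AddCommGroup (B x)] [∀ x, Module ℂ (B x)]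
  [∀ x, TopologicalSpace (B x)] [TopologicalSpace (Bundle.TotalSpace F B)] [FiberBundle F B]
  [VectorBundle ℂ F B]

theorem contMDiff_smul_section {f : M → ℂ} (hf : SmoothOn E f Set.univ)
    (u : Cₛ^∞⟮𝓘(ℝ, E); F, B⟯) : ContMDiff 𝓘(ℝ, E) (𝓘(ℝ, E).prod 𝓘(ℝ, F)) ∞
      (fun y => (⟨y, f y • u y⟩ : Bundle.TotalSpace F B)) := by
  intro x
  rw [Bundle.contMDiffAt_section]
  have h1 := (Bundle.contMDiffAt_section x).1 (u.contMDiff x)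
  have h2 : ContDiff ℝ ∞ (fun p : ℂ × F => p.1 • p.2) := contDiff_fst.smul contDiff_snd
  have h3 := h2.contMDiff.contMDiffAt.comp x ((contMDiffOn_univ.1 hf x).prodMk_space h1)
  refine h3.congr_of_eventuallyEq ?_
  filter_upwards [(trivializationAt F B x).open_baseSet.mem_nhds
    (FiberBundle.mem_baseSet_trivializationAt' x)] with y hy
  exact ((trivializationAt F B x).linear ℂ hy).map_smul _ _

/-- The product of a smooth complex function and a smooth section of `B`. -/
def smulSection (f : M → ℂ) (hf : SmoothOn E f Set.univ) (u : Cₛ^∞⟮𝓘(ℝ, E); F, B⟯) :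
    Cₛ^∞⟮𝓘(ℝ, E); F, B⟯ :=
  ⟨fun y => f y • u y, contMDiff_smul_section hf u⟩

end SmulSection

/-! ### Frames of B by global sections. -/

section BundleFrame

variable {E : Type*} [NormedAddCommGroup E] [NormedSpace ℝ E] [FiniteDimensional ℝ E]
  {M : Type*} [TopologicalSpace M] [ChartedSpace E M] [IsManifold 𝓘(ℝ, E) ∞ M] [T2Space M]
  {F : Type*} [NormedAddCommGroup F] [NormedSpace ℂ F] [FiniteDimensional ℂ F]
  {B : M → Type*} [∀ x, AddCommGroup (B x)] [∀ x, Module ℂ (B x)]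
  [∀ x, TopologicalSpace (B x)] [TopologicalSpace (Bundle.TotalSpace F B)] [FiberBundle F B]
  [VectorBundle ℂ F B] [VectorBundle ℝ F B]

/-! ### Smooth frames of `B` -/

variable (E F B) in
/-- A frame of `B` on `N` by global smooth sections, with its dual frame. -/
structure BundleFrame (N : Set M) where
  /-- the sections -/
  b : Fin (Module.finrank ℂ F) → Cₛ^∞⟮𝓘(ℝ, E); F, B⟯
  /-- the dual frame -/
  c : Fin (Module.finrank ℂ F) → ∀ x : M, Module.Dual ℂ (B x)
  dual : ∀ y ∈ N, ∀ i j, c i y (b j y) = if i = j then 1 else 0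
  sum : ∀ y ∈ N, ∀ v, ∑ i, c i y v • b i y = v
  smooth_dual : ∀ i, SmoothFormOn (E := E) F (c i) N

theorem exists_bundleFrame [ContMDiffVectorBundle ∞ F B 𝓘(ℝ, E)] (x : M) :
    ∃ N, IsOpen N ∧ x ∈ N ∧ Nonempty (BundleFrame E F B N) := by
  let e := trivializationAt F B x
  have hxe : x ∈ e.baseSet := FiberBundle.mem_baseSet_trivializationAt' x
  let b := Module.finBasis ℂ F
  have hloc (i) : ContMDiffOn 𝓘(ℝ, E) (𝓘(ℝ, E).prod 𝓘(ℝ, F)) ∞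
      (fun y => (⟨y, e.symm y (b i)⟩ : Bundle.TotalSpace F B)) e.baseSet := by
    rw [e.contMDiffOn_section_baseSet_iff]
    refine (contMDiffOn_const (c := b i)).congr fun y hy => ?_
    rw [e.apply_mk_symm hy]
  have hext (i) := exists_contMDiff_section_eventuallyEq e.open_baseSet hxe (hloc i)
  choose Y hY hYe using hext
  obtain ⟨N, hN, hNo, hxN⟩ := mem_nhds_iff.1 (Filter.inter_mem (e.open_baseSet.mem_nhds hxe)
    (Filter.eventually_all.2 hYe))
  refine ⟨N, hNo, hxN, ⟨⟨fun i => ⟨Y i, hY i⟩, fun i y => b.coord i ∘ₗ e.linearMapAt ℂ y,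
    ?_, ?_, ?_⟩⟩⟩
  · intro y hy i j
    have h1 : Y j y = e.symm y (b j) := (hN hy).2 j
    have h2 : e.linearMapAt ℂ y (e.symm y (b j)) = b j := by
      rw [e.linearMapAt_apply, if_pos (hN hy).1, e.apply_mk_symm (hN hy).1]
    rw [ContMDiffSection.coeFn_mk, h1, LinearMap.comp_apply, h2, Module.Basis.coord_apply,
      b.repr_self, Finsupp.single_apply]
    simp [eq_comm]
  · intro y hy v
    have h1 (j) : Y j y = e.symmₗ ℂ y (b j) := by rw [e.symmₗ_apply (hN hy).1]; exact (hN hy).2 j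
    simp_rw [ContMDiffSection.coeFn_mk, h1, ← map_smul, ← map_sum]
    have h2 : ∑ i, (b.coord i ∘ₗ e.linearMapAt ℂ y) v • b i = e.linearMapAt ℂ y v :=
      b.sum_repr _
    rw [h2, e.symmₗ_linearMapAt (hN hy).1]
  · intro i Z
    have h1 : ContMDiffOn 𝓘(ℝ, E) 𝓘(ℝ, F) ∞ (fun y => (e ⟨y, Z y⟩).2) N :=
      (e.contMDiffOn_section_iff hNo fun y hy => (hN hy).1).1 Z.contMDiff.contMDiffOn
    have h2 : ContDiff ℝ ∞ (b.coord i) :=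
      ((LinearMap.toContinuousLinearMap (b.coord i)).restrictScalars ℝ).contDiff
    refine (h2.contMDiff.comp_contMDiffOn h1).congr fun y hy => ?_
    simp [(hN hy).1]

end BundleFrame

/-! ### Linear algebra of alternating forms of top degree -/

/-- Both sides are alternating in the rows of `U`, so it suffices to compare them on distinct
standard basis vectors. There the indices form a permutation and both sides pick up its sign. -/
theorem alternatingMap_sum_smul {R V P ι : Type*} [CommRing R] [AddCommGroup V] [Module R V]
    [AddCommGroup P] [Module R P] [Fintype ι] [DecidableEq ι] (g : V [⋀^ι]→ₗ[R] P) (v : ι → V)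
    (U : Matrix ι ι R) : g (fun i => ∑ k, U i k • v k) = U.det • g v := by
  have h : g.compLinearMap (Fintype.linearCombination R v)
      = (LinearMap.toSpanSingleton R P (g v)).compAlternatingMap Matrix.detRowAlternating := by
    refine Module.Basis.ext_alternating (Pi.basisFun R ι) fun w hw => ?_
    have hw' : Function.Bijective w := Finite.injective_iff_bijective.1 hw
    let σ : Equiv.Perm ι := Equiv.ofBijective w hw'
    have h1 : (fun i => Pi.basisFun R ι (w i)) = (Pi.basisFun R ι) ∘ σ := rfl
    rw [h1, AlternatingMap.map_perm, AlternatingMap.map_perm]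
    congr 1
    have h2 : Matrix.detRowAlternating (⇑(Pi.basisFun R ι)) = (1 : R) := by
      rw [← Matrix.det_one (n := ι) (R := R)]
      change Matrix.det (Matrix.of fun i => Pi.basisFun R ι i) = _
      congr 1
      ext i j
      simp [Matrix.one_apply, Pi.single_apply, eq_comm]
    simp only [AlternatingMap.compLinearMap_apply, LinearMap.compAlternatingMap_apply, h2,
      LinearMap.toSpanSingleton_apply, one_smul]
    congr 1
    ext i
    simp [Fintype.linearCombination_apply, Pi.single_apply]
  exact congrArg (fun f => f U) h

/-- This is the derivative of det(U(1 + tA)) at t = 0. Expanding each determinant along the replaced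
row turns the sum into tr(U A adj U), and cyclicity with adj(U) U = det(U) finishes. -/
theorem sum_det_updateRow_mul {R ι : Type*} [CommRing R] [Fintype ι] [DecidableEq ι]
    (U A : Matrix ι ι R) : ∑ i, (U.updateRow i ((U * A) i)).det = A.trace * U.det := by
  have h (i : ι) (v : ι → R) : (U.updateRow i v).det = ∑ k, v k * U.adjugate k i := by
    rw [← Matrix.cramer_transpose_apply, Matrix.cramer_eq_adjugate_mulVec,
      ← Matrix.adjugate_transpose]
    simp [Matrix.mulVec, dotProduct, mul_comm]
  simp_rw [h]
  have h2 : ∑ i, ∑ k, (U * A) i k * U.adjugate k i = (U * A * U.adjugate).trace := by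
    simp [Matrix.trace, Matrix.mul_apply]
  rw [h2, Matrix.trace_mul_comm, ← Matrix.mul_assoc, Matrix.adjugate_mul]
  simp [mul_comm]

/-! ### Derivatives of functions and determinants along complex tangent vectors. -/

section Derivatives

variable {E : Type*} [NormedAddCommGroup E] [NormedSpace ℝ E]
  {M : Type*} [TopologicalSpace M] [ChartedSpace E M]

/-! ### Derivatives along complex tangent vectors -/

theorem cderiv_tmul (f : M → ℂ) (x : M) (z : ℂ) (v : TangentSpace 𝓘(ℝ, E) x) :
    cderiv f x (z ⊗ₜ[ℝ] v) = z * mvfderiv 𝓘(ℝ, E) f x v := by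
  simp [cderiv]

theorem tmul_reVec_add_imVec {V : Type*} [AddCommGroup V] [Module ℝ V] (v : ℂ ⊗[ℝ] V) :
    (1 : ℂ) ⊗ₜ[ℝ] reVec V v + Complex.I ⊗ₜ[ℝ] imVec V v = v := by
  induction v with
  | zero => simp
  | add a b ha hb =>
    rw [map_add, map_add, TensorProduct.tmul_add, TensorProduct.tmul_add]
    nth_rewrite 3 [← ha]
    nth_rewrite 3 [← hb]
    abel
  | tmul z v =>
    simp only [reVec, imVec, LinearMap.comp_apply, LinearMap.rTensor_tmul, Complex.reLm_coe,
      Complex.imLm_coe, LinearEquiv.coe_coe, TensorProduct.lid_tmul, ← TensorProduct.smul_tmul,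
      ← TensorProduct.add_tmul]
    congr 1
    apply Complex.ext <;> simp

theorem reVec_add_tmul {V : Type*} [AddCommGroup V] [Module ℝ V] (v w : V) :
    reVec V ((1 : ℂ) ⊗ₜ[ℝ] v + Complex.I ⊗ₜ[ℝ] w) = v := by
  simp [reVec]

theorem imVec_add_tmul {V : Type*} [AddCommGroup V] [Module ℝ V] (v w : V) :
    imVec V ((1 : ℂ) ⊗ₜ[ℝ] v + Complex.I ⊗ₜ[ℝ] w) = w := by
  simp [imVec]

theorem cderiv_eq (f : M → ℂ) (x : M) (v : CTangent E x) :
    cderiv f x v = mvfderiv 𝓘(ℝ, E) f x (reVec _ v)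
      + Complex.I * mvfderiv 𝓘(ℝ, E) f x (imVec _ v) := by
  nth_rewrite 1 [← tmul_reVec_add_imVec v]
  rw [map_add, cderiv_tmul, cderiv_tmul, one_mul]

theorem mvfderiv_ofReal {f : M → ℝ} {x : M} (hf : MDifferentiableAt 𝓘(ℝ, E) 𝓘(ℝ, ℝ) f x)
    (v : TangentSpace 𝓘(ℝ, E) x) :
    mvfderiv 𝓘(ℝ, E) (fun y => (f y : ℂ)) x v = (mvfderiv 𝓘(ℝ, E) f x v : ℝ) :=
  congrArg (fun l => l v) (Complex.ofRealCLM.hasMFDerivAt.comp x hf.hasMFDerivAt).mfderiv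

theorem cderiv_ofReal {f : M → ℝ} {x : M} (hf : MDifferentiableAt 𝓘(ℝ, E) 𝓘(ℝ, ℝ) f x)
    (v : CTangent E x) : cderiv (fun y => (f y : ℂ)) x v
      = (mvfderiv 𝓘(ℝ, E) f x (reVec _ v) : ℝ)
        + Complex.I * (mvfderiv 𝓘(ℝ, E) f x (imVec _ v) : ℝ) := by
  rw [cderiv_eq, mvfderiv_ofReal hf, mvfderiv_ofReal hf]

theorem cderiv_const_mul (c : ℂ) {f : M → ℂ} {x : M}
    (hf : MDifferentiableAt 𝓘(ℝ, E) 𝓘(ℝ, ℂ) f x) :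
    cderiv (E := E) (fun y => c * f y) x = c • cderiv f x := by
  rw [cderiv_mul mdifferentiableAt_const hf, cderiv_const]
  simp

theorem SmoothOn.sum {ι : Type*} {s : Finset ι} {f : ι → M → ℂ} {N : Set M}
    (hf : ∀ i ∈ s, SmoothOn E (f i) N) : SmoothOn E (fun y => ∑ i ∈ s, f i y) N := by
  classical
  induction s using Finset.induction_on with
  | empty => simpa using SmoothOn.const 0 N
  | insert a s ha ih =>
    simp_rw [Finset.sum_insert ha]
    exact (hf a (Finset.mem_insert_self a s)).add
      (ih fun i hi => hf i (Finset.mem_insert_of_mem hi))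

theorem SmoothOn.prod {ι : Type*} {s : Finset ι} {f : ι → M → ℂ} {N : Set M}
    (hf : ∀ i ∈ s, SmoothOn E (f i) N) : SmoothOn E (fun y => ∏ i ∈ s, f i y) N := by
  classical
  induction s using Finset.induction_on with
  | empty => simpa using SmoothOn.const 1 N
  | insert a s ha ih =>
    simp_rw [Finset.prod_insert ha]
    exact (hf a (Finset.mem_insert_self a s)).mul
      (ih fun i hi => hf i (Finset.mem_insert_of_mem hi))

theorem cderiv_sum {ι : Type*} {s : Finset ι} {f : ι → M → ℂ} {N : Set M} (hN : IsOpen N)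
    (hf : ∀ i ∈ s, SmoothOn E (f i) N) {x : M} (hx : x ∈ N) :
    cderiv (E := E) (fun y => ∑ i ∈ s, f i y) x = ∑ i ∈ s, cderiv (f i) x := by
  classical
  induction s using Finset.induction_on with
  | empty => simpa using cderiv_const 0 x
  | insert a s ha ih =>
    have hf' := fun i hi => hf i (Finset.mem_insert_of_mem hi)
    simp_rw [Finset.sum_insert ha]
    rw [cderiv_add ((hf a (Finset.mem_insert_self a s)).mdifferentiableAt hN hx)
      ((SmoothOn.sum hf').mdifferentiableAt hN hx), ih hf']

/-- The differentiated factor is placed by an `if` inside a full product, so that each summand is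
visibly a term in the expansion of a determinant with one row replaced. -/
theorem cderiv_prod {ι : Type*} [DecidableEq ι] {s : Finset ι} {f : ι → M → ℂ} {N : Set M}
    (hN : IsOpen N) (hf : ∀ i ∈ s, SmoothOn E (f i) N) {x : M} (hx : x ∈ N) (v : CTangent E x) :
    cderiv (fun y => ∏ i ∈ s, f i y) x v
      = ∑ i ∈ s, ∏ j ∈ s, if j = i then cderiv (f i) x v else f j x := by
  induction s using Finset.induction_on with
  | empty => simp [cderiv_const]
  | insert a s ha ih =>
    have hf' := fun i hi => hf i (Finset.mem_insert_of_mem hi)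
    simp_rw [Finset.prod_insert ha]
    rw [cderiv_mul ((hf a (Finset.mem_insert_self a s)).mdifferentiableAt hN hx)
      ((SmoothOn.prod hf').mdifferentiableAt hN hx), Finset.sum_insert ha]
    simp only [LinearMap.add_apply, LinearMap.smul_apply, smul_eq_mul, if_true, ih hf',
      Finset.mul_sum]
    rw [add_comm]
    congr 1
    · rw [mul_comm]
      congr 1
      refine Finset.prod_congr rfl fun j hj => ?_
      rw [if_neg (by rintro rfl; exact ha hj)]
    · refine Finset.sum_congr rfl fun i hi => ?_
      rw [if_neg (by rintro rfl; exact ha hi)]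

variable {ι : Type*} [Fintype ι] [DecidableEq ι]

theorem SmoothOn.det {U : ι → ι → M → ℂ} {N : Set M} (hU : ∀ i k, SmoothOn E (U i k) N) :
    SmoothOn E (fun y => (Matrix.of fun i k => U i k y).det) N := by
  simp_rw [Matrix.det_apply']
  exact SmoothOn.sum fun σ _ => (SmoothOn.const _ N).mul (SmoothOn.prod fun i _ => hU _ _)

theorem cderiv_det {U : ι → ι → M → ℂ} {N : Set M} (hN : IsOpen N)
    (hU : ∀ i k, SmoothOn E (U i k) N) {x : M} (hx : x ∈ N) (v : CTangent E x) :
    cderiv (fun y => (Matrix.of fun i k => U i k y).det) x v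
      = ∑ i, ((Matrix.of fun i k => U i k x).updateRow i fun k => cderiv (U i k) x v).det := by
  -- The transposed Leibniz expansion is used so that the factor with index `i` lies in row `i`.
  -- Differentiating that factor then replaces exactly row `i`.
  have hdet (W : Matrix ι ι ℂ) : W.det = ∑ σ : Equiv.Perm ι,
      ((Equiv.Perm.sign σ : ℤ) : ℂ) * ∏ i, W i (σ i) := by
    rw [← Matrix.det_transpose, Matrix.det_apply']
    simp
  simp_rw [hdet, Matrix.of_apply]
  rw [cderiv_sum hN (fun σ _ => (SmoothOn.const _ N).mul (SmoothOn.prod fun i _ => hU _ _)) hx,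
    LinearMap.sum_apply, Finset.sum_comm]
  refine Finset.sum_congr rfl fun σ _ => ?_
  rw [cderiv_const_mul _ ((SmoothOn.prod fun i _ => hU _ _).mdifferentiableAt hN hx),
    LinearMap.smul_apply, cderiv_prod hN (fun i _ => hU _ _) hx, smul_eq_mul, Finset.mul_sum]
  refine Finset.sum_congr rfl fun i _ => ?_
  congr 1
  refine Finset.prod_congr rfl fun j _ => ?_
  by_cases h : j = i
  · subst h
    simp
  · simp [h]

/-- The derivative of a determinant, in the form in which it enters the Leibniz rule for a
derivation of a frame: `A` is the matrix of the derivation in the frame. -/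
theorem sum_det_updateRow_cderiv_add {U : ι → ι → M → ℂ} {N : Set M} (hN : IsOpen N)
    (hU : ∀ i k, SmoothOn E (U i k) N) {x : M} (hx : x ∈ N) (v : CTangent E x)
    (A : Matrix ι ι ℂ) :
    ∑ i, ((Matrix.of fun i k => U i k x).updateRow i
        fun k => cderiv (U i k) x v + ∑ j, U i j x * A j k).det
      = cderiv (fun y => (Matrix.of fun i k => U i k y).det) x v
        + A.trace * (Matrix.of fun i k => U i k x).det := by
  rw [cderiv_det hN hU hx, ← sum_det_updateRow_mul, ← Finset.sum_add_distrib]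
  refine Finset.sum_congr rfl fun i _ => ?_
  rw [← Matrix.det_updateRow_add]
  rfl

end Derivatives

/-! ### Real and imaginary parts of complex vector fields. -/

section Fields

variable {E : Type*} [NormedAddCommGroup E] [NormedSpace ℝ E]
  {M : Type*} [TopologicalSpace M] [ChartedSpace E M]

/-! ### Real and imaginary parts of complex vector fields -/

theorem reField_add (V W : ∀ x : M, CTangent E x) :
    reField (fun y => V y + W y) = reField V + reField W := by
  funext y
  simp [reField]

theorem imField_add (V W : ∀ x : M, CTangent E x) :
    imField (fun y => V y + W y) = imField V + imField W := by
  funext y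
  simp [imField]

theorem reVec_smul {V : Type*} [AddCommGroup V] [Module ℝ V] (z : ℂ) (v : ℂ ⊗[ℝ] V) :
    reVec V (z • v) = z.re • reVec V v - z.im • imVec V v := by
  induction v with
  | zero => simp
  | add a b ha hb => simp only [smul_add, map_add, ha, hb]; abel
  | tmul w v => simp [reVec, imVec, TensorProduct.smul_tmul', sub_smul, mul_smul]

theorem imVec_smul {V : Type*} [AddCommGroup V] [Module ℝ V] (z : ℂ) (v : ℂ ⊗[ℝ] V) :
    imVec V (z • v) = z.re • imVec V v + z.im • reVec V v := by
  induction v with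
  | zero => simp
  | add a b ha hb => simp only [smul_add, map_add, ha, hb]; abel
  | tmul w v => simp [reVec, imVec, TensorProduct.smul_tmul', add_smul, mul_smul]

theorem reField_smul (f : M → ℂ) (V : ∀ x : M, CTangent E x) :
    reField (fun y => f y • V y)
      = (fun y => (f y).re) • reField V - (fun y => (f y).im) • imField V := by
  funext y
  simp [reField, imField, reVec_smul]

theorem imField_smul (f : M → ℂ) (V : ∀ x : M, CTangent E x) :
    imField (fun y => f y • V y)
      = (fun y => (f y).re) • imField V + (fun y => (f y).im) • reField V := by
  funext y
  simp [reField, imField, imVec_smul]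

theorem reField_cLieBracket (V W : ∀ x : M, CTangent E x) : reField (cLieBracket V W)
    = VectorField.mlieBracket 𝓘(ℝ, E) (reField V) (reField W)
      - VectorField.mlieBracket 𝓘(ℝ, E) (imField V) (imField W) := by
  funext y
  exact reVec_add_tmul _ _

theorem imField_cLieBracket (V W : ∀ x : M, CTangent E x) : imField (cLieBracket V W)
    = VectorField.mlieBracket 𝓘(ℝ, E) (reField V) (imField W)
      + VectorField.mlieBracket 𝓘(ℝ, E) (imField V) (reField W) := by
  funext y
  exact imVec_add_tmul _ _

theorem mvfderiv_sum_apply {ι : Type*} {s : Finset ι} {f : ι → M → ℝ} {x : M}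
    (hf : ∀ i ∈ s, ContMDiffAt 𝓘(ℝ, E) 𝓘(ℝ, ℝ) ∞ (f i) x) (v : TangentSpace 𝓘(ℝ, E) x) :
    mvfderiv 𝓘(ℝ, E) (fun y => ∑ i ∈ s, f i y) x v = ∑ i ∈ s, mvfderiv 𝓘(ℝ, E) (f i) x v := by
  classical
  induction s using Finset.induction_on with
  | empty => simp [mvfderiv_const]
  | insert a s ha ih =>
    have hf' := fun i hi => hf i (Finset.mem_insert_of_mem hi)
    have h1 := (hf a (Finset.mem_insert_self a s)).mdifferentiableAt (n := ∞) (by simp)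
    have h2 := (contMDiffAt_finsetSum (t := s) (f := f) hf').mdifferentiableAt (n := ∞) (by simp)
    simp_rw [Finset.sum_insert ha]
    rw [← ih hf']
    exact congrArg (fun l => l v) (mvfderiv_add h1 h2)

end Fields

/-! ### The trace of the Lie derivative in a tangent frame. -/

section Tangent

variable {E : Type*} [NormedAddCommGroup E] [NormedSpace ℝ E]
  {M : Type*} [TopologicalSpace M] [ChartedSpace E M] [IsManifold 𝓘(ℝ, E) ∞ M]

/-! ### Real vector fields -/

theorem SmoothField.mdifferentiableAt {Z : ∀ x : M, TangentSpace 𝓘(ℝ, E) x} (hZ : SmoothField Z)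
    (x : M) : MDifferentiableAt 𝓘(ℝ, E) 𝓘(ℝ, E).tangent
      (fun y => (⟨y, Z y⟩ : TangentBundle 𝓘(ℝ, E) M)) x :=
  (hZ x).mdifferentiableAt (by simp)

theorem SmoothField.smul {f : M → ℝ} {Z : ∀ x : M, TangentSpace 𝓘(ℝ, E) x}
    (hf : ContMDiff 𝓘(ℝ, E) 𝓘(ℝ, ℝ) ∞ f) (hZ : SmoothField Z) : SmoothField (f • Z) :=
  ContMDiff.smul_section hf hZ

theorem SmoothField.mlieBracket [CompleteSpace E] {Z W : ∀ x : M, TangentSpace 𝓘(ℝ, E) x}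
    (hZ : SmoothField Z) (hW : SmoothField W) :
    SmoothField (VectorField.mlieBracket 𝓘(ℝ, E) Z W) := by
  have : IsManifold 𝓘(ℝ, E) (minSmoothness ℝ 2) M := by
    rw [minSmoothness_of_isRCLikeNormedField]
    infer_instance
  have : IsManifold 𝓘(ℝ, E) ((⊤ : ℕ∞) + 1 : WithTop ℕ∞) M := ‹IsManifold 𝓘(ℝ, E) ∞ M›
  refine ContDiff.mlieBracket_vectorField (m := ⊤) (n := ⊤) hZ hW ?_
  simp

theorem SmoothField.jacobi [CompleteSpace E] {U Z W : ∀ x : M, TangentSpace 𝓘(ℝ, E) x}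
    (hU : SmoothField U) (hZ : SmoothField Z) (hW : SmoothField W) (x : M) :
    VectorField.mlieBracket 𝓘(ℝ, E) U (VectorField.mlieBracket 𝓘(ℝ, E) Z W) x
      = VectorField.mlieBracket 𝓘(ℝ, E) (VectorField.mlieBracket 𝓘(ℝ, E) U Z) W x
        + VectorField.mlieBracket 𝓘(ℝ, E) Z (VectorField.mlieBracket 𝓘(ℝ, E) U W) x := by
  have h2 : minSmoothness ℝ 2 ≤ ∞ := by
    rw [minSmoothness_of_isRCLikeNormedField]
    exact WithTop.coe_le_coe.2 le_top
  have : IsManifold 𝓘(ℝ, E) (minSmoothness ℝ 3) M := by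
    rw [minSmoothness_of_isRCLikeNormedField]
    infer_instance
  exact VectorField.leibniz_identity_mlieBracket_apply ((hU x).of_le h2) ((hZ x).of_le h2)
    ((hW x).of_le h2)

theorem mlieBracket_sum_smul [CompleteSpace E] {ι : Type*} (s : Finset ι)
    {G : ι → M → ℝ} {Y : ι → ∀ x : M, TangentSpace 𝓘(ℝ, E) x}
    (Z : ∀ x : M, TangentSpace 𝓘(ℝ, E) x) {x : M}
    (hG : ∀ i ∈ s, ContMDiffAt 𝓘(ℝ, E) 𝓘(ℝ, ℝ) ∞ (G i) x) (hY : ∀ i ∈ s, SmoothField (Y i)) :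
    VectorField.mlieBracket 𝓘(ℝ, E) Z (∑ i ∈ s, G i • Y i) x
      = ∑ i ∈ s, (mvfderiv 𝓘(ℝ, E) (G i) x (Z x) • Y i x
          + G i x • VectorField.mlieBracket 𝓘(ℝ, E) Z (Y i) x) := by
  classical
  induction s using Finset.induction_on with
  | empty => simp
  | insert a s ha ih =>
    have hG' := fun i hi => hG i (Finset.mem_insert_of_mem hi)
    have hY' := fun i hi => hY i (Finset.mem_insert_of_mem hi)
    have h1 := (ContMDiffAt.smul_section (hG a (Finset.mem_insert_self a s))
      (hY a (Finset.mem_insert_self a s) x)).mdifferentiableAt (by simp)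
    have h2 : ContMDiffAt 𝓘(ℝ, E) 𝓘(ℝ, E).tangent ∞
        (fun y => (⟨y, (∑ i ∈ s, G i • Y i) y⟩ : TangentBundle 𝓘(ℝ, E) M)) x := by
      have := ContMDiffAt.sum_section (t := fun i => G i • Y i) (s := s) (x₀ := x)
        fun i hi => ContMDiffAt.smul_section (hG' i hi) (hY' i hi x)
      simpa only [Finset.sum_apply] using this
    rw [Finset.sum_insert ha, Finset.sum_insert ha,
      VectorField.mlieBracket_add_right h1 (h2.mdifferentiableAt (by simp)), ih hG' hY',
      VectorField.mlieBracket_smul_right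
        ((hG a (Finset.mem_insert_self a s)).mdifferentiableAt (by simp))
        ((hY a (Finset.mem_insert_self a s)).mdifferentiableAt x)]

namespace TangentFrame

variable {N : Set M} (T : TangentFrame E N)

/-- The matrix of the Lie derivative along `Z` in the frame. -/
def lieMatrix (Z : ∀ x : M, TangentSpace 𝓘(ℝ, E) x) (y : M) :
    Matrix (Fin (Module.finrank ℝ E)) (Fin (Module.finrank ℝ E)) ℝ :=
  Matrix.of fun i k => T.η k y (VectorField.mlieBracket 𝓘(ℝ, E) Z (T.Y i) y)

variable {T}

/-- Near `x` the field `W` is the sum of its coordinates times the frame, and the bracket depends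
only on the germ of `W`, so the Leibniz rule applies. -/
theorem mlieBracket_eq [CompleteSpace E] (hN : IsOpen N) (Z : ∀ x : M, TangentSpace 𝓘(ℝ, E) x)
    {W : ∀ x : M, TangentSpace 𝓘(ℝ, E) x} (hW : SmoothField W) {x : M} (hx : x ∈ N) :
    VectorField.mlieBracket 𝓘(ℝ, E) Z W x
      = ∑ k, (mvfderiv 𝓘(ℝ, E) (fun y => T.η k y (W y)) x (Z x) • T.Y k x
        + T.η k x (W x) • VectorField.mlieBracket 𝓘(ℝ, E) Z (T.Y k) x) := by
  rw [← mlieBracket_sum_smul (G := fun k y => T.η k y (W y)) Finset.univ Z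
    (fun k _ => (T.smooth_dual k W hW).contMDiffAt (hN.mem_nhds hx)) (fun k _ => T.smooth k)]
  refine Filter.EventuallyEq.mlieBracket_vectorField_eq Filter.EventuallyEq.rfl ?_
  filter_upwards [hN.mem_nhds hx] with y hy
  rw [Finset.sum_apply]
  exact (T.sum y hy (W y)).symm

theorem dual_sum {x : M} (hx : x ∈ N) (a : Fin (Module.finrank ℝ E) → ℝ)
    (j : Fin (Module.finrank ℝ E)) : T.η j x (∑ k, a k • T.Y k x) = a j := by
  simp [map_sum, T.dual x hx]

theorem η_mlieBracket [CompleteSpace E] (hN : IsOpen N) (Z : ∀ x : M, TangentSpace 𝓘(ℝ, E) x)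
    {W : ∀ x : M, TangentSpace 𝓘(ℝ, E) x} (hW : SmoothField W) {x : M} (hx : x ∈ N)
    (j : Fin (Module.finrank ℝ E)) :
    T.η j x (VectorField.mlieBracket 𝓘(ℝ, E) Z W x)
      = mvfderiv 𝓘(ℝ, E) (fun y => T.η j y (W y)) x (Z x)
        + ∑ k, T.η k x (W x) * T.lieMatrix Z x k j := by
  rw [mlieBracket_eq (T := T) hN Z hW hx, Finset.sum_add_distrib, map_add, dual_sum hx, map_sum]
  simp [lieMatrix]

theorem contMDiffOn_lieMatrix [CompleteSpace E] {Z : ∀ x : M, TangentSpace 𝓘(ℝ, E) x}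
    (hZ : SmoothField Z) (i k : Fin (Module.finrank ℝ E)) :
    ContMDiffOn 𝓘(ℝ, E) 𝓘(ℝ, ℝ) ∞ (fun y => T.lieMatrix Z y i k) N :=
  T.smooth_dual k _ (hZ.mlieBracket (T.smooth i))

theorem contMDiffOn_trace [CompleteSpace E] {Z : ∀ x : M, TangentSpace 𝓘(ℝ, E) x}
    (hZ : SmoothField Z) :
    ContMDiffOn 𝓘(ℝ, E) 𝓘(ℝ, ℝ) ∞ (fun y => (T.lieMatrix Z y).trace) N :=
  contMDiffOn_finsetSum fun i _ => contMDiffOn_lieMatrix hZ i i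

theorem trace_add [CompleteSpace E] {Z W : ∀ x : M, TangentSpace 𝓘(ℝ, E) x}
    (hZ : SmoothField Z) (hW : SmoothField W) (x : M) :
    (T.lieMatrix (Z + W) x).trace = (T.lieMatrix Z x).trace + (T.lieMatrix W x).trace := by
  rw [← Matrix.trace_add]
  congr 1
  ext i k
  simp [lieMatrix, VectorField.mlieBracket_add_left (hZ.mdifferentiableAt x)
    (hW.mdifferentiableAt x)]

/-- From [fZ, Y_i] = f[Z, Y_i] - (Y_i f) Z the error term is the sum of η_i(Z) Y_i f, which is Zf.
The trace is thus not C^∞-linear in `Z`, and the same defect on the side of B will cancel it. -/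
theorem trace_smul [CompleteSpace E] {f : M → ℝ} (hf : ContMDiff 𝓘(ℝ, E) 𝓘(ℝ, ℝ) ∞ f)
    {Z : ∀ x : M, TangentSpace 𝓘(ℝ, E) x} (hZ : SmoothField Z) {x : M} (hx : x ∈ N) :
    (T.lieMatrix (f • Z) x).trace
      = f x * (T.lieMatrix Z x).trace - mvfderiv 𝓘(ℝ, E) f x (Z x) := by
  have h (i) : T.lieMatrix (f • Z) x i i
      = f x * T.lieMatrix Z x i i - mvfderiv 𝓘(ℝ, E) f x (T.η i x (Z x) • T.Y i x) := by
    simp only [lieMatrix, Matrix.of_apply]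
    rw [VectorField.mlieBracket_smul_left ((hf x).mdifferentiableAt (by simp))
      (hZ.mdifferentiableAt x)]
    simp only [map_add, map_smul, neg_smul, map_neg, smul_eq_mul]
    ring
  simp_rw [Matrix.trace, Matrix.diag_apply, h]
  rw [Finset.sum_sub_distrib, ← Finset.mul_sum, ← map_sum, T.sum x hx]

theorem trace_neg [CompleteSpace E] {Z : ∀ x : M, TangentSpace 𝓘(ℝ, E) x}
    (hZ : SmoothField Z) (x : M) :
    (T.lieMatrix (-Z) x).trace = -(T.lieMatrix Z x).trace := by
  have h : SmoothField (-Z) := ContMDiff.neg_section hZ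
  have h1 := trace_add (T := T) hZ h x
  have h2 : (T.lieMatrix (0 : ∀ x : M, TangentSpace 𝓘(ℝ, E) x) x).trace = 0 := by
    simp [lieMatrix, Matrix.trace]
  rw [add_neg_cancel, h2] at h1
  linarith

theorem trace_sub [CompleteSpace E] {Z W : ∀ x : M, TangentSpace 𝓘(ℝ, E) x}
    (hZ : SmoothField Z) (hW : SmoothField W) (x : M) :
    (T.lieMatrix (Z - W) x).trace = (T.lieMatrix Z x).trace - (T.lieMatrix W x).trace := by
  have h : SmoothField (-W) := ContMDiff.neg_section hW
  rw [sub_eq_add_neg, trace_add hZ h, trace_neg hW, sub_eq_add_neg]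

/-- The trace of [Z, [W, ·]] in the frame is Z(tr A_W) + tr(A_W A_Z). Antisymmetrizing by the Jacobi
identity removes the product term, because the trace is cyclic. The trace is therefore a 1-cocycle
on vector fields. -/
theorem trace_mlieBracket [CompleteSpace E] (hN : IsOpen N)
    {Z W : ∀ x : M, TangentSpace 𝓘(ℝ, E) x}
    (hZ : SmoothField Z) (hW : SmoothField W) {x : M} (hx : x ∈ N) :
    (T.lieMatrix (VectorField.mlieBracket 𝓘(ℝ, E) Z W) x).trace
      = mvfderiv 𝓘(ℝ, E) (fun y => (T.lieMatrix W y).trace) x (Z x)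
        - mvfderiv 𝓘(ℝ, E) (fun y => (T.lieMatrix Z y).trace) x (W x) := by
  have key {Z W : ∀ x : M, TangentSpace 𝓘(ℝ, E) x} (hW : SmoothField W) :
      ∑ i, T.η i x (VectorField.mlieBracket 𝓘(ℝ, E) Z
        (VectorField.mlieBracket 𝓘(ℝ, E) W (T.Y i)) x)
      = mvfderiv 𝓘(ℝ, E) (fun y => (T.lieMatrix W y).trace) x (Z x)
        + (T.lieMatrix W x * T.lieMatrix Z x).trace := by
    simp_rw [η_mlieBracket hN Z (hW.mlieBracket (T.smooth _)) hx]
    rw [Finset.sum_add_distrib]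
    congr 1
    exact (mvfderiv_sum_apply (fun i _ =>
      (contMDiffOn_lieMatrix hW i i).contMDiffAt (hN.mem_nhds hx)) (Z x)).symm
  have h (i) : T.lieMatrix (VectorField.mlieBracket 𝓘(ℝ, E) Z W) x i i
      = T.η i x (VectorField.mlieBracket 𝓘(ℝ, E) Z
          (VectorField.mlieBracket 𝓘(ℝ, E) W (T.Y i)) x)
        - T.η i x (VectorField.mlieBracket 𝓘(ℝ, E) W
          (VectorField.mlieBracket 𝓘(ℝ, E) Z (T.Y i)) x) := by
    rw [hZ.jacobi hW (T.smooth i), map_add, add_sub_cancel_right]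
    rfl
  rw [Matrix.trace]
  simp_rw [Matrix.diag_apply, h]
  rw [Finset.sum_sub_distrib, key hW, key hZ, Matrix.trace_mul_comm (T.lieMatrix W x)]
  ring

end TangentFrame

/-! ### Complex vector fields -/

/-- Smooth complex vector fields. -/
def SmoothCField (V : ∀ x : M, CTangent E x) : Prop :=
  SmoothField (reField V) ∧ SmoothField (imField V)

namespace TangentFrame

variable {N : Set M} (T : TangentFrame E N)

/-- The trace, in the frame, of the Lie derivative along a complex vector field. -/
def lieTrace (V : ∀ x : M, CTangent E x) (y : M) : ℂ :=
  ((T.lieMatrix (reField V) y).trace : ℂ) + Complex.I * ((T.lieMatrix (imField V) y).trace : ℂ)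

variable {T} [CompleteSpace E]

theorem smoothOn_lieTrace {V : ∀ x : M, CTangent E x} (hV : SmoothCField V) :
    SmoothOn E (T.lieTrace V) N := by
  have h {Z : ∀ x : M, TangentSpace 𝓘(ℝ, E) x} (hZ : SmoothField Z) :
      SmoothOn E (fun y => ((T.lieMatrix Z y).trace : ℂ)) N :=
    Complex.ofRealCLM.contDiff.contMDiff.comp_contMDiffOn (contMDiffOn_trace hZ)
  exact (h hV.1).add ((SmoothOn.const _ N).mul (h hV.2))

theorem lieTrace_add {V W : ∀ x : M, CTangent E x} (hV : SmoothCField V) (hW : SmoothCField W)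
    (x : M) : T.lieTrace (fun y => V y + W y) x = T.lieTrace V x + T.lieTrace W x := by
  rw [lieTrace, reField_add, imField_add, trace_add hV.1 hW.1, trace_add hV.2 hW.2, lieTrace,
    lieTrace]
  push_cast
  ring

theorem lieTrace_smul {f : M → ℂ} (hf : SmoothOn E f Set.univ) {V : ∀ x : M, CTangent E x}
    (hV : SmoothCField V) {x : M} (hx : x ∈ N) :
    T.lieTrace (fun y => f y • V y) x = f x * T.lieTrace V x - cderiv f x (V x) := by
  have hre : ContMDiff 𝓘(ℝ, E) 𝓘(ℝ, ℝ) ∞ (fun y => (f y).re) :=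
    Complex.reCLM.contDiff.contMDiff.comp (contMDiffOn_univ.1 hf)
  have him : ContMDiff 𝓘(ℝ, E) 𝓘(ℝ, ℝ) ∞ (fun y => (f y).im) :=
    Complex.imCLM.contDiff.contMDiff.comp (contMDiffOn_univ.1 hf)
  have hred := (hre x).mdifferentiableAt (by simp)
  have himd := (him x).mdifferentiableAt (by simp)
  have hfe : f = fun y => ((f y).re : ℂ) + Complex.I * ((f y).im : ℂ) := by
    funext y
    rw [mul_comm, Complex.re_add_im]
  have hc : SmoothOn E (fun y => ((f y).re : ℂ)) Set.univ :=
    hf.comp_contDiff (φ := fun z => (z.re : ℂ))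
      (Complex.ofRealCLM.contDiff.comp Complex.reCLM.contDiff)
  have hc' : SmoothOn E (fun y => ((f y).im : ℂ)) Set.univ :=
    hf.comp_contDiff (φ := fun z => (z.im : ℂ))
      (Complex.ofRealCLM.contDiff.comp Complex.imCLM.contDiff)
  have hd : cderiv f x (V x) = cderiv (fun y => ((f y).re : ℂ)) x (V x)
      + Complex.I * cderiv (fun y => ((f y).im : ℂ)) x (V x) := by
    conv_lhs => rw [hfe]
    rw [cderiv_add (hc.mdifferentiableAt isOpen_univ trivial)
      (((SmoothOn.const _ _).mul hc').mdifferentiableAt isOpen_univ trivial),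
      cderiv_const_mul _ (hc'.mdifferentiableAt isOpen_univ trivial)]
    simp
  rw [lieTrace, reField_smul, imField_smul, trace_sub (hV.1.smul hre) (hV.2.smul him),
    trace_add (hV.2.smul hre) (hV.1.smul him), trace_smul hre hV.1 hx, trace_smul hre hV.2 hx,
    trace_smul him hV.1 hx, trace_smul him hV.2 hx, hd, cderiv_ofReal hred, cderiv_ofReal himd,
    lieTrace]
  simp only [reField, imField]
  have hfx : f x = ((f x).re : ℂ) + Complex.I * ((f x).im : ℂ) := congrFun hfe x
  rw [hfx]
  simp only [Complex.add_re, Complex.mul_re, Complex.ofReal_re, Complex.ofReal_im, Complex.I_re,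
    Complex.I_im, Complex.add_im, Complex.mul_im]
  push_cast
  -- Once all is expanded into real and imaginary parts, the two sides differ only by I² = -1.
  linear_combination (-((f x).im : ℂ) * ((T.lieMatrix (imField V) x).trace : ℂ)
    + (mvfderiv 𝓘(ℝ, E) (fun y => (f y).im) x (imVec _ (V x)) : ℂ)) * Complex.I_sq

theorem lieTrace_cLieBracket (hN : IsOpen N) {V W : ∀ x : M, CTangent E x} (hV : SmoothCField V)
    (hW : SmoothCField W) {x : M} (hx : x ∈ N) :
    T.lieTrace (cLieBracket V W) x
      = cderiv (T.lieTrace W) x (V x) - cderiv (T.lieTrace V) x (W x) := by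
  have hd {V : ∀ x : M, CTangent E x} (hV : SmoothCField V) (w : CTangent E x) :
      cderiv (T.lieTrace V) x w
        = (mvfderiv 𝓘(ℝ, E) (fun y => (T.lieMatrix (reField V) y).trace) x (reVec _ w) : ℂ)
        + Complex.I
          * (mvfderiv 𝓘(ℝ, E) (fun y => (T.lieMatrix (reField V) y).trace) x (imVec _ w) : ℂ)
        + Complex.I
          * ((mvfderiv 𝓘(ℝ, E) (fun y => (T.lieMatrix (imField V) y).trace) x (reVec _ w) : ℂ)
          + Complex.I
          * (mvfderiv 𝓘(ℝ, E) (fun y => (T.lieMatrix (imField V) y).trace) x (imVec _ w) : ℂ)) := by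
    have hr {Z : ∀ x : M, TangentSpace 𝓘(ℝ, E) x} (hZ : SmoothField Z) :
        MDifferentiableAt 𝓘(ℝ, E) 𝓘(ℝ, ℝ) (fun y => (T.lieMatrix Z y).trace) x :=
      ((contMDiffOn_trace (T := T) hZ).contMDiffAt (hN.mem_nhds hx)).mdifferentiableAt (by simp)
    have hs {Z : ∀ x : M, TangentSpace 𝓘(ℝ, E) x} (hZ : SmoothField Z) :
        SmoothOn E (fun y => ((T.lieMatrix Z y).trace : ℂ)) N :=
      Complex.ofRealCLM.contDiff.contMDiff.comp_contMDiffOn (contMDiffOn_trace hZ)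
    have h1 : cderiv (T.lieTrace V) x = _ := cderiv_add ((hs hV.1).mdifferentiableAt hN hx)
      (((SmoothOn.const Complex.I N).mul (hs hV.2)).mdifferentiableAt hN hx)
    rw [h1, cderiv_const_mul _ ((hs hV.2).mdifferentiableAt hN hx), LinearMap.add_apply,
      LinearMap.smul_apply, smul_eq_mul, cderiv_ofReal (hr hV.1), cderiv_ofReal (hr hV.2)]
  rw [hd hV, hd hW, lieTrace, reField_cLieBracket, imField_cLieBracket,
    trace_sub (hV.1.mlieBracket hW.1) (hV.2.mlieBracket hW.2),
    trace_add (hV.1.mlieBracket hW.2) (hV.2.mlieBracket hW.1),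
    trace_mlieBracket hN hV.1 hW.1 hx, trace_mlieBracket hN hV.2 hW.2 hx,
    trace_mlieBracket hN hV.1 hW.2 hx, trace_mlieBracket hN hV.2 hW.1 hx]
  simp only [reField, imField]
  push_cast
  linear_combination (-(mvfderiv 𝓘(ℝ, E)
      (fun y => (T.lieMatrix (imField W) y).trace) x
      (imVec _ (V x)) : ℂ)
    + (mvfderiv 𝓘(ℝ, E)
      (fun y => (T.lieMatrix (imField V) y).trace) x
      (imVec _ (W x)) : ℂ)) * Complex.I_sq

end TangentFrame

end Tangent

/-! ### Forms of top degree and their Lie derivatives. -/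

section TopForms

variable {E : Type*} [NormedAddCommGroup E] [NormedSpace ℝ E]
  {M : Type*} [TopologicalSpace M] [ChartedSpace E M] [IsManifold 𝓘(ℝ, E) ∞ M]

namespace TangentFrame

variable {N : Set M} (T : TangentFrame E N)

/-! ### Forms of top degree and their Lie derivatives in a frame -/

/-- The matrix of coordinates of tangent vectors in the frame. -/
def coordMatrix (y : M) (v : Fin (Module.finrank ℝ E) → TangentSpace 𝓘(ℝ, E) y) :
    Matrix (Fin (Module.finrank ℝ E)) (Fin (Module.finrank ℝ E)) ℂ :=
  Matrix.of fun i k => (T.η k y (v i) : ℂ)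

/-- The top form which takes the value `1` on the frame. -/
def volumeForm (y : M) : TopForm E y :=
  Complex.ofRealCLM.toLinearMap.compAlternatingMap
    (Matrix.detRowAlternating.compLinearMap (LinearMap.pi fun k => T.η k y))

theorem volumeForm_apply (y : M) (v : Fin (Module.finrank ℝ E) → TangentSpace 𝓘(ℝ, E) y) :
    T.volumeForm y v = (T.coordMatrix y v).det :=
  Complex.ofRealHom.map_det _

variable {T}

theorem coordMatrix_frame {y : M} (hy : y ∈ N) : T.coordMatrix y (fun j => T.Y j y) = 1 := by
  ext i k
  simp only [coordMatrix, T.dual y hy, Matrix.of_apply, Matrix.one_apply, eq_comm (a := k)]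
  split_ifs <;> simp

theorem topForm_apply {y : M} (hy : y ∈ N) (μ : TopForm E y)
    (v : Fin (Module.finrank ℝ E) → TangentSpace 𝓘(ℝ, E) y) :
    μ v = (T.coordMatrix y v).det * μ (fun j => T.Y j y) := by
  have h := alternatingMap_sum_smul μ (fun j => T.Y j y) (Matrix.of fun i k => T.η k y (v i))
  simp only [Matrix.of_apply, T.sum y hy] at h
  rw [h, ← volumeForm_apply]
  exact Complex.real_smul

theorem topForm_eq_smul {y : M} (hy : y ∈ N) (μ : TopForm E y) :
    μ = μ (fun j => T.Y j y) • T.volumeForm y := by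
  ext v
  rw [topForm_apply hy, AlternatingMap.smul_apply, volumeForm_apply, smul_eq_mul, mul_comm]

theorem coordMatrix_update (y : M) (v : Fin (Module.finrank ℝ E) → TangentSpace 𝓘(ℝ, E) y)
    (j : Fin (Module.finrank ℝ E)) (w : TangentSpace 𝓘(ℝ, E) y) :
    T.coordMatrix y (Function.update v j w)
      = (T.coordMatrix y v).updateRow j fun k => (T.η k y w : ℂ) := by
  ext i k
  by_cases h : i = j
  · subst h
    simp [coordMatrix]
  · simp [coordMatrix, h]

theorem smoothOn_coord {Z : ∀ x : M, TangentSpace 𝓘(ℝ, E) x} (hZ : SmoothField Z)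
    (k : Fin (Module.finrank ℝ E)) : SmoothOn E (fun y => (T.η k y (Z y) : ℂ)) N :=
  Complex.ofRealCLM.contDiff.contMDiff.comp_contMDiffOn (T.smooth_dual k Z hZ)

theorem smoothOn_topForm_frame {μ : ∀ x : M, TopForm E x} (hμ : SmoothTopForm μ) (s : Set M) :
    SmoothOn E (fun y => μ y fun j => T.Y j y) s :=
  ContMDiff.contMDiffOn (hμ T.Y T.smooth)

/-- The defining expression of the Lie derivative is tensorial in the fields. Its value on `Z` is
the determinant of the coordinates of `Z` times a scalar. In that scalar the derivatives of the
determinant cancel against the brackets, leaving the derivative of the coefficient of `μ` minus the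
trace term. This gives both the existence of the Lie derivative and its coefficient in the frame. -/
theorem lieDeriv_apply_eq [CompleteSpace E] (hN : IsOpen N) (V : ∀ x : M, CTangent E x)
    {μ : ∀ x : M, TopForm E x} (hμ : SmoothTopForm μ)
    {Z : Fin (Module.finrank ℝ E) → ∀ x : M, TangentSpace 𝓘(ℝ, E) x}
    (hZ : ∀ j, SmoothField (Z j)) {x : M} (hx : x ∈ N) :
    cderiv (fun y => μ y (fun j => Z j y)) x (V x)
        - ∑ j, (μ x (Function.update (fun k => Z k x) j
                  (VectorField.mlieBracket 𝓘(ℝ, E) (reField V) (Z j) x))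
              + Complex.I * μ x (Function.update (fun k => Z k x) j
                  (VectorField.mlieBracket 𝓘(ℝ, E) (imField V) (Z j) x)))
      = (cderiv (fun y => μ y fun j => T.Y j y) x (V x)
          - T.lieTrace V x * μ x fun j => T.Y j x) * T.volumeForm x fun j => Z j x := by
  let U : Fin (Module.finrank ℝ E) → Fin (Module.finrank ℝ E) → M → ℂ :=
    fun i k y => (T.η k y (Z i y) : ℂ)
  have hU (i k) : SmoothOn E (U i k) N := smoothOn_coord (hZ i) k
  have hdet : SmoothOn E (fun y => (Matrix.of fun i k => U i k y).det) N := SmoothOn.det hU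
  have hm := smoothOn_topForm_frame (T := T) hμ N
  have h1 : cderiv (E := E) (fun y => μ y (fun j => Z j y)) x
      = cderiv (fun y => (Matrix.of fun i k => U i k y).det * μ y fun j => T.Y j y) x := by
    refine cderiv_congr ?_
    filter_upwards [hN.mem_nhds hx] with y hy
    exact topForm_apply hy _ _
  rw [h1, cderiv_mul (hdet.mdifferentiableAt hN hx) (hm.mdifferentiableAt hN hx)]
  -- The complex matrix of the Lie derivative along `V` in the frame, with the parts from Re V and
  -- Im V combined. The two determinants from these parts then merge into one by linearity in row
  -- `j`.
  let A : Matrix (Fin (Module.finrank ℝ E)) (Fin (Module.finrank ℝ E)) ℂ := Matrix.of fun i k =>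
    (T.lieMatrix (reField V) x i k : ℂ) + Complex.I * (T.lieMatrix (imField V) x i k : ℂ)
  have hA : A.trace = T.lieTrace V x := by
    simp [A, lieTrace, Matrix.trace, Finset.sum_add_distrib, Finset.mul_sum]
  have h2 (j) : μ x (Function.update (fun k => Z k x) j
        (VectorField.mlieBracket 𝓘(ℝ, E) (reField V) (Z j) x))
      + Complex.I * μ x (Function.update (fun k => Z k x) j
        (VectorField.mlieBracket 𝓘(ℝ, E) (imField V) (Z j) x))
      = ((Matrix.of fun i k => U i k x).updateRow j
          fun k => cderiv (U j k) x (V x) + ∑ i, U j i x * A i k).det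
        * μ x fun j => T.Y j x := by
    rw [topForm_apply hx, topForm_apply hx (μ x) (Function.update _ _ (VectorField.mlieBracket
      𝓘(ℝ, E) (imField V) (Z j) x)), coordMatrix_update, coordMatrix_update, ← mul_assoc,
      ← add_mul, ← Matrix.det_updateRow_smul, ← Matrix.det_updateRow_add]
    congr 3
    funext k
    have hd := (((T.smooth_dual k _ (hZ j)).contMDiffAt (hN.mem_nhds hx))).mdifferentiableAt
      (n := ∞) (by simp)
    simp only [Pi.add_apply, Pi.smul_apply, smul_eq_mul]
    rw [η_mlieBracket hN _ (hZ j) hx, η_mlieBracket hN _ (hZ j) hx]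
    have hd' : cderiv (U j k) x (V x) = _ := cderiv_ofReal hd (V x)
    rw [hd']
    simp only [A, U, Matrix.of_apply, mul_add, Finset.sum_add_distrib, Complex.ofReal_add,
      Complex.ofReal_sum, Complex.ofReal_mul, Finset.mul_sum, reField, imField]
    simp only [mul_left_comm Complex.I]
    ring
  simp_rw [h2]
  rw [← Finset.sum_mul, sum_det_updateRow_cderiv_add hN hU hx, hA, volumeForm_apply]
  have hc : T.coordMatrix x (fun j => Z j x) = Matrix.of fun i k => U i k x := rfl
  rw [hc]
  simp only [LinearMap.add_apply, LinearMap.smul_apply, smul_eq_mul]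
  ring

theorem isLieDeriv_apply_frame [CompleteSpace E] (hN : IsOpen N) {V : ∀ x : M, CTangent E x}
    {μ ν : ∀ x : M, TopForm E x} (hμ : SmoothTopForm μ) (h : IsLieDeriv V μ ν) {x : M}
    (hx : x ∈ N) : ν x (fun j => T.Y j x)
      = cderiv (fun y => μ y fun j => T.Y j y) x (V x)
          - T.lieTrace V x * μ x fun j => T.Y j x := by
  rw [h T.Y T.smooth x, lieDeriv_apply_eq hN V hμ T.smooth hx, volumeForm_apply,
    coordMatrix_frame hx, Matrix.det_one, mul_one]

end TangentFrame

variable [FiniteDimensional ℝ E] [T2Space M]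

/-- The condition on `ν` is imposed point by point, so at each `x` the formula in a frame around `x`
may be used. No compatibility between the chosen frames has to be checked. -/
theorem exists_isLieDeriv (V : ∀ x : M, CTangent E x) {μ : ∀ x : M, TopForm E x}
    (hμ : SmoothTopForm μ) : ∃ ν, IsLieDeriv V μ ν := by
  have := FiniteDimensional.complete ℝ E
  have h (x : M) := exists_tangentFrame (E := E) x
  choose N hN hx T using h
  refine ⟨fun x => (cderiv (fun y => μ y fun j => (T x).some.Y j y) x (V x)
    - (T x).some.lieTrace V x * μ x fun j => (T x).some.Y j x) • (T x).some.volumeForm x,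
    fun Z hZ x => ?_⟩
  rw [TangentFrame.lieDeriv_apply_eq (T := (T x).some) (hN x) V hμ hZ (hx x)]
  rfl

/-- Besides extending the coefficient `G`, a cutoff supported in `N` is needed, because the dual
frame is known to be smooth only there. -/
theorem TangentFrame.exists_smoothTopForm {N : Set M} (T : TangentFrame E N) (hN : IsOpen N)
    {s : Set M} (hs : IsOpen s) {G : M → ℂ} (hG : SmoothOn E G s) {x : M} (hx : x ∈ N)
    (hxs : x ∈ s) :
    ∃ μ : ∀ x : M, TopForm E x, SmoothTopForm μ ∧ ∀ᶠ y in 𝓝 x, μ y = G y • T.volumeForm y := by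
  obtain ⟨G', hG', hGG'⟩ := hG.exists_extension hs hxs
  obtain ⟨χ, hχ, hχN, hχ1⟩ := exists_bump (E := E) hN hx
  refine ⟨fun y => ((χ y : ℂ) * G' y) • T.volumeForm y, fun Z hZ => ?_, ?_⟩
  · rw [← contMDiffOn_univ]
    refine SmoothOn.of_locally fun y _ => ?_
    by_cases hy : y ∈ N
    · refine ⟨N, hN, hy, ?_⟩
      have h1 : SmoothOn E (fun y => (χ y : ℂ)) N :=
        Complex.ofRealCLM.contDiff.contMDiff.comp_contMDiffOn hχ.contMDiffOn
      refine ((h1.mul (hG'.mono (Set.subset_univ _))).mul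
        (SmoothOn.det fun i k => smoothOn_coord (T := T) (hZ i) k)).congr fun z _ => ?_
      rw [AlternatingMap.smul_apply, T.volumeForm_apply]
      rfl
    · refine ⟨(tsupport χ)ᶜ, (isClosed_tsupport χ).isOpen_compl, fun h => hy (hχN h), ?_⟩
      refine (SmoothOn.const 0 _).congr fun z hz => ?_
      simp [image_eq_zero_of_notMem_tsupport hz]
  · filter_upwards [hχ1, hGG'] with y hy hy'
    simp [hy, hy']

end TopForms

/-! ### Smoothness of derivatives along vector fields. -/

section DerivSmooth

variable {E : Type*} [NormedAddCommGroup E] [NormedSpace ℝ E]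
  {M : Type*} [TopologicalSpace M] [ChartedSpace E M] [IsManifold 𝓘(ℝ, E) ∞ M]

theorem SmoothOn.mvfderiv_apply {f : M → ℂ} (hf : SmoothOn E f Set.univ)
    {Z : ∀ x : M, TangentSpace 𝓘(ℝ, E) x} (hZ : SmoothField Z) :
    SmoothOn E (fun y => mvfderiv 𝓘(ℝ, E) f y (Z y)) Set.univ := by
  have h1 := (contMDiffOn_univ.1 hf).contMDiff_tangentMap (m := ∞) (by simp)
  have h2 := (contMDiff_snd_tangentBundle_modelSpace (n := ∞) ℂ 𝓘(ℝ, ℂ)).comp (h1.comp hZ)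
  exact contMDiffOn_univ.2 h2

theorem SmoothOn.cderiv_apply {f : M → ℂ} (hf : SmoothOn E f Set.univ)
    {V : ∀ x : M, CTangent E x} (hV : SmoothCField V) :
    SmoothOn E (fun y => cderiv f y (V y)) Set.univ := by
  simp_rw [cderiv_eq]
  exact (hf.mvfderiv_apply hV.1).add ((SmoothOn.const _ _).mul (hf.mvfderiv_apply hV.2))

end DerivSmooth

/-! ### The differential, locality of the bracket, and the modular form of a pair of frames. -/

section Algebroid

variable {E : Type*} [NormedAddCommGroup E] [NormedSpace ℝ E]
  {M : Type*} [TopologicalSpace M] [ChartedSpace E M] [IsManifold 𝓘(ℝ, E) ∞ M]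
  {F : Type*} [NormedAddCommGroup F] [NormedSpace ℂ F]
  {B : M → Type*} [∀ x, AddCommGroup (B x)] [∀ x, Module ℂ (B x)]
  [∀ x, TopologicalSpace (B x)] [TopologicalSpace (Bundle.TotalSpace F B)] [FiberBundle F B]
  [VectorBundle ℂ F B] [VectorBundle ℝ F B]

namespace ComplexLieAlgebroid

/-! ### The bracket -/

section VB

variable {E : Type*} [NormedAddCommGroup E] [NormedSpace ℝ E]
  {M : Type*} [TopologicalSpace M] [ChartedSpace E M] [IsManifold 𝓘(ℝ, E) ∞ M]
  {F : Type*} [NormedAddCommGroup F] [NormedSpace ℂ F]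
  {B : M → Type*} [∀ x, AddCommGroup (B x)] [∀ x, Module ℂ (B x)]
  [∀ x, TopologicalSpace (B x)] [TopologicalSpace (Bundle.TotalSpace F B)] [FiberBundle F B]
  [VectorBundle ℝ F B] (L : ComplexLieAlgebroid E M F B)

theorem smoothCField_anchorField (u : Cₛ^∞⟮𝓘(ℝ, E); F, B⟯) : SmoothCField (L.anchorField u) :=
  L.smooth_anchor u

theorem section_sum_apply {ι : Type*} (s : Finset ι) (v : ι → Cₛ^∞⟮𝓘(ℝ, E); F, B⟯) (y : M) :
    (∑ i ∈ s, v i) y = ∑ i ∈ s, v i y := by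
  rw [← ContMDiffSection.coeAddHom_apply, map_sum, Finset.sum_apply]
  rfl

theorem bracket_zero (u : Cₛ^∞⟮𝓘(ℝ, E); F, B⟯) : L.bracket u 0 = 0 := by
  have h := L.bracket_add u 0 0
  rw [add_zero] at h
  exact left_eq_add.1 h

theorem bracket_sum {ι : Type*} (s : Finset ι) (u : Cₛ^∞⟮𝓘(ℝ, E); F, B⟯)
    (v : ι → Cₛ^∞⟮𝓘(ℝ, E); F, B⟯) : L.bracket u (∑ i ∈ s, v i) = ∑ i ∈ s, L.bracket u (v i) :=
  map_sum (AddMonoidHom.mk' (L.bracket u) (L.bracket_add u)) v s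

theorem add_bracket (u v w : Cₛ^∞⟮𝓘(ℝ, E); F, B⟯) :
    L.bracket (u + v) w = L.bracket u w + L.bracket v w := by
  rw [L.bracket_skew, L.bracket_add, L.bracket_skew w u, L.bracket_skew w v]
  abel

end VB

variable (L : ComplexLieAlgebroid E M F B)

theorem bracket_smulSection {f : M → ℂ} (hf : SmoothOn E f Set.univ)
    (u v : Cₛ^∞⟮𝓘(ℝ, E); F, B⟯) (x : M) : L.bracket u (smulSection f hf v) x
      = cderiv f x (L.anchorField u x) • v x + f x • L.bracket u v x :=
  L.leibniz f u v _ hf (fun _ => rfl) x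

theorem smulSection_bracket {f : M → ℂ} (hf : SmoothOn E f Set.univ)
    (u v : Cₛ^∞⟮𝓘(ℝ, E); F, B⟯) (x : M) : L.bracket (smulSection f hf u) v x
      = f x • L.bracket u v x - cderiv f x (L.anchorField v x) • u x := by
  rw [L.bracket_skew, ContMDiffSection.coe_neg, Pi.neg_apply, bracket_smulSection,
    L.bracket_skew v u, ContMDiffSection.coe_neg, Pi.neg_apply, smul_neg]
  abel

theorem smoothOn_d0 {f : M → ℂ} (hf : SmoothOn E f Set.univ) (u : Cₛ^∞⟮𝓘(ℝ, E); F, B⟯) :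
    SmoothOn E (fun y => L.d0 f y (u y)) Set.univ :=
  hf.cderiv_apply (L.smoothCField_anchorField u)

/-- The Jacobi identity for `u`, `v`, `f w`, expanded by the Leibniz rule and compared with that for
`u`, `v`, `w`, leaves d_B²f(u, v) as the coefficient of `w`. A section `w` with `w x ≠ 0` thus
suffices. If there is none, all terms vanish at `x`. -/
theorem d1_d0 {f : M → ℂ} (hf : SmoothOn E f Set.univ) (u v : Cₛ^∞⟮𝓘(ℝ, E); F, B⟯) (x : M) :
    L.d1 (L.d0 f) u v x = 0 := by
  by_cases h : ∃ w : Cₛ^∞⟮𝓘(ℝ, E); F, B⟯, w x ≠ 0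
  · obtain ⟨w, hw⟩ := h
    have hb (v : Cₛ^∞⟮𝓘(ℝ, E); F, B⟯) : L.bracket v (smulSection f hf w)
        = smulSection _ (L.smoothOn_d0 hf v) w + smulSection f hf (L.bracket v w) := by
      ext y
      exact L.bracket_smulSection hf v w y
    have hj := congrArg (fun s => s x) (L.jacobi u v (smulSection f hf w))
    have hj' := congrArg (fun s => s x) (L.jacobi u v w)
    simp only [hb, L.bracket_add, ContMDiffSection.coe_add, Pi.add_apply, bracket_smulSection] at hj
    simp only [ContMDiffSection.coe_add, Pi.add_apply] at hj'
    have e : L.d1 (L.d0 f) u v x • w x = 0 := by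
      have h1 : smulSection _ (L.smoothOn_d0 hf (L.bracket u v)) w x
        = L.d0 f x (L.bracket u v x) • w x := rfl
      have h2 : smulSection f hf (L.bracket (L.bracket u v) w) x
        = f x • L.bracket (L.bracket u v) w x := rfl
      rw [hj', h1, h2, smul_add] at hj
      rw [d1, sub_smul, sub_smul]
      have h3 (u : Cₛ^∞⟮𝓘(ℝ, E); F, B⟯) : cderiv f x (L.anchorField u x) = L.d0 f x (u x) := rfl
      rw [h3, h3] at hj
      rw [sub_sub, sub_eq_zero]
      have hj2 := sub_eq_zero.2 hj
      rw [← sub_eq_zero, ← hj2]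
      abel
    exact (smul_eq_zero.1 e).resolve_right hw
  · push Not at h
    simp [d1, anchorField, h]

theorem d1_congr {ξ η : ∀ x : M, Module.Dual ℂ (B x)} {x : M} (h : ∀ᶠ y in 𝓝 x, ξ y = η y)
    (u v : Cₛ^∞⟮𝓘(ℝ, E); F, B⟯) : L.d1 ξ u v x = L.d1 η u v x := by
  have hc (w : Cₛ^∞⟮𝓘(ℝ, E); F, B⟯) : cderiv (E := E) (fun y => ξ y (w y)) x
      = cderiv (fun y => η y (w y)) x := cderiv_congr <| by
    filter_upwards [h] with y hy
    rw [hy]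
  rw [d1, hc, hc, h.self_of_nhds, d1]

variable [FiniteDimensional ℝ E] [T2Space M]

theorem IsClosedOn.of_locally {ξ : ∀ x : M, Module.Dual ℂ (B x)} {s : Set M}
    (h : ∀ x ∈ s, ∃ N, IsOpen N ∧ x ∈ N ∧ ∃ η : ∀ x : M, Module.Dual ℂ (B x),
      L.IsClosedOn η N ∧ ∀ y ∈ N, ξ y = η y) : L.IsClosedOn ξ s := by
  refine ⟨fun u => SmoothOn.of_locally fun x hx => ?_, fun u v x hx => ?_⟩
  · obtain ⟨N, hN, hxN, η, hη, he⟩ := h x hx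
    exact ⟨N, hN, hxN, (hη.1 u).congr fun y hy => by rw [he y hy]⟩
  · obtain ⟨N, hN, hxN, η, hη, he⟩ := h x hx
    rw [L.d1_congr (Filter.eventually_of_mem (hN.mem_nhds hxN) he), hη.2 u v x hxN]

theorem d0_congr {f g : M → ℂ} {x : M} (h : f =ᶠ[𝓝 x] g) : L.d0 f x = L.d0 g x := by
  rw [d0, cderiv_congr h, d0]

theorem dlog_congr {f g : M → ℂˣ} {x : M} (h : f =ᶠ[𝓝 x] g) : L.dlog f x = L.dlog g x := by
  have h' : (fun y => (f y : ℂ)) =ᶠ[𝓝 x] fun y => (g y : ℂ) := by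
    filter_upwards [h] with y hy
    rw [hy]
  rw [dlog, L.d0_congr h', h.self_of_nhds, dlog]

/-- Near each point f = exp l, so d̃f = d_B l is closed. The logarithm is first extended to all of
`M`, since d_B² = 0 is proved for global functions. -/
theorem isClosedOn_dlog {f : M → ℂˣ} {s : Set M} (hs : IsOpen s) (hf : SmoothUnitOn E f s) :
    L.IsClosedOn (L.dlog f) s := by
  refine IsClosedOn.of_locally L fun x hx => ?_
  obtain ⟨V, hV, hxV, hVs, l, hl, hl'⟩ := hf.exists_log hs hx
  obtain ⟨l', h1, h2⟩ := hl.exists_extension hV hxV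
  obtain ⟨O, hO, hOo, hxO⟩ := mem_nhds_iff.1 h2
  refine ⟨V ∩ O, hV.inter hOo, ⟨hxV, hxO⟩, L.d0 l',
    ⟨fun u => (L.smoothOn_d0 h1 u).mono (Set.subset_univ _), fun u v y _ => L.d1_d0 h1 u v y⟩,
    fun y hy => ?_⟩
  rw [← d0_exp (L := L) (g := expUnit l') isOpen_univ h1 trivial fun _ => rfl]
  refine L.dlog_congr ?_
  filter_upwards [(hV.inter hOo).mem_nhds hy] with z hz
  ext
  rw [coe_expUnit, show l' z = l z from hO hz.2, hl' z hz.1]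

/-- The bracket is given only on global sections, so its locality must be derived. With a cutoff χ
supported where `w` vanishes and equal to 1 near `x`, the section χw is 0, and the Leibniz rule at
`x` leaves [u, w](x). -/
theorem bracket_eq_zero_of_eventuallyEq_zero (u : Cₛ^∞⟮𝓘(ℝ, E); F, B⟯)
    {w : Cₛ^∞⟮𝓘(ℝ, E); F, B⟯} {x : M} (hw : ∀ᶠ y in 𝓝 x, w y = 0) : L.bracket u w x = 0 := by
  obtain ⟨O, hO, hOo, hxO⟩ := mem_nhds_iff.1 hw
  obtain ⟨χ, hχ, hχN, hχ1⟩ := exists_bump (E := E) hOo hxO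
  have hχ' : SmoothOn E (fun y => (χ y : ℂ)) Set.univ :=
    Complex.ofRealCLM.contDiff.contMDiff.comp_contMDiffOn hχ.contMDiffOn
  have h0 : smulSection (fun y => (χ y : ℂ)) hχ' w = 0 := by
    ext y
    change (χ y : ℂ) • w y = 0
    by_cases hy : y ∈ tsupport χ
    · rw [show w y = 0 from hO (hχN hy), smul_zero]
    · simp [image_eq_zero_of_notMem_tsupport hy]
  have h := L.bracket_smulSection hχ' u w x
  rw [h0, bracket_zero, hw.self_of_nhds, hχ1.self_of_nhds] at h
  simpa using h.symm

theorem bracket_congr (u : Cₛ^∞⟮𝓘(ℝ, E); F, B⟯) {v w : Cₛ^∞⟮𝓘(ℝ, E); F, B⟯} {x : M}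
    (h : ∀ᶠ y in 𝓝 x, v y = w y) : L.bracket u v x = L.bracket u w x := by
  have h0 : L.bracket u (v - w) x = 0 := by
    refine L.bracket_eq_zero_of_eventuallyEq_zero u ?_
    filter_upwards [h] with y hy
    simp [hy]
  rw [← sub_add_cancel v w, L.bracket_add, ContMDiffSection.coe_add, Pi.add_apply, h0, zero_add]

end ComplexLieAlgebroid

variable [FiniteDimensional ℝ E] [T2Space M] (L : ComplexLieAlgebroid E M F B)

namespace BundleFrame

variable {N : Set M} (Φ : BundleFrame E F B N)

theorem dual_sum {x : M} (hx : x ∈ N) (a : Fin (Module.finrank ℂ F) → ℂ)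
    (j : Fin (Module.finrank ℂ F)) : Φ.c j x (∑ k, a k • Φ.b k x) = a j := by
  simp [map_sum, Φ.dual x hx]

/-- The coordinates of `u` are smooth only on `N`. Replacing them by global functions with the same
germ at `x` allows the Leibniz rule for global sections to be used. -/
theorem exists_coord (hN : IsOpen N) (u : Cₛ^∞⟮𝓘(ℝ, E); F, B⟯) {x : M} (hx : x ∈ N) :
    ∃ (G : Fin (Module.finrank ℂ F) → M → ℂ) (hG : ∀ k, SmoothOn E (G k) Set.univ),
      (∀ k, G k =ᶠ[𝓝 x] fun y => Φ.c k y (u y)) ∧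
      ∀ᶠ y in 𝓝 x, u y = (∑ k, smulSection (G k) (hG k) (Φ.b k)) y := by
  have h (k) := SmoothOn.exists_extension (Φ.smooth_dual k u) hN hx
  choose G hG hGe using h
  refine ⟨G, hG, hGe, ?_⟩
  filter_upwards [hN.mem_nhds hx, Filter.eventually_all.2 hGe] with y hy hy'
  rw [ComplexLieAlgebroid.section_sum_apply]
  refine (Φ.sum y hy (u y)).symm.trans (Finset.sum_congr rfl fun k _ => ?_)
  rw [← hy' k]
  rfl

/-- The matrix of the bracket with `X` in the frame. -/
def lieMatrix (X : Cₛ^∞⟮𝓘(ℝ, E); F, B⟯) (y : M) :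
    Matrix (Fin (Module.finrank ℂ F)) (Fin (Module.finrank ℂ F)) ℂ :=
  Matrix.of fun i k => Φ.c k y (L.bracket X (Φ.b i) y)

theorem bracket_eq (hN : IsOpen N) (X u : Cₛ^∞⟮𝓘(ℝ, E); F, B⟯) {x : M} (hx : x ∈ N) :
    L.bracket X u x = ∑ k, (cderiv (fun y => Φ.c k y (u y)) x (L.anchorField X x) • Φ.b k x
      + Φ.c k x (u x) • L.bracket X (Φ.b k) x) := by
  obtain ⟨G, hG, hGe, hu⟩ := Φ.exists_coord hN u hx
  rw [L.bracket_congr X hu, L.bracket_sum, ComplexLieAlgebroid.section_sum_apply]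
  refine Finset.sum_congr rfl fun k _ => ?_
  rw [L.bracket_smulSection, cderiv_congr (hGe k),
    (hGe k).self_of_nhds]

theorem c_bracket (hN : IsOpen N) (X u : Cₛ^∞⟮𝓘(ℝ, E); F, B⟯) {x : M} (hx : x ∈ N)
    (j : Fin (Module.finrank ℂ F)) :
    Φ.c j x (L.bracket X u x) = cderiv (fun y => Φ.c j y (u y)) x (L.anchorField X x)
      + ∑ k, Φ.c k x (u x) * Φ.lieMatrix L X x k j := by
  rw [Φ.bracket_eq L hN X u hx, Finset.sum_add_distrib, map_add, Φ.dual_sum hx, map_sum]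
  simp [lieMatrix]

theorem smoothOn_trace (X : Cₛ^∞⟮𝓘(ℝ, E); F, B⟯) :
    SmoothOn E (fun y => (Φ.lieMatrix L X y).trace) N :=
  SmoothOn.sum fun i _ => Φ.smooth_dual i (L.bracket X (Φ.b i))

theorem trace_add (X W : Cₛ^∞⟮𝓘(ℝ, E); F, B⟯) (x : M) : (Φ.lieMatrix L (X + W) x).trace
    = (Φ.lieMatrix L X x).trace + (Φ.lieMatrix L W x).trace := by
  rw [← Matrix.trace_add]
  congr 1
  ext i k
  simp [lieMatrix, L.add_bracket]

/-- The error term is the same -a(X)f as for the trace on tangent vectors, and arises in the same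
way from [fX, b_i] = f[X, b_i] - (a(b_i)f) X. -/
theorem trace_smul {f : M → ℂ} (hf : SmoothOn E f Set.univ) (X : Cₛ^∞⟮𝓘(ℝ, E); F, B⟯) {x : M}
    (hx : x ∈ N) : (Φ.lieMatrix L (smulSection f hf X) x).trace
      = f x * (Φ.lieMatrix L X x).trace - cderiv f x (L.anchorField X x) := by
  have h (i) : Φ.lieMatrix L (smulSection f hf X) x i i = f x * Φ.lieMatrix L X x i i
      - L.d0 f x (Φ.c i x (X x) • Φ.b i x) := by
    simp only [lieMatrix, Matrix.of_apply]
    rw [L.smulSection_bracket, map_sub, map_smul, map_smul, map_smul, smul_eq_mul, smul_eq_mul,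
      smul_eq_mul, mul_comm (cderiv f x _)]
    rfl
  simp_rw [Matrix.trace, Matrix.diag_apply, h]
  rw [Finset.sum_sub_distrib, ← Finset.mul_sum, ← map_sum, Φ.sum x hx]
  rfl

theorem trace_bracket (hN : IsOpen N) (X W : Cₛ^∞⟮𝓘(ℝ, E); F, B⟯) {x : M} (hx : x ∈ N) :
    (Φ.lieMatrix L (L.bracket X W) x).trace
      = cderiv (fun y => (Φ.lieMatrix L W y).trace) x (L.anchorField X x)
        - cderiv (fun y => (Φ.lieMatrix L X y).trace) x (L.anchorField W x) := by
  -- As on the tangent bundle: the matrix product here is symmetric in `X` and `W` under the trace,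
  -- and so drops out of the commutator supplied by the Jacobi identity.
  have key (X W : Cₛ^∞⟮𝓘(ℝ, E); F, B⟯) :
      ∑ i, Φ.c i x (L.bracket X (L.bracket W (Φ.b i)) x)
      = cderiv (fun y => (Φ.lieMatrix L W y).trace) x (L.anchorField X x)
        + (Φ.lieMatrix L W x * Φ.lieMatrix L X x).trace := by
    simp_rw [Φ.c_bracket L hN X _ hx]
    rw [Finset.sum_add_distrib]
    congr 1
    have h : cderiv (E := E) (fun y => (Φ.lieMatrix L W y).trace) x = _ := cderiv_sum hN
      (fun i _ => Φ.smooth_dual i (L.bracket W (Φ.b i))) hx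
    rw [h, LinearMap.sum_apply]
  have h (i) : Φ.lieMatrix L (L.bracket X W) x i i
      = Φ.c i x (L.bracket X (L.bracket W (Φ.b i)) x)
        - Φ.c i x (L.bracket W (L.bracket X (Φ.b i)) x) := by
    rw [L.jacobi X W (Φ.b i), ContMDiffSection.coe_add, Pi.add_apply, map_add,
      add_sub_cancel_right]
    rfl
  rw [Matrix.trace]
  simp_rw [Matrix.diag_apply, h]
  rw [Finset.sum_sub_distrib, key X W, key W X, Matrix.trace_mul_comm (Φ.lieMatrix L W x)]
  ring

/-! ### The modular form of a frame of `B` and a frame of the tangent bundle -/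

variable (T : TangentFrame E N)

/-- The function by which `∇_X` multiplies the local section of `Q_B` given by the frames. -/
def modularFun (X : Cₛ^∞⟮𝓘(ℝ, E); F, B⟯) (y : M) : ℂ :=
  (Φ.lieMatrix L X y).trace - T.lieTrace (L.anchorField X) y

/-- The modular form of the local section of `Q_B` given by the frames. -/
def modularForm (y : M) : Module.Dual ℂ (B y) := ∑ i, Φ.modularFun L T (Φ.b i) y • Φ.c i y

variable [CompleteSpace E]

theorem smoothOn_modularFun (X : Cₛ^∞⟮𝓘(ℝ, E); F, B⟯) : SmoothOn E (Φ.modularFun L T X) N :=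
  (Φ.smoothOn_trace L X).sub (TangentFrame.smoothOn_lieTrace (L.smoothCField_anchorField X))

theorem modularFun_add (X W : Cₛ^∞⟮𝓘(ℝ, E); F, B⟯) (x : M) :
    Φ.modularFun L T (X + W) x = Φ.modularFun L T X x + Φ.modularFun L T W x := by
  have h : L.anchorField (X + W) = fun y => L.anchorField X y + L.anchorField W y := by
    funext y
    simp [ComplexLieAlgebroid.anchorField]
  rw [modularFun, trace_add, h, TangentFrame.lieTrace_add (L.smoothCField_anchorField X)
    (L.smoothCField_anchorField W), modularFun, modularFun]
  ring

/-- The two defects -a(X)f cancel in the difference of traces. This C^∞-linearity is what makes the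
modular function come from a section of B*. -/
theorem modularFun_smul {f : M → ℂ} (hf : SmoothOn E f Set.univ) (X : Cₛ^∞⟮𝓘(ℝ, E); F, B⟯)
    {x : M} (hx : x ∈ N) :
    Φ.modularFun L T (smulSection f hf X) x = f x * Φ.modularFun L T X x := by
  have h : L.anchorField (smulSection f hf X) = fun y => f y • L.anchorField X y := by
    funext y
    exact (L.anchor y).map_smul _ _
  rw [modularFun, Φ.trace_smul L hf X hx, h,
    TangentFrame.lieTrace_smul hf (L.smoothCField_anchorField X) hx, modularFun]
  ring

theorem modularFun_bracket (hN : IsOpen N) (X W : Cₛ^∞⟮𝓘(ℝ, E); F, B⟯) {x : M} (hx : x ∈ N) :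
    Φ.modularFun L T (L.bracket X W) x
      = cderiv (Φ.modularFun L T W) x (L.anchorField X x)
        - cderiv (Φ.modularFun L T X) x (L.anchorField W x) := by
  have h : L.anchorField (L.bracket X W) = cLieBracket (L.anchorField X) (L.anchorField W) := by
    funext y
    exact L.anchor_bracket X W y
  have hd (X W : Cₛ^∞⟮𝓘(ℝ, E); F, B⟯) : cderiv (Φ.modularFun L T W) x (L.anchorField X x)
      = cderiv (fun y => (Φ.lieMatrix L W y).trace) x (L.anchorField X x)
        - cderiv (T.lieTrace (L.anchorField W)) x (L.anchorField X x) := by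
    have hs := TangentFrame.smoothOn_lieTrace (T := T) (L.smoothCField_anchorField W)
    have h1 : cderiv (E := E) (Φ.modularFun L T W) x
        = cderiv (fun y => (Φ.lieMatrix L W y).trace + -T.lieTrace (L.anchorField W) y) x := by
      simp_rw [← sub_eq_add_neg]
      rfl
    rw [h1, cderiv_add ((Φ.smoothOn_trace L W).mdifferentiableAt hN hx)
      (hs.neg.mdifferentiableAt hN hx), cderiv_neg]
    simp [sub_eq_add_neg]
  rw [hd, hd, modularFun, Φ.trace_bracket L hN X W hx, h, TangentFrame.lieTrace_cLieBracket hN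
    (L.smoothCField_anchorField X) (L.smoothCField_anchorField W) hx]
  ring

theorem modularFun_zero (x : M) : Φ.modularFun L T 0 x = 0 := by
  have h := Φ.modularFun_add L T 0 0 x
  rw [add_zero] at h
  exact left_eq_add.1 h

theorem modularFun_sum {ι : Type*} (s : Finset ι) (X : ι → Cₛ^∞⟮𝓘(ℝ, E); F, B⟯) (x : M) :
    Φ.modularFun L T (∑ i ∈ s, X i) x = ∑ i ∈ s, Φ.modularFun L T (X i) x :=
  map_sum (AddMonoidHom.mk' (fun X => Φ.modularFun L T X x) fun X W => Φ.modularFun_add L T X W x)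
    X s

theorem modularFun_eq_zero {X : Cₛ^∞⟮𝓘(ℝ, E); F, B⟯} {x : M} (hx : x ∈ N)
    (hX : ∀ᶠ y in 𝓝 x, X y = 0) : Φ.modularFun L T X x = 0 := by
  obtain ⟨O, hO, hOo, hxO⟩ := mem_nhds_iff.1 hX
  obtain ⟨χ, hχ, hχN, hχ1⟩ := exists_bump (E := E) hOo hxO
  have hχ' : SmoothOn E (fun y => (χ y : ℂ)) Set.univ :=
    Complex.ofRealCLM.contDiff.contMDiff.comp_contMDiffOn hχ.contMDiffOn
  have h0 : smulSection (fun y => (χ y : ℂ)) hχ' X = 0 := by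
    ext y
    change (χ y : ℂ) • X y = 0
    by_cases hy : y ∈ tsupport χ
    · rw [show X y = 0 from hO (hχN hy), smul_zero]
    · simp [image_eq_zero_of_notMem_tsupport hy]
  have h := Φ.modularFun_smul L T hχ' X hx
  rw [h0, modularFun_zero, hχ1.self_of_nhds] at h
  simpa using h.symm

/-- By C^∞-linearity the modular function depends only on the germ of `X`, so `X` may be replaced by
its expansion in the frame with globally extended coordinates. -/
theorem modularForm_apply (hN : IsOpen N) (X : Cₛ^∞⟮𝓘(ℝ, E); F, B⟯) {x : M} (hx : x ∈ N) :
    Φ.modularForm L T x (X x) = Φ.modularFun L T X x := by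
  obtain ⟨G, hG, hGe, hu⟩ := Φ.exists_coord hN X hx
  have h0 : Φ.modularFun L T (X - ∑ k, smulSection (G k) (hG k) (Φ.b k)) x = 0 := by
    refine Φ.modularFun_eq_zero L T hx ?_
    filter_upwards [hu] with y hy
    rw [ContMDiffSection.coe_sub, Pi.sub_apply, hy, sub_self]
  rw [← sub_add_cancel X (∑ k, smulSection (G k) (hG k) (Φ.b k)), modularFun_add, h0, zero_add,
    modularFun_sum, sub_add_cancel, modularForm, LinearMap.sum_apply]
  refine Finset.sum_congr rfl fun k _ => ?_
  rw [Φ.modularFun_smul L T (hG k) _ hx, (hGe k).self_of_nhds, LinearMap.smul_apply, smul_eq_mul,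
    mul_comm]

/-- After evaluation on sections, d_B ξ = 0 is precisely the cocycle identity `modularFun_bracket`.
-/
theorem isClosedOn_modularForm (hN : IsOpen N) : L.IsClosedOn (Φ.modularForm L T) N := by
  refine ⟨fun u => (Φ.smoothOn_modularFun L T u).congr fun y hy => Φ.modularForm_apply L T hN u hy,
    fun u v x hx => ?_⟩
  have h (w : Cₛ^∞⟮𝓘(ℝ, E); F, B⟯) : cderiv (E := E) (fun y => Φ.modularForm L T y (w y)) x
      = cderiv (Φ.modularFun L T w) x := by
    refine cderiv_congr ?_
    filter_upwards [hN.mem_nhds hx] with y hy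
    exact Φ.modularForm_apply L T hN w hy
  rw [ComplexLieAlgebroid.d1, h, h, Φ.modularForm_apply L T hN _ hx,
    Φ.modularFun_bracket L T hN u v hx]
  ring

end BundleFrame

end Algebroid

/-! ### The line bundle Q_B, its canonical representation, and modular forms. -/

section QBundle

variable {E : Type*} [NormedAddCommGroup E] [NormedSpace ℝ E]
  {M : Type*} [TopologicalSpace M] [ChartedSpace E M] [IsManifold 𝓘(ℝ, E) ∞ M]
  {F : Type*} [NormedAddCommGroup F] [NormedSpace ℂ F]
  {B : M → Type*} [∀ x, AddCommGroup (B x)] [∀ x, Module ℂ (B x)]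
  [∀ x, TopologicalSpace (B x)] [TopologicalSpace (Bundle.TotalSpace F B)] [FiberBundle F B]
  [VectorBundle ℂ F B] [VectorBundle ℝ F B]

/-- Evaluation of top forms on tangent vectors. -/
def evalTopForm {x : M} (v : Fin (Module.finrank ℝ E) → TangentSpace 𝓘(ℝ, E) x) :
    TopForm E x →ₗ[ℂ] ℂ where
  toFun μ := μ v
  map_add' _ _ := rfl
  map_smul' _ _ := rfl

namespace BundleFrame

variable {N : Set M} (Φ : BundleFrame E F B N) (T : TangentFrame E N)

/-! ### The line bundle `Q_B` in local frames -/

/-- The linear form on `∧^r B` which takes the value `1` on the frame. -/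
def wedgeCoord (y : M) : (⋀[ℂ]^(Module.finrank ℂ F) (B y)) →ₗ[ℂ] ℂ :=
  exteriorPower.alternatingMapLinearEquiv
    (Matrix.detRowAlternating.compLinearMap (LinearMap.pi fun k => Φ.c k y))

/-- The coordinate on `Q_B` given by the frames. -/
def qCoord (y : M) : QFiber E F B y →ₗ[ℂ] ℂ :=
  LinearMap.mul' ℂ ℂ ∘ₗ TensorProduct.map (Φ.wedgeCoord y) (evalTopForm fun j => T.Y j y)

/-- The local section of `Q_B` given by the frames. -/
def qFrame (y : M) : QFiber E F B y := wedge Φ.b y ⊗ₜ[ℂ] T.volumeForm y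

theorem wedgeCoord_ιMulti (y : M) (v : Fin (Module.finrank ℂ F) → B y) :
    Φ.wedgeCoord y (exteriorPower.ιMulti ℂ _ v) = (Matrix.of fun i k => Φ.c k y (v i)).det := by
  rw [wedgeCoord, exteriorPower.alternatingMapLinearEquiv_apply_ιMulti]
  rfl

theorem qCoord_tmul (y : M) (w : ⋀[ℂ]^(Module.finrank ℂ F) (B y)) (μ : TopForm E y) :
    Φ.qCoord T y (w ⊗ₜ[ℂ] μ) = Φ.wedgeCoord y w * μ fun j => T.Y j y := by
  simp [qCoord, evalTopForm]

variable {Φ T}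

/-- It suffices to check decomposable elements, where the expansion of an alternating map by a
determinant applies to the wedge itself. -/
theorem eq_wedgeCoord_smul {y : M} (hy : y ∈ N) (w : ⋀[ℂ]^(Module.finrank ℂ F) (B y)) :
    w = Φ.wedgeCoord y w • wedge Φ.b y := by
  have h : LinearMap.id = (LinearMap.toSpanSingleton ℂ _ (wedge Φ.b y)) ∘ₗ Φ.wedgeCoord y := by
    refine exteriorPower.linearMap_ext ?_
    ext v
    have h1 := alternatingMap_sum_smul (exteriorPower.ιMulti ℂ (Module.finrank ℂ F))
      (fun k => Φ.b k y) (Matrix.of fun i k => Φ.c k y (v i))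
    simp only [Matrix.of_apply, Φ.sum y hy] at h1
    simp only [LinearMap.compAlternatingMap_apply, LinearMap.id_apply, LinearMap.comp_apply,
      LinearMap.toSpanSingleton_apply, wedgeCoord_ιMulti]
    exact congrArg _ h1
  exact congrArg (fun l => l w) h

theorem eq_qCoord_smul {y : M} (hy : y ∈ N) (q : QFiber E F B y) :
    q = Φ.qCoord T y q • Φ.qFrame T y := by
  induction q using TensorProduct.induction_on with
  | zero => simp
  | add a b ha hb => rw [map_add, add_smul, ← ha, ← hb]
  | tmul w μ =>
    rw [qCoord_tmul]
    nth_rewrite 1 [eq_wedgeCoord_smul (Φ := Φ) hy w, TangentFrame.topForm_eq_smul (T := T) hy μ]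
    rw [TensorProduct.smul_tmul_smul, qFrame]

theorem qCoord_injective {y : M} (hy : y ∈ N) {q q' : QFiber E F B y}
    (h : Φ.qCoord T y q = Φ.qCoord T y q') : q = q' := by
  rw [eq_qCoord_smul (Φ := Φ) (T := T) hy q, h, ← eq_qCoord_smul hy q']

theorem qCoord_ne_zero {y : M} (hy : y ∈ N) {q : QFiber E F B y} (hq : q ≠ 0) :
    Φ.qCoord T y q ≠ 0 := fun h => hq (by rw [eq_qCoord_smul (Φ := Φ) (T := T) hy q, h, zero_smul])

theorem qCoord_qFrame {y : M} (hy : y ∈ N) : Φ.qCoord T y (Φ.qFrame T y) = 1 := by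
  have h : (Matrix.of fun i k => Φ.c k y (Φ.b i y)) = 1 := by
    ext i k
    simp only [Matrix.of_apply, Φ.dual y hy, Matrix.one_apply, eq_comm]
  rw [qFrame, qCoord_tmul, wedge, wedgeCoord_ιMulti, TangentFrame.volumeForm_apply,
    TangentFrame.coordMatrix_frame hy, Matrix.det_one, mul_one, h, Matrix.det_one]

theorem qCoord_wedge_tmul (u : Fin (Module.finrank ℂ F) → Cₛ^∞⟮𝓘(ℝ, E); F, B⟯) (y : M)
    (μ : TopForm E y) : Φ.qCoord T y (wedge u y ⊗ₜ[ℂ] μ)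
      = (Matrix.of fun i k => Φ.c k y (u i y)).det * μ fun j => T.Y j y := by
  rw [qCoord_tmul, wedge, wedgeCoord_ιMulti]

theorem smoothOn_qCoord (hN : IsOpen N) {e : ∀ x : M, QFiber E F B x} {s : Set M}
    (he : IsQFrameOn e s) : SmoothOn E (fun y => Φ.qCoord T y (e y)) (N ∩ s) := by
  refine SmoothOn.of_locally fun x hx => ?_
  obtain ⟨-, u, μ, hμ, hu⟩ := he x hx.2
  obtain ⟨O, hO, hOo, hxO⟩ := mem_nhds_iff.1 hu
  refine ⟨O ∩ N, hOo.inter hN, ⟨hxO, hx.1⟩, ?_⟩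
  have h1 : SmoothOn E (fun y => (Matrix.of fun i k => Φ.c k y (u i y)).det) (O ∩ N) :=
    SmoothOn.det fun i k => (Φ.smooth_dual k (u i)).mono Set.inter_subset_right
  refine (h1.mul (TangentFrame.smoothOn_topForm_frame (T := T) hμ _)).congr fun y hy => ?_
  rw [show e y = _ from hO hy.1, qCoord_wedge_tmul]

/-- The canonical representation in local frames. -/
theorem qCoord_nabla [FiniteDimensional ℝ E] [T2Space M] (hN : IsOpen N)
    {L : ComplexLieAlgebroid E M F B}
    {X : Cₛ^∞⟮𝓘(ℝ, E); F, B⟯} {e : ∀ x : M, QFiber E F B x} {x : M} (hx : x ∈ N)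
    {q : QFiber E F B x} (hq : L.IsNablaAt X e x q) :
    Φ.qCoord T x q = cderiv (fun y => Φ.qCoord T y (e y)) x (L.anchorField X x)
      + Φ.modularFun L T X x * Φ.qCoord T x (e x) := by
  have := FiniteDimensional.complete ℝ E
  obtain ⟨u, μ, ν, hμ, hν, he, rfl⟩ := hq
  let U : Fin (Module.finrank ℂ F) → Fin (Module.finrank ℂ F) → M → ℂ :=
    fun i k y => Φ.c k y (u i y)
  have hU (i k) : SmoothOn E (U i k) N := Φ.smooth_dual k (u i)
  have hdet : SmoothOn E (fun y => (Matrix.of fun i k => U i k y).det) N := SmoothOn.det hU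
  have hm := TangentFrame.smoothOn_topForm_frame (T := T) hμ N
  have h1 : cderiv (E := E) (fun y => Φ.qCoord T y (e y)) x
      = cderiv (fun y => (Matrix.of fun i k => U i k y).det * μ y fun j => T.Y j y) x := by
    refine cderiv_congr ?_
    filter_upwards [he] with y hy
    rw [hy, qCoord_wedge_tmul]
  -- Bracketing the i-th factor replaces row `i` of the coordinate matrix by its derivative plus the
  -- row times the matrix of ad X. Summing over `i` gives the derivative of the determinant plus a
  -- trace term.
  have h2 (i) : Φ.wedgeCoord x (wedge (Function.update u i (L.bracket X (u i))) x)
      = ((Matrix.of fun i k => U i k x).updateRow i fun k =>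
          cderiv (U i k) x (L.anchorField X x) + ∑ j, U i j x * Φ.lieMatrix L X x j k).det := by
    rw [wedge, wedgeCoord_ιMulti]
    congr 1
    ext i' k
    by_cases h : i' = i
    · subst h
      simpa using Φ.c_bracket L hN X (u i') hx k
    · simp [U, h]
  rw [h1, cderiv_mul (hdet.mdifferentiableAt hN hx) (hm.mdifferentiableAt hN hx), map_add,
    qCoord_tmul, map_sum, he.self_of_nhds, qCoord_wedge_tmul, qCoord_wedge_tmul,
    TangentFrame.isLieDeriv_apply_frame hN hμ hν hx, modularFun]
  simp_rw [h2]
  rw [sum_det_updateRow_cderiv_add hN hU hx]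
  simp only [LinearMap.add_apply, LinearMap.smul_apply, smul_eq_mul]
  ring

end BundleFrame

variable [FiniteDimensional ℝ E] [T2Space M]

/-- The coefficient is absorbed into the top form, which yields the required local presentation as a
wedge tensor a form. -/
theorem BundleFrame.isQFrameOn_of_eq_smul {N : Set M} (hN : IsOpen N) (Φ : BundleFrame E F B N)
    (T : TangentFrame E N) {s : Set M} (hs : IsOpen s) (hsN : s ⊆ N)
    {e : ∀ x : M, QFiber E F B x} {G : M → ℂ}
    (hG : SmoothOn E G s) (hG0 : ∀ y ∈ s, G y ≠ 0) (he : ∀ y ∈ s, e y = G y • Φ.qFrame T y) :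
    IsQFrameOn e s := by
  intro x hx
  refine ⟨fun h0 => ?_, ?_⟩
  · have h1 := congrArg (Φ.qCoord T x) h0
    rw [he x hx, map_smul, qCoord_qFrame (hsN hx), map_zero] at h1
    exact hG0 x hx (by simpa using h1)
  · obtain ⟨μ, hμ, hμe⟩ := T.exists_smoothTopForm hN hs hG (hsN hx) hx
    refine ⟨Φ.b, μ, hμ, ?_⟩
    filter_upwards [hμe, hs.mem_nhds hx] with y hy hys
    rw [he y hys, hy, qFrame, TensorProduct.tmul_smul]

theorem IsQFrameOn.mono {e : ∀ x : M, QFiber E F B x} {s t : Set M} (he : IsQFrameOn e s)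
    (h : t ⊆ s) : IsQFrameOn e t := fun x hx => he x (h hx)

variable [FiniteDimensional ℂ F] [ContMDiffVectorBundle ∞ F B 𝓘(ℝ, E)]

theorem exists_frames (x : M) : ∃ N, IsOpen N ∧ x ∈ N ∧ Nonempty (BundleFrame E F B N) ∧
    Nonempty (TangentFrame E N) := by
  obtain ⟨N, hN, hx, ⟨Φ⟩⟩ := exists_bundleFrame (E := E) (F := F) (B := B) x
  obtain ⟨N', hN', hx', ⟨T⟩⟩ := exists_tangentFrame (E := E) x
  refine ⟨N ∩ N', hN.inter hN', ⟨hx, hx'⟩, ⟨⟨Φ.b, Φ.c, fun y hy => Φ.dual y hy.1,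
    fun y hy => Φ.sum y hy.1, fun i u => (Φ.smooth_dual i u).mono Set.inter_subset_left⟩⟩,
    ⟨⟨T.Y, T.smooth, T.η, fun y hy => T.dual y hy.2, fun y hy => T.sum y hy.2,
    fun i Z hZ => (T.smooth_dual i Z hZ).mono Set.inter_subset_right⟩⟩⟩

theorem eq_of_smul_eq_smul {x : M} {q : QFiber E F B x} (hq : q ≠ 0) {a b : ℂ}
    (h : a • q = b • q) : a = b := by
  obtain ⟨N, hN, hxN, ⟨Φ⟩, ⟨T⟩⟩ := exists_frames (E := E) (F := F) (B := B) x
  refine mul_right_cancel₀ (Φ.qCoord_ne_zero (T := T) hxN hq) ?_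
  simpa using congrArg (Φ.qCoord T x) h

theorem IsQFrameOn.smul {e e' : ∀ x : M, QFiber E F B x} {s : Set M} (hs : IsOpen s)
    (he : IsQFrameOn e s) {g : M → ℂˣ} (hg : SmoothUnitOn E g s)
    (h : ∀ y ∈ s, e' y = (g y : ℂ) • e y) : IsQFrameOn e' s := by
  intro x hx
  obtain ⟨N, hN, hxN, ⟨Φ⟩, ⟨T⟩⟩ := exists_frames (E := E) (F := F) (B := B) x
  refine Φ.isQFrameOn_of_eq_smul hN T (hN.inter hs) Set.inter_subset_left
    (G := fun y => (g y : ℂ) * Φ.qCoord T y (e y))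
    (SmoothOn.mul (hg.mono Set.inter_subset_right) (Φ.smoothOn_qCoord hN he))
    (fun y hy => ?_) (fun y hy => ?_) x ⟨hxN, hx⟩
  · exact mul_ne_zero (g y).ne_zero (Φ.qCoord_ne_zero hy.1 (he y hy.2).1)
  · rw [h y hy.2, mul_smul, ← Φ.eq_qCoord_smul hy.1]

/-- The quotient of two frames of `Q_B` is smooth. -/
theorem smoothUnitOn_of_eq_smul {e e' : ∀ x : M, QFiber E F B x} {s : Set M} (hs : IsOpen s)
    (he : IsQFrameOn e s) (he' : IsQFrameOn e' s) {g : M → ℂˣ}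
    (h : ∀ y ∈ s, e' y = (g y : ℂ) • e y) : SmoothUnitOn E g s := by
  refine SmoothOn.of_locally fun x hx => ?_
  obtain ⟨N, hN, hxN, ⟨Φ⟩, ⟨T⟩⟩ := exists_frames (E := E) (F := F) (B := B) x
  have h0 (y) (hy : y ∈ N ∩ s) : Φ.qCoord T y (e y) ≠ 0 :=
    Φ.qCoord_ne_zero hy.1 (he y hy.2).1
  have hG := Φ.smoothOn_qCoord (T := T) hN he
  refine ⟨N ∩ s, hN.inter hs, ⟨hxN, hx⟩, ?_⟩
  have hinv : SmoothOn E (fun y => (Φ.qCoord T y (e y))⁻¹) (N ∩ s) := fun y hy =>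
    ContMDiffAt.comp_contMDiffWithinAt (I' := 𝓘(ℝ, ℂ)) y
      (contDiffAt_inv ℝ (h0 y hy)).contMDiffAt (hG y hy)
  refine ((Φ.smoothOn_qCoord (T := T) hN he').mul hinv).congr fun y hy => ?_
  rw [h y hy.2, map_smul, smul_eq_mul, mul_inv_cancel_right₀ (h0 y hy)]

/-- Any two frames of `Q_B` differ by a nowhere vanishing function. -/
theorem exists_eq_smul {x : M} {q q' : QFiber E F B x} (hq : q ≠ 0) (hq' : q' ≠ 0) :
    ∃ g : ℂˣ, q' = (g : ℂ) • q := by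
  obtain ⟨N, hN, hxN, ⟨Φ⟩, ⟨T⟩⟩ := exists_frames (E := E) (F := F) (B := B) x
  have h := Φ.qCoord_ne_zero (T := T) hxN hq
  refine ⟨Units.mk0 _ (div_ne_zero (Φ.qCoord_ne_zero (T := T) hxN hq') h), ?_⟩
  refine Φ.qCoord_injective (T := T) hxN ?_
  rw [map_smul, Units.val_mk0, smul_eq_mul, div_mul_cancel₀ _ h]

theorem exists_isQFrameOn (x : M) : ∃ N, IsOpen N ∧ x ∈ N ∧
    ∃ e : ∀ x : M, QFiber E F B x, IsQFrameOn e N := by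
  obtain ⟨N, hN, hxN, ⟨Φ⟩, ⟨T⟩⟩ := exists_frames (E := E) (F := F) (B := B) x
  exact ⟨N, hN, hxN, Φ.qFrame T, Φ.isQFrameOn_of_eq_smul hN T hN subset_rfl (SmoothOn.const 1 N)
    (fun _ _ => one_ne_zero) fun y _ => (one_smul _ _).symm⟩

/-! ### Modular forms -/

namespace ComplexLieAlgebroid

variable {L : ComplexLieAlgebroid E M F B}

/-- The definition of ∇_X e goes through a chosen presentation of `e`, but the coordinate formula
`BundleFrame.qCoord_nabla` involves only `e` itself. -/
theorem IsNablaAt.unique {X : Cₛ^∞⟮𝓘(ℝ, E); F, B⟯} {e : ∀ x : M, QFiber E F B x} {x : M}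
    {q q' : QFiber E F B x} (h : L.IsNablaAt X e x q) (h' : L.IsNablaAt X e x q') : q = q' := by
  obtain ⟨N, hN, hxN, ⟨Φ⟩, ⟨T⟩⟩ := exists_frames (E := E) (F := F) (B := B) x
  exact Φ.qCoord_injective (T := T) hxN
    ((Φ.qCoord_nabla hN hxN h).trans (Φ.qCoord_nabla hN hxN h').symm)

variable (L) in
theorem exists_isNablaAt (X : Cₛ^∞⟮𝓘(ℝ, E); F, B⟯) {e : ∀ x : M, QFiber E F B x} {s : Set M}
    (he : IsQFrameOn e s) {x : M} (hx : x ∈ s) : ∃ q, L.IsNablaAt X e x q := by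
  obtain ⟨-, u, μ, hμ, hu⟩ := he x hx
  obtain ⟨ν, hν⟩ := exists_isLieDeriv (L.anchorField X) hμ
  exact ⟨_, u, μ, ν, hμ, hν, hu, rfl⟩

theorem exists_section_apply_eq {x : M} (v : B x) : ∃ X : Cₛ^∞⟮𝓘(ℝ, E); F, B⟯, X x = v := by
  obtain ⟨N, hN, hxN, ⟨Φ⟩⟩ := exists_bundleFrame (E := E) (F := F) (B := B) x
  refine ⟨∑ k, smulSection (fun _ => Φ.c k x v) (SmoothOn.const _ _) (Φ.b k), ?_⟩
  rw [section_sum_apply]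
  exact Φ.sum x hxN v

/-- Every vector of `B x` is the value of a global section, and ∇_X e is well defined with `e x ≠
0`, so the form is determined point by point. -/
theorem modularForm_unique {e : ∀ x : M, QFiber E F B x} {ξ η : ∀ x : M, Module.Dual ℂ (B x)}
    {s t : Set M} (hξ : L.IsModularFormOn e ξ s) (hη : L.IsModularFormOn e η t) {x : M}
    (hs : x ∈ s) (ht : x ∈ t) (h0 : e x ≠ 0) : ξ x = η x := by
  ext v
  obtain ⟨X, rfl⟩ := exists_section_apply_eq (E := E) (F := F) v
  exact eq_of_smul_eq_smul h0 ((hξ.2 X x hs).unique (hη.2 X x ht))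

theorem exists_modularForm_nhds {e : ∀ x : M, QFiber E F B x} {s : Set M} (hs : IsOpen s)
    (he : IsQFrameOn e s) {x : M} (hx : x ∈ s) : ∃ N, IsOpen N ∧ x ∈ N ∧ N ⊆ s ∧
      ∃ ξ : ∀ x : M, Module.Dual ℂ (B x), L.IsClosedOn ξ N ∧ L.IsModularFormOn e ξ N := by
  have := FiniteDimensional.complete ℝ E
  classical
  obtain ⟨N, hN, hxN, ⟨Φ⟩, ⟨T⟩⟩ := exists_frames (E := E) (F := F) (B := B) x
  -- The coordinate of `e`, with the value 1 put in where it vanishes. On `N ∩ s` it never vanishes,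
  -- so there e = g·(frame), and the candidate form is d̃g plus the modular form of the frame.
  let g (y : M) : ℂˣ := if h : Φ.qCoord T y (e y) = 0 then 1 else Units.mk0 _ h
  have hg (y) (hy : y ∈ N ∩ s) : (g y : ℂ) = Φ.qCoord T y (e y) := by
    simp only [g]
    rw [dif_neg (Φ.qCoord_ne_zero hy.1 (he y hy.2).1), Units.val_mk0]
  have hNs := hN.inter hs
  have hgs : SmoothUnitOn E g (N ∩ s) := (Φ.smoothOn_qCoord hN he).congr hg
  have hc : L.IsClosedOn (L.dlog g + Φ.modularForm L T) (N ∩ s) :=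
    (L.isClosedOn_dlog hNs hgs).add hNs
      ((Φ.isClosedOn_modularForm L T hN).mono Set.inter_subset_left)
  refine ⟨N ∩ s, hNs, ⟨hxN, hx⟩, Set.inter_subset_right, _, hc, hc.1, fun X y hy => ?_⟩
  obtain ⟨q, hq⟩ := L.exists_isNablaAt X he hy.2
  convert! hq
  refine Φ.qCoord_injective (T := T) hy.1 ?_
  have hd : cderiv (E := E) (fun z => (g z : ℂ)) y = cderiv (fun z => Φ.qCoord T z (e z)) y :=
    cderiv_congr (Filter.eventually_of_mem (hNs.mem_nhds hy) hg)
  rw [Φ.qCoord_nabla hN hy.1 hq, map_smul, ← hd, Pi.add_apply, LinearMap.add_apply,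
    Φ.modularForm_apply L T hN X hy.1, ← hg y hy, dlog, d0, LinearMap.smul_apply,
    LinearMap.comp_apply, smul_eq_mul, smul_eq_mul, anchorField]
  have := (g y).ne_zero
  field_simp

/-- Uniqueness makes the local forms agree, so the form chosen near `y` may be evaluated at `y`
itself to glue them. -/
theorem exists_modularForm {e : ∀ x : M, QFiber E F B x} {s : Set M} (hs : IsOpen s)
    (he : IsQFrameOn e s) : ∃ ξ : ∀ x : M, Module.Dual ℂ (B x),
      L.IsClosedOn ξ s ∧ L.IsModularFormOn e ξ s := by
  classical
  have h (x) (hx : x ∈ s) := exists_modularForm_nhds (L := L) hs he hx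
  choose! N hN hxN hNs ξ hc hξ using h
  have heq (x) (hx : x ∈ s) (y) (hy : y ∈ N x) : ξ y y = ξ x y :=
    modularForm_unique (hξ y (hNs x hx hy)) (hξ x hx) (hxN y (hNs x hx hy)) hy
      (he y (hNs x hx hy)).1
  have hcl : L.IsClosedOn (fun x => ξ x x) s :=
    IsClosedOn.of_locally L fun x hx => ⟨N x, hN x hx, hxN x hx, ξ x, hc x hx, heq x hx⟩
  exact ⟨fun x => ξ x x, hcl, hcl.1, fun X x hx => (hξ x hx).2 X x (hxN x hx)⟩

theorem IsModularFormOn.isClosedOn {e : ∀ x : M, QFiber E F B x}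
    {ξ : ∀ x : M, Module.Dual ℂ (B x)} {s : Set M} (hs : IsOpen s) (he : IsQFrameOn e s)
    (h : L.IsModularFormOn e ξ s) : L.IsClosedOn ξ s := by
  obtain ⟨η, hc, hη⟩ := exists_modularForm (L := L) hs he
  exact IsClosedOn.of_locally L fun x hx => ⟨s, hs, hx, η, hc, fun y hy =>
    modularForm_unique h hη hy hy (he y hy).1⟩

/-- The modular form of the frame `g e` is `ξ + d̃ g`. -/
theorem IsModularFormOn.smul {e e' : ∀ x : M, QFiber E F B x}
    {ξ : ∀ x : M, Module.Dual ℂ (B x)} {s : Set M} (hs : IsOpen s) (he : IsQFrameOn e s)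
    (hξ : L.IsModularFormOn e ξ s) {g : M → ℂˣ} (hg : SmoothUnitOn E g s)
    (h : ∀ y ∈ s, e' y = (g y : ℂ) • e y) : L.IsModularFormOn e' (ξ + L.dlog g) s := by
  refine ⟨fun u => (hξ.1 u).add ((L.isClosedOn_dlog hs hg).1 u), fun X x hx => ?_⟩
  obtain ⟨N, hN, hxN, ⟨Φ⟩, ⟨T⟩⟩ := exists_frames (E := E) (F := F) (B := B) x
  obtain ⟨q, hq⟩ := L.exists_isNablaAt X (he.smul hs hg h) hx
  convert! hq
  refine Φ.qCoord_injective (T := T) hxN ?_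
  have hNs := hN.inter hs
  have hG := Φ.smoothOn_qCoord (T := T) hN he
  have hd : cderiv (E := E) (fun z => Φ.qCoord T z (e' z)) x
      = cderiv (fun z => (g z : ℂ) * Φ.qCoord T z (e z)) x := by
    refine cderiv_congr ?_
    filter_upwards [hs.mem_nhds hx] with y hy
    rw [h y hy, map_smul, smul_eq_mul]
  have h1 := Φ.qCoord_nabla (T := T) hN hxN (hξ.2 X x hx)
  rw [map_smul, smul_eq_mul] at h1
  rw [Φ.qCoord_nabla hN hxN hq, hd, cderiv_mul (SmoothOn.mdifferentiableAt hg hs hx)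
    (hG.mdifferentiableAt hNs ⟨hxN, hx⟩), map_smul, h x hx, map_smul, Pi.add_apply,
    LinearMap.add_apply, LinearMap.add_apply, LinearMap.smul_apply, LinearMap.smul_apply, dlog, d0,
    LinearMap.smul_apply, LinearMap.comp_apply]
  simp only [smul_eq_mul, anchorField] at h1 ⊢
  have := (g x).ne_zero
  field_simp
  linear_combination (g x : ℂ) * h1

end ComplexLieAlgebroid

end QBundle

/-! ### The connecting map τ, exactness, and the kernel of H¹ → H̃¹. -/

namespace ComplexLieAlgebroid

variable {E : Type*} [NormedAddCommGroup E] [NormedSpace ℝ E]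
  {M : Type*} [TopologicalSpace M] [ChartedSpace E M] [IsManifold 𝓘(ℝ, E) ∞ M]
  {F : Type*} [NormedAddCommGroup F] [NormedSpace ℂ F]
  {B : M → Type*} [∀ x, AddCommGroup (B x)] [∀ x, Module ℂ (B x)]
  [∀ x, TopologicalSpace (B x)] [TopologicalSpace (Bundle.TotalSpace F B)] [FiberBundle F B]
  [VectorBundle ℂ F B] [VectorBundle ℝ F B]
  [FiniteDimensional ℝ E] [T2Space M] [FiniteDimensional ℂ F] [ContMDiffVectorBundle ∞ F B 𝓘(ℝ, E)]

section Connecting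

variable (L : ComplexLieAlgebroid E M F B)

/-! ### The connecting map and exactness -/

theorem dlog_div {f g : M → ℂˣ} {s : Set M} (hs : IsOpen s) (hf : SmoothUnitOn E f s)
    (hg : SmoothUnitOn E g s) {x : M} (hx : x ∈ s) :
    L.dlog (fun y => f y / g y) x = L.dlog f x - L.dlog g x := by
  rw [sub_eq_add_neg, ← dlog_inv hs hg hx, ← dlog_mul hs hf hg.inv hx]
  exact dlog_congr L (Filter.Eventually.of_forall fun y => div_eq_mul_inv _ _)

theorem tildeCoboundary_le : L.tildeCoboundary ≤ L.tildeCocycle := by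
  rintro c ⟨U, hU, h, h1, h2, h3⟩
  obtain ⟨V, hV, k2, k3⟩ := unitCoboundary_le
    (show c.2 ∈ unitCoboundary E M from ⟨U, hU, h, h1, h3⟩)
  have hUV := hU.inter hV
  refine ⟨_, hUV, fun p => ?_, fun p q => (k2 p q).mono (by grind), fun p q y hy => ?_,
    fun p q r y hy => k3 p q r y (by grind)⟩
  · exact IsClosedOn.of_locally L fun x hx => ⟨U p, (hU p).1, hx.1, L.dlog (h p),
      L.isClosedOn_dlog (hU p).1 (h1 p), h2 p⟩
  · have ho := hU.isOpen₂ p q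
    have e : L.dlog (c.2.toMul p q) y = L.dlog (fun z => h p z / h q z) y :=
      dlog_congr L (Filter.eventually_of_mem (ho.mem_nhds (by grind)) (h3 p q))
    rw [h2 p y (by grind), h2 q y (by grind), e,
      L.dlog_div ho ((h1 p).mono (by grind)) ((h1 q).mono (by grind)) (by grind)]
    abel

variable {L} in
theorem mk_eq_mk {c c' : L.tildeCocycle} {U : M → Set M} (hU : NbhdCover U) {h : M → M → ℂˣ}
    (h1 : ∀ p, SmoothUnitOn E (h p) (U p))
    (h2 : ∀ p, ∀ y ∈ U p, c.1.1 p y = c'.1.1 p y + L.dlog (h p) y)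
    (h3 : ∀ p q, ∀ y ∈ U p ∩ U q,
      c.1.2.toMul p q y = c'.1.2.toMul p q y * (h p y / h q y)) :
    (QuotientAddGroup.mk c : L.HTilde1) = QuotientAddGroup.mk c' := by
  refine (QuotientAddGroup.eq.2 (AddSubgroup.mem_addSubgroupOf.2 ?_)).symm
  refine ⟨U, hU, h, h1, fun p y hy => ?_, fun p q y hy => ?_⟩
  · simp [h2 p y hy]
  · simp [h3 p q y hy]

/-- The map of cocycles `(ξ, f) ↦ f`. -/
def forgetCocycle : L.tildeCocycle →+ unitCocycle E M :=
  ((AddMonoidHom.snd _ _).comp L.tildeCocycle.subtype).codRestrict (unitCocycle E M) fun c => by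
    obtain ⟨U, hU, -, h2, -, h4⟩ := c.2
    exact ⟨U, hU, h2, h4⟩

/-- The map `H̃¹(B, ℂ) → H¹(M, 𝒮ˣ)`, `[(ξ, f)] ↦ [f]`. -/
def forget : L.HTilde1 →+ H1Unit E M :=
  QuotientAddGroup.map _ _ L.forgetCocycle (by
    rintro c ⟨U, hU, h, h1, -, h3⟩
    exact ⟨U, hU, h, h1, h3⟩)

/-- The connecting map `H̃¹(B, ℂ) → H²(M, ℤ)`. -/
def connecting [ParacompactSpace M] : L.HTilde1 →+ H2Int M := (expConnecting E M).comp L.forget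

variable {L} in
theorem isConnecting_iff [ParacompactSpace M] {a : L.HTilde1} {b : H2Int M} :
    L.IsConnecting a b ↔ b = L.connecting a := by
  have key {a : L.HTilde1} {b : H2Int M} (h : L.IsConnecting a b) : b = L.connecting a := by
    obtain ⟨c, n, rfl, rfl, hn⟩ := h
    exact isExpConnecting_iff.1 ⟨L.forgetCocycle c, n, rfl, rfl, hn⟩
  refine ⟨key, ?_⟩
  rintro rfl
  obtain ⟨c, rfl⟩ := QuotientAddGroup.mk_surjective a
  obtain ⟨W, k, n, hW, hk, hn⟩ := exists_isLogCoboundary_add (L.forgetCocycle c).2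
  -- The twist that makes `f` have logarithms is completed by the forms d̃k to a coboundary of the
  -- total complex, so the class in H̃¹ is unchanged.
  let t : (M → ∀ x : M, Module.Dual ℂ (B x)) × Additive (M → M → M → ℂˣ) :=
    (fun p => L.dlog (k p), Additive.ofMul fun p q y => k p y / k q y)
  have ht : t ∈ L.tildeCoboundary := ⟨W, hW, k, hk, fun _ _ _ => rfl, fun _ _ _ _ => rfl⟩
  let c' : L.tildeCocycle := c + ⟨t, L.tildeCoboundary_le ht⟩
  have hc : (QuotientAddGroup.mk c : L.HTilde1) = QuotientAddGroup.mk c' := by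
    refine QuotientAddGroup.eq.2 (AddSubgroup.mem_addSubgroupOf.2 ?_)
    simpa [c'] using ht
  have h : L.IsConnecting (QuotientAddGroup.mk c)
      (QuotientAddGroup.mk ⟨n, hn.mem_intCocycle⟩) := ⟨c', _, hc, rfl, hn⟩
  rwa [key h] at h

/-- The composite is zero because `forget` kills pairs (ξ, 1). Conversely, if τ vanishes then f =
h_p/h_q, and subtracting the coboundary of `h` leaves forms that agree on overlaps and a trivial
cocycle of functions. -/
theorem range_toTilde [SigmaCompactSpace M] [ParacompactSpace M] :
    L.toTilde.range = L.connecting.ker := by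
  ext a
  constructor
  · rintro ⟨b, rfl⟩
    obtain ⟨ξ, rfl⟩ := QuotientAddGroup.mk_surjective b
    have h : L.forget (L.toTilde (QuotientAddGroup.mk ξ)) = 0 := rfl
    rw [AddMonoidHom.mem_ker, connecting, AddMonoidHom.comp_apply, h, map_zero]
  · intro ha
    obtain ⟨c, rfl⟩ := QuotientAddGroup.mk_surjective a
    obtain ⟨V, hV, h, h1, h2⟩ := mem_unitCoboundary_of_isExpConnecting (L.forgetCocycle c) ha
    obtain ⟨U, hU, c1, -, c3, -⟩ := c.2
    have hUV := hU.inter hV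
    have key (p y : M) (hy : y ∈ U p ∩ V p) :
        c.1.1 y y - L.dlog (h y) y = c.1.1 p y - L.dlog (h p) y := by
      have hyy := (hUV y).2
      have e : L.dlog (c.1.2.toMul y p) y = L.dlog (fun z => h y z / h p z) y :=
        dlog_congr L (Filter.eventually_of_mem ((hV.isOpen₂ y p).mem_nhds ⟨hyy.2, hy.2⟩)
          (h2 y p))
      rw [c3 y p y ⟨hyy.1, hy.1⟩, e, L.dlog_div (hV.isOpen₂ y p) ((h1 y).mono (by grind))
        ((h1 p).mono (by grind)) ⟨hyy.2, hy.2⟩]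
      abel
    -- Since the cover is indexed by points, the glued form is read off on the diagonal: at `y` the
    -- member with index `y` is used.
    let ξ (y : M) : Module.Dual ℂ (B y) := c.1.1 y y - L.dlog (h y) y
    have hξ : ξ ∈ L.closedForms := IsClosedOn.of_locally L fun x _ =>
      ⟨_, (hUV x).1, (hUV x).2, c.1.1 x + -L.dlog (h x),
        ((c1 x).mono Set.inter_subset_left).add (hUV x).1
          (((L.isClosedOn_dlog (hV x).1 (h1 x)).mono Set.inter_subset_right).neg),
        fun y hy => (key x y hy).trans (sub_eq_add_neg _ _)⟩
    refine ⟨QuotientAddGroup.mk ⟨ξ, hξ⟩, (mk_eq_mk hUV (fun p => (h1 p).mono (by grind))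
      (fun p y hy => ?_) fun p q y hy => ?_).symm⟩
    · exact (sub_eq_iff_eq_add.1 (key p y hy).symm)
    · exact (h2 p q y (by grind)).trans (one_mul _).symm

/-- The kernel of `H¹(B, ℂ) → H̃¹(B, ℂ)`. -/
theorem toTilde_mk_eq_zero_iff (ξ : L.closedForms) :
    L.toTilde (QuotientAddGroup.mk ξ) = 0 ↔
      ∃ g : M → ℂˣ, SmoothUnitOn E g Set.univ ∧ ξ.1 = L.dlog g := by
  have hz : L.toTilde (QuotientAddGroup.mk ξ) = 0 ↔
      (L.toTildeCocycle ξ).1 ∈ L.tildeCoboundary :=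
    (QuotientAddGroup.eq_zero_iff (L.toTildeCocycle ξ)).trans AddSubgroup.mem_addSubgroupOf
  rw [hz]
  constructor
  · rintro ⟨U, hU, h, h1, h2, h3⟩
    -- The function component of the cocycle is 1, so the local functions agree on overlaps and glue
    -- to one nowhere vanishing function.
    have key (p y : M) (hy : y ∈ U p) : h y y = h p y :=
      div_eq_one.1 (h3 y p y ⟨(hU y).2, hy⟩).symm
    refine ⟨fun y => h y y, SmoothOn.of_locally fun x _ => ⟨U x, (hU x).1, (hU x).2,
      (h1 x).congr (key x)⟩, funext fun x => ?_⟩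
    exact (h2 x x (hU x).2).trans (dlog_congr L
      (Filter.eventually_of_mem ((hU x).1.mem_nhds (hU x).2) (key x))).symm
  · rintro ⟨g, hg, h⟩
    exact ⟨_, NbhdCover.univ, fun _ => g, fun _ => hg, fun p y _ => congrFun h y,
      fun p q y _ => (div_self' _).symm⟩

end Connecting

end ComplexLieAlgebroid

/-! ### Systems of local frames, the modular class, and the first Chern class. -/

section Frames

variable {E : Type*} [NormedAddCommGroup E] [NormedSpace ℝ E]
  {M : Type*} [TopologicalSpace M] [ChartedSpace E M] [IsManifold 𝓘(ℝ, E) ∞ M]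
  {F : Type*} [NormedAddCommGroup F] [NormedSpace ℂ F]
  {B : M → Type*} [∀ x, AddCommGroup (B x)] [∀ x, Module ℂ (B x)]
  [∀ x, TopologicalSpace (B x)] [TopologicalSpace (Bundle.TotalSpace F B)] [FiberBundle F B]
  [VectorBundle ℂ F B] [VectorBundle ℝ F B]
  [FiniteDimensional ℝ E] [T2Space M] [FiniteDimensional ℂ F] [ContMDiffVectorBundle ∞ F B 𝓘(ℝ, E)]

/-! ### Systems of local frames of `Q_B` -/

/-- No regularity is claimed here. Smoothness of the quotient is obtained afterwards from
`smoothUnitOn_of_eq_smul`. -/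
theorem exists_transition {e e' : ∀ x : M, QFiber E F B x} {s : Set M}
    (he : ∀ y ∈ s, e y ≠ 0) (he' : ∀ y ∈ s, e' y ≠ 0) :
    ∃ g : M → ℂˣ, ∀ y ∈ s, e' y = (g y : ℂ) • e y := by
  classical
  have h (y) : ∃ g : ℂˣ, y ∈ s → e' y = (g : ℂ) • e y := by
    by_cases hy : y ∈ s
    · obtain ⟨g, hg⟩ := exists_eq_smul (he y hy) (he' y hy)
      exact ⟨g, fun _ => hg⟩
    · exact ⟨1, fun h => absurd h hy⟩
  choose g hg using h
  exact ⟨g, hg⟩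

namespace QFrames

variable (E M F B) in
theorem nonempty : Nonempty (QFrames E M F B) := by
  choose U hU hp e he using exists_isQFrameOn (E := E) (M := M) (F := F) (B := B)
  have h (p q : M) := exists_transition (s := U p ∩ U q) (fun y hy => (he q y hy.2).1)
    (fun y hy => (he p y hy.1).1)
  choose f hf using h
  exact ⟨⟨U, fun p => ⟨hU p, hp p⟩, e, he, f, hf⟩⟩

/-- The system which consists of a single global frame. -/
def const (e : ∀ x : M, QFiber E F B x) (he : IsQFrameOn e Set.univ) : QFrames E M F B :=
  ⟨fun _ => Set.univ, NbhdCover.univ, fun _ => e, fun _ => he, 1,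
    fun _ _ _ _ => (one_smul ℂ _).symm⟩

variable (A : QFrames E M F B)

theorem smoothUnitOn_f (p q : M) : SmoothUnitOn E (A.f p q) (A.U p ∩ A.U q) :=
  smoothUnitOn_of_eq_smul (A.cover.isOpen₂ p q) ((A.frame q).mono Set.inter_subset_right)
    ((A.frame p).mono Set.inter_subset_left) (A.trans p q)

theorem f_mul_f (p q r : M) {y : M} (hy : y ∈ A.U p ∩ A.U q ∩ A.U r) :
    A.f p q y * A.f q r y = A.f p r y := by
  refine Units.ext (eq_of_smul_eq_smul (A.frame r y hy.2).1 ?_)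
  rw [Units.val_mul, mul_smul, ← A.trans q r y (by grind), ← A.trans p q y (by grind),
    ← A.trans p r y (by grind)]

theorem mem_unitCocycle : Additive.ofMul A.f ∈ unitCocycle E M :=
  ⟨A.U, A.cover, A.smoothUnitOn_f, fun p q r _ => A.f_mul_f p q r⟩

/-- If the cocycle of `Q_B` is a coboundary, then `Q_B` has a global frame. -/
theorem exists_global (h : Additive.ofMul A.f ∈ unitCoboundary E M) :
    ∃ e : ∀ x : M, QFiber E F B x, IsQFrameOn e Set.univ := by
  obtain ⟨V, hV, h, h1, h2⟩ := h
  have hUV := A.cover.inter hV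
  -- With transition functions h_p/h_q the rescaled frames h_p⁻¹e_p agree on overlaps. Their common
  -- value at `y` is taken from the member with index `y`.
  let e (y : M) : QFiber E F B y := (((h y)⁻¹ y : ℂˣ) : ℂ) • A.e y y
  refine ⟨e, fun x _ => ?_⟩
  refine IsQFrameOn.smul (e' := e) (g := (h x)⁻¹) (hUV x).1 ((A.frame x).mono Set.inter_subset_left)
    ((h1 x).mono Set.inter_subset_right).inv (fun y hy => ?_) x (hUV x).2
  have hyy := (hUV y).2
  have hf : A.f y x y = h y y / h x y := h2 y x y ⟨hyy.2, hy.2⟩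
  simp only [e]
  rw [A.trans y x y ⟨hyy.1, hy.1⟩, hf, smul_smul, ← Units.val_mul]
  simp [div_eq_mul_inv]

end QFrames

namespace ComplexLieAlgebroid

variable {L : ComplexLieAlgebroid E M F B}

theorem IsModularFormOn.mono {e : ∀ x : M, QFiber E F B x} {ξ : ∀ x : M, Module.Dual ℂ (B x)}
    {s t : Set M} (h : L.IsModularFormOn e ξ s) (hts : t ⊆ s) : L.IsModularFormOn e ξ t :=
  ⟨fun u => (h.1 u).mono hts, fun X x hx => h.2 X x (hts hx)⟩

/-- The modular forms of a system of frames form a cocycle. -/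
theorem mem_tildeCocycle (A : QFrames E M F B) {ξ : M → ∀ x : M, Module.Dual ℂ (B x)}
    (hξ : ∀ p, L.IsModularFormOn (A.e p) (ξ p) (A.U p)) :
    (ξ, Additive.ofMul A.f) ∈ L.tildeCocycle := by
  refine ⟨A.U, A.cover, fun p => (hξ p).isClosedOn (A.cover p).1 (A.frame p), A.smoothUnitOn_f,
    fun p q y hy => ?_, fun p q r _ => A.f_mul_f p q r⟩
  have h := ((hξ q).mono Set.inter_subset_right).smul (A.cover.isOpen₂ p q)
    ((A.frame q).mono Set.inter_subset_right) (A.smoothUnitOn_f p q) (A.trans p q)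
  exact modularForm_unique (hξ p) h hy.1 hy (A.frame p y hy.1).1

/-- The class of the modular forms does not depend on the system of frames. -/
theorem mk_eq_mk_of_frames (A A' : QFrames E M F B) {ξ ξ' : M → ∀ x : M, Module.Dual ℂ (B x)}
    (hξ : ∀ p, L.IsModularFormOn (A.e p) (ξ p) (A.U p))
    (hξ' : ∀ p, L.IsModularFormOn (A'.e p) (ξ' p) (A'.U p)) :
    (QuotientAddGroup.mk (⟨_, mem_tildeCocycle A hξ⟩ : L.tildeCocycle) : L.HTilde1)
      = QuotientAddGroup.mk ⟨_, mem_tildeCocycle A' hξ'⟩ := by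
  have hUV := A.cover.inter A'.cover
  have hA (p) : IsQFrameOn (A.e p) (A.U p ∩ A'.U p) := (A.frame p).mono Set.inter_subset_left
  have hA' (p) : IsQFrameOn (A'.e p) (A.U p ∩ A'.U p) :=
    (A'.frame p).mono Set.inter_subset_right
  have h (p : M) := exists_transition (s := A.U p ∩ A'.U p) (fun y hy => (hA' p y hy).1)
    (fun y hy => (hA p y hy).1)
  choose g hg using h
  have hgs (p) : SmoothUnitOn E (g p) (A.U p ∩ A'.U p) :=
    smoothUnitOn_of_eq_smul (hUV p).1 (hA' p) (hA p) (hg p)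
  refine mk_eq_mk hUV hgs (fun p y hy => ?_) fun p q y hy => ?_
  · exact modularForm_unique (hξ p) (((hξ' p).mono Set.inter_subset_right).smul (hUV p).1 (hA' p)
      (hgs p) (hg p)) hy.1 hy (hA p y hy).1
  -- Both products express `A.e p` in terms of `A'.e q`, passing through `A.e q` on one side and
  -- through `A'.e p` on the other.
  · have e : A.f p q y * g q y = g p y * A'.f p q y := by
      refine Units.ext (eq_of_smul_eq_smul (hA' q y hy.2).1 ?_)
      rw [Units.val_mul, Units.val_mul, mul_smul, mul_smul, ← hg q y hy.2,
        ← A.trans p q y (by grind), ← A'.trans p q y (by grind), ← hg p y hy.1]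
    change A.f p q y = A'.f p q y * (g p y / g q y)
    rw [mul_div_assoc', eq_div_iff_mul_eq', e, mul_comm]

variable (L) in
theorem exists_modularForms (A : QFrames E M F B) : ∃ ξ : M → ∀ x : M, Module.Dual ℂ (B x),
    ∀ p, L.IsModularFormOn (A.e p) (ξ p) (A.U p) := by
  choose ξ _ hξ using fun p => exists_modularForm (L := L) (A.cover p).1 (A.frame p)
  exact ⟨ξ, hξ⟩

variable (L) in
theorem exists_modularClass : ∃ c : L.HTilde1, ∀ (A : QFrames E M F B)
    (ξ : M → ∀ x : M, Module.Dual ℂ (B x))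
    (hξ : ∀ p, L.IsModularFormOn (A.e p) (ξ p) (A.U p)),
    QuotientAddGroup.mk (⟨_, mem_tildeCocycle A hξ⟩ : L.tildeCocycle) = c := by
  obtain ⟨A⟩ := QFrames.nonempty E M F B
  obtain ⟨ξ, hξ⟩ := L.exists_modularForms A
  exact ⟨_, fun A' ξ' hξ' => mk_eq_mk_of_frames A' A hξ' hξ⟩

variable (L) in
/-- The modular class. -/
def modularClass : L.HTilde1 := L.exists_modularClass.choose

theorem mk_eq_modularClass (A : QFrames E M F B) {ξ : M → ∀ x : M, Module.Dual ℂ (B x)}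
    (hξ : ∀ p, L.IsModularFormOn (A.e p) (ξ p) (A.U p)) :
    QuotientAddGroup.mk (⟨_, mem_tildeCocycle A hξ⟩ : L.tildeCocycle) = L.modularClass :=
  L.exists_modularClass.choose_spec A ξ hξ

theorem isModularClass_iff {c : L.HTilde1} : L.IsModularClass c ↔ c = L.modularClass := by
  constructor
  · rintro ⟨A, ξ, hξ, h, rfl⟩
    exact mk_eq_modularClass A hξ
  · rintro rfl
    obtain ⟨A⟩ := QFrames.nonempty E M F B
    obtain ⟨ξ, hξ⟩ := L.exists_modularForms A
    exact ⟨A, ξ, hξ, mem_tildeCocycle A hξ, (mk_eq_modularClass A hξ).symm⟩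

variable (L) in
theorem forget_modularClass (A : QFrames E M F B) :
    L.forget L.modularClass = QuotientAddGroup.mk ⟨_, A.mem_unitCocycle⟩ := by
  obtain ⟨ξ, hξ⟩ := L.exists_modularForms A
  rw [← mk_eq_modularClass A hξ]
  rfl

variable (L) in
-- For every system of frames `forget` maps the modular class to the class of its transition
-- functions. Hence c₁ does not depend on the frames, and it equals τ of the modular class because τ
-- factors through `forget`.
theorem isFirstChernClass_iff [ParacompactSpace M] {c : H2Int M} :
    IsFirstChernClass E F B c ↔ c = L.connecting L.modularClass := by
  have key (A : QFrames E M F B) :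
      IsExpConnecting (QuotientAddGroup.mk (⟨_, A.mem_unitCocycle⟩ : unitCocycle E M)) c ↔
        c = L.connecting L.modularClass := by
    rw [isExpConnecting_iff, connecting, AddMonoidHom.comp_apply, L.forget_modularClass A]
  constructor
  · rintro ⟨A, hf, h⟩
    exact (key A).1 h
  · intro h
    obtain ⟨A⟩ := QFrames.nonempty E M F B
    exact ⟨A, A.mem_unitCocycle, (key A).2 h⟩

variable (L) in
theorem exists_global_frame [SigmaCompactSpace M] [ParacompactSpace M]
    (h : L.connecting L.modularClass = 0) :
    ∃ e : ∀ x : M, QFiber E F B x, IsQFrameOn e Set.univ := by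
  obtain ⟨A⟩ := QFrames.nonempty E M F B
  rw [connecting, AddMonoidHom.comp_apply, L.forget_modularClass A] at h
  exact A.exists_global (mem_unitCoboundary_of_isExpConnecting _ h)

theorem IsModularFormOn.mem_closedForms {e : ∀ x : M, QFiber E F B x}
    {ξ : ∀ x : M, Module.Dual ℂ (B x)} (he : IsQFrameOn e Set.univ)
    (h : L.IsModularFormOn e ξ Set.univ) : ξ ∈ L.closedForms :=
  h.isClosedOn isOpen_univ he

/-- A global frame is a system of frames on the trivial cover with transition functions 1, so its
pair is (ξ, 1). -/
theorem toTilde_mk_modularForm {e : ∀ x : M, QFiber E F B x}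
    {ξ : ∀ x : M, Module.Dual ℂ (B x)} (he : IsQFrameOn e Set.univ)
    (h : L.IsModularFormOn e ξ Set.univ) :
    L.toTilde (QuotientAddGroup.mk ⟨ξ, h.mem_closedForms he⟩) = L.modularClass :=
  mk_eq_modularClass (QFrames.const e he) (ξ := fun _ => ξ) fun _ => h

theorem isELWClass_iff {e : ∀ x : M, QFiber E F B x}
    {ξ : ∀ x : M, Module.Dual ℂ (B x)} (he : IsQFrameOn e Set.univ)
    (h : L.IsModularFormOn e ξ Set.univ) {a : L.H1} :
    L.IsELWClass e a ↔ a = QuotientAddGroup.mk ⟨ξ, h.mem_closedForms he⟩ := by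
  constructor
  · rintro ⟨η, hη, h', rfl⟩
    have e : η = ξ := funext fun x => modularForm_unique hη h trivial trivial (he x trivial).1
    subst e
    rfl
  · rintro rfl
    exact ⟨ξ, h, _, rfl⟩

theorem modularClass_eq_zero_iff {e : ∀ x : M, QFiber E F B x}
    {ξ : ∀ x : M, Module.Dual ℂ (B x)} (he : IsQFrameOn e Set.univ)
    (h : L.IsModularFormOn e ξ Set.univ) : L.modularClass = 0 ↔
      ∃ g : M → ℂˣ, SmoothUnitOn E g Set.univ ∧ ξ = L.dlog g := by
  rw [← toTilde_mk_modularForm he h, toTilde_mk_eq_zero_iff]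

end ComplexLieAlgebroid

end Frames

end CLieAlgd

/-! ### The main theorem. -/

theorem mainTheorem10
    {E : Type*} [NormedAddCommGroup E] [NormedSpace ℝ E] [FiniteDimensional ℝ E]
    {M : Type*} [TopologicalSpace M] [ChartedSpace E M] [IsManifold 𝓘(ℝ, E) ∞ M]
    [T2Space M] [SigmaCompactSpace M]
    {F : Type*} [NormedAddCommGroup F] [NormedSpace ℂ F] [FiniteDimensional ℂ F]
    {B : M → Type*} [∀ x, AddCommGroup (B x)] [∀ x, Module ℂ (B x)]
    [∀ x, TopologicalSpace (B x)] [TopologicalSpace (Bundle.TotalSpace F B)] [FiberBundle F B]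
    [VectorBundle ℂ F B] [VectorBundle ℝ F B] [ContMDiffVectorBundle ∞ F B 𝓘(ℝ, E)]
    (L : CLieAlgd.ComplexLieAlgebroid E M F B) :
    ∃ (τ : L.HTilde1 →+ CLieAlgd.H2Int M) (modB : L.HTilde1) (c₁ : CLieAlgd.H2Int M),
      -- `τ` is the connecting map, and the sequence is exact at `H̃¹(B, ℂ)`
      (∀ a b, L.IsConnecting a b ↔ b = τ a) ∧
      L.toTilde.range = τ.ker ∧
      -- `modB` is the modular class: it is well defined, and given by all local frames
      (∀ a, L.IsModularClass a ↔ a = modB) ∧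
      (∀ A : CLieAlgd.QFrames E M F B,
        (∃ ξ : M → ∀ x : M, Module.Dual ℂ (B x),
          ∀ p, L.IsModularFormOn (A.e p) (ξ p) (A.U p)) ∧
        ∀ ξ : M → ∀ x : M, Module.Dual ℂ (B x),
          (∀ p, L.IsModularFormOn (A.e p) (ξ p) (A.U p)) →
          ∃ h : (ξ, Additive.ofMul A.f) ∈ L.tildeCocycle,
            (QuotientAddGroup.mk (⟨_, h⟩ : L.tildeCocycle) : L.HTilde1) = modB) ∧
      -- `c₁` is the first Chern class of `Q_B`
      (∀ c, CLieAlgd.IsFirstChernClass E F B c ↔ c = c₁) ∧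
      -- the image of the modular class
      τ modB = c₁ ∧
      -- the case of vanishing first Chern class
      (c₁ = 0 →
        (∃ e : ∀ x : M, CLieAlgd.QFiber E F B x, CLieAlgd.IsQFrameOn e Set.univ) ∧
        ∀ e : ∀ x : M, CLieAlgd.QFiber E F B x, CLieAlgd.IsQFrameOn e Set.univ →
          ∃ a : L.H1, (∀ a', L.IsELWClass e a' ↔ a' = a) ∧ L.toTilde a = modB) ∧
      -- unimodularity
      (modB = 0 ↔ c₁ = 0 ∧
        ∃ (e : ∀ x : M, CLieAlgd.QFiber E F B x) (ξ : ∀ x : M, Module.Dual ℂ (B x)),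
          CLieAlgd.IsQFrameOn e Set.univ ∧ L.IsModularFormOn e ξ Set.univ ∧
          ∃ g : M → ℂ, CLieAlgd.SmoothOn E g Set.univ ∧ ξ = L.d0 g) ∧
      (modB = 0 ↔ c₁ = 0 ∧
        ∀ (e : ∀ x : M, CLieAlgd.QFiber E F B x) (ξ : ∀ x : M, Module.Dual ℂ (B x)),
          CLieAlgd.IsQFrameOn e Set.univ → L.IsModularFormOn e ξ Set.univ →
          ∃ g : M → ℂˣ, CLieAlgd.SmoothUnitOn E g Set.univ ∧ ξ = L.dlog g) := by
  have := FiniteDimensional.complete ℝ E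
  -- Together with Hausdorff and σ-compact this yields paracompactness, on which the connecting map
  -- relies.
  have : LocallyCompactSpace M := Manifold.locallyCompact_of_finiteDimensional 𝓘(ℝ, E)
  have hfr (h : L.connecting L.modularClass = 0) := L.exists_global_frame h
  have hmf {e : ∀ x : M, CLieAlgd.QFiber E F B x} (he : CLieAlgd.IsQFrameOn e Set.univ) :=
    CLieAlgd.ComplexLieAlgebroid.exists_modularForm (L := L) isOpen_univ he
  refine ⟨L.connecting, L.modularClass, L.connecting L.modularClass,
    fun _ _ => CLieAlgd.ComplexLieAlgebroid.isConnecting_iff, L.range_toTilde,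
    fun _ => CLieAlgd.ComplexLieAlgebroid.isModularClass_iff,
    fun A => ⟨L.exists_modularForms A, fun ξ hξ =>
      ⟨CLieAlgd.ComplexLieAlgebroid.mem_tildeCocycle A hξ,
        CLieAlgd.ComplexLieAlgebroid.mk_eq_modularClass A hξ⟩⟩,
    fun _ => L.isFirstChernClass_iff, rfl, fun h => ⟨hfr h, fun e he => ?_⟩, ⟨fun h => ?_, ?_⟩,
    ⟨fun h => ⟨by rw [h, map_zero], fun e ξ he hξ =>
      (CLieAlgd.ComplexLieAlgebroid.modularClass_eq_zero_iff he hξ).1 h⟩, ?_⟩⟩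
  · obtain ⟨ξ, -, hξ⟩ := hmf he
    exact ⟨_, fun _ => CLieAlgd.ComplexLieAlgebroid.isELWClass_iff he hξ,
      CLieAlgd.ComplexLieAlgebroid.toTilde_mk_modularForm he hξ⟩
  · have h0 : L.connecting L.modularClass = 0 := by rw [h, map_zero]
    obtain ⟨e, he⟩ := hfr h0
    obtain ⟨ξ, -, hξ⟩ := hmf he
    obtain ⟨g, hg, rfl⟩ := (CLieAlgd.ComplexLieAlgebroid.modularClass_eq_zero_iff he hξ).1 h
    -- The given frame only has ξ = d̃g, and `g` may lack a global logarithm. Rescaling by g⁻¹ makes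
    -- the modular form d̃g - d̃g = 0, which is exact with primitive 0.
    refine ⟨h0, fun y => ((g⁻¹ y : ℂˣ) : ℂ) • e y, _, he.smul isOpen_univ hg.inv fun _ _ => rfl,
      hξ.smul isOpen_univ he hg.inv fun _ _ => rfl, fun _ => 0, CLieAlgd.SmoothOn.const 0 _,
      funext fun x => ?_⟩
    rw [Pi.add_apply, CLieAlgd.ComplexLieAlgebroid.dlog_inv isOpen_univ hg trivial,
      CLieAlgd.ComplexLieAlgebroid.d0, CLieAlgd.cderiv_const, LinearMap.zero_comp, add_neg_cancel]
  · rintro ⟨-, e, ξ, he, hξ, hex⟩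
    rw [← CLieAlgd.ComplexLieAlgebroid.toTilde_mk_modularForm he hξ,
      (QuotientAddGroup.eq_zero_iff _).2 (AddSubgroup.mem_addSubgroupOf.2 hex), map_zero]
  · rintro ⟨h0, h⟩
    -- The condition on all global frames has content only because c₁ = 0 supplies at least one.
    obtain ⟨e, he⟩ := hfr h0
    obtain ⟨ξ, -, hξ⟩ := hmf he
    exact (CLieAlgd.ComplexLieAlgebroid.modularClass_eq_zero_iff he hξ).2 (h e ξ he hξ)
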